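/- Let $\widehat{\mathbb{C}} = \mathbb{C} \cup \{\infty\}$ be the Riemann sphere. Two rational maps $f, g \colon \widehat{\mathbb{C}} \to \widehat{\mathbb{C}}$ are conjugate if $\phi \circ f = g \circ \phi$ for some Möbius transformation $\phi$. If $z_0$ is a periodic point of $f$ with (least) period $n \geq 1$, the multiplier of $f$ at $z_0$, or at the cycle of $z_0$, is the unique eigenvalue of the differential of $f^{\circ n}$ at $z_0$. A rational map $f$ of degree $d \geq 2$ is called - a power map if it is conjugate to $z \mapsto z^{d}$ or to $z \mapsto z^{-d}$; - a Chebyshev map if it is conjugate to $T_d$ or to $-T_d$, where $T_d \in \mathbb{C}[z]$ is the unique polynomial such that $T_d(z + z^{-1}) = z^{d} + z^{-d}$; - a Lattès map if there exist a lattice $\Lambda$ in $\mathbb{C}$, a holomorphic map $L \colon \mathbb{C}/\Lambda \to \mathbb{C}/\Lambda$ and a nonconstant holomorphic map $p \colon \mathbb{C}/\Lambda \to \widehat{\mathbb{C}}$ such that $f \circ p = p \circ L$. **Theorem.** Let $D$ be a positive squarefree integer and let $R_D \subset \mathbb{C}$ be the ring of integers of the imaginary quadratic field $\mathbb{Q}(i\sqrt{D})$.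 Let $f \colon \widehat{\mathbb{C}} \to \widehat{\mathbb{C}}$ be a rational map of degree $2$ whose multiplier at each cycle with period less than or equal to $5$ lies in $R_D$. Then $f$ is a power map, a Chebyshev map or a Lattès map. -/

import Mathlib

noncomputable section

open Polynomial Filter Topology
open scoped OnePoint

/-- The Riemann sphere `ℂ ∪ {∞}`. -/
abbrev RSphere : Type := OnePoint ℂ

namespace RSphere

/-- The standard coordinate of the Riemann sphere centred near `a`: it is `z ↦ z` (defined on `ℂ`)
if `a` is finite and `z ↦ 1/z` (defined on the complement of `0`, with `∞ ↦ 0`) if `a = ∞`. Outside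
its domain the coordinate takes the irrelevant value `0`. -/
def coord (a z : RSphere) : ℂ :=
  a.elim (z.elim 0 fun w => w⁻¹) (fun _ => z.elim 0 id)

/-- The inverse of the coordinate `coord a`, as a map `ℂ → ℂ ∪ {∞}`. -/
def param (a : RSphere) (w : ℂ) : RSphere :=
  a.elim (if w = 0 then ∞ else ((w⁻¹ : ℂ) : RSphere)) (fun _ => (w : RSphere))

/-- The map `z ↦ P(z) / Q(z)` of the Riemann sphere, for coprime polynomials `P` and `Q`: poles are
sent to `∞`, and `∞` is sent to the limit of `P / Q` at `∞`. -/
def ratMap (P Q : ℂ[X]) (z : RSphere) : RSphere :=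
  z.elim
    (if Q.coeff (max P.natDegree Q.natDegree) = 0 then ∞
      else ((P.coeff (max P.natDegree Q.natDegree) / Q.coeff (max P.natDegree Q.natDegree) : ℂ) :
        RSphere))
    (fun w => if Q.eval w = 0 then ∞ else ((P.eval w / Q.eval w : ℂ) : RSphere))

/-- `f` is a rational map of degree `d`. -/
def IsRationalMap (d : ℕ) (f : RSphere → RSphere) : Prop :=
  ∃ P Q : ℂ[X], IsCoprime P Q ∧ max P.natDegree Q.natDegree = d ∧ f = ratMap P Q

/-- `f` and `g` are conjugate by a Möbius transformation. -/
def IsConj (f g : RSphere → RSphere) : Prop :=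
  ∃ φ : GL (Fin 2) ℂ, ∀ z : RSphere, φ • f z = g (φ • z)

/-- The multiplier of `f` at a periodic point `a` of period `n`: the derivative at `a` of `f^n`, read
in a coordinate near `a`. -/
def multiplier (f : RSphere → RSphere) (a : RSphere) : ℂ :=
  deriv (fun w => coord a (f^[Function.minimalPeriod f a] (param a w))) (coord a a)

/-- Power maps: rational maps of degree `d ≥ 2` conjugate to `z ↦ z ^ d` or `z ↦ z ^ (-d)`. -/
def IsPowerMap (f : RSphere → RSphere) : Prop :=
  ∃ d : ℕ, 2 ≤ d ∧ IsRationalMap d f ∧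
    (IsConj f (ratMap (X ^ d) 1) ∨ IsConj f (ratMap 1 (X ^ d)))

/-- Chebyshev maps: rational maps of degree `d ≥ 2` conjugate to `T` or `-T`, where `T` is the monic
Chebyshev polynomial of degree `d`, characterized by `T(z + 1/z) = z ^ d + z ^ (-d)`
(see `eval_chebyshev` below). -/
def IsChebyshevMap (f : RSphere → RSphere) : Prop :=
  ∃ d : ℕ, 2 ≤ d ∧ IsRationalMap d f ∧
    (IsConj f (ratMap (Polynomial.Chebyshev.C ℂ d) 1) ∨
      IsConj f (ratMap (-Polynomial.Chebyshev.C ℂ d) 1))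

theorem eval_chebyshev (d : ℕ) (z : ℂ) (hz : z ≠ 0) :
    (Polynomial.Chebyshev.C ℂ d).eval (z + z⁻¹) = z ^ d + (z ^ d)⁻¹ := by
  induction d using Nat.strong_induction_on with
  | _ d ih =>
    match d, ih with
    | 0, _ => simp; norm_num
    | 1, _ => simp
    | n + 2, ih =>
      have h0 := ih n (by omega)
      have h1 := ih (n + 1) (by omega)
      push_cast at h1 ⊢
      rw [Polynomial.Chebyshev.C_add_two, eval_sub, eval_mul, eval_X, h0, h1]
      field_simp
      ring

/-- A map `F : ℂ → ℂ ∪ {∞}` is holomorphic. -/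
def IsHolomorphic (F : ℂ → RSphere) : Prop :=
  Continuous F ∧ ∀ z : ℂ, AnalyticAt ℂ (fun w => coord (F z) (F w)) z

end RSphere

/-- The complex torus `ℂ / Λ`, where `Λ` is the lattice spanned by two `ℝ`-linearly independent
periods. -/
abbrev CTorus (Λ : PeriodPair) : Type := ℂ ⧸ Λ.lattice

namespace CTorus

/-- The projection `ℂ → ℂ / Λ`. As it is a local biholomorphism, it is used to express that a map
from or to the torus is holomorphic. -/
def proj (Λ : PeriodPair) (z : ℂ) : CTorus Λ := Λ.lattice.mkQ z

/-- A map from the torus to itself is holomorphic if near every point of `ℂ` it lifts to a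
holomorphic function. -/
def IsHolomorphicSelfMap {Λ : PeriodPair} (L : CTorus Λ → CTorus Λ) : Prop :=
  ∀ z : ℂ, ∃ g : ℂ → ℂ, AnalyticAt ℂ g z ∧ ∀ᶠ w in 𝓝 z, L (proj Λ w) = proj Λ (g w)

/-- A map from the torus to the Riemann sphere is holomorphic. -/
def IsHolomorphicToSphere {Λ : PeriodPair} (p : CTorus Λ → RSphere) : Prop :=
  RSphere.IsHolomorphic (fun z => p (proj Λ z))

end CTorus

/-- Lattès maps: rational maps `f` of degree `d ≥ 2` such that `f ∘ p = p ∘ L` for some holomorphic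
`L : ℂ / Λ → ℂ / Λ` and some nonconstant holomorphic `p : ℂ / Λ → ℂ ∪ {∞}`. -/
def RSphere.IsLattesMap (f : RSphere → RSphere) : Prop :=
  ∃ d : ℕ, 2 ≤ d ∧ RSphere.IsRationalMap d f ∧
    ∃ (Λ : PeriodPair) (L : CTorus Λ → CTorus Λ) (p : CTorus Λ → RSphere),
      CTorus.IsHolomorphicSelfMap L ∧ CTorus.IsHolomorphicToSphere p ∧
      (¬ ∃ c : RSphere, ∀ t, p t = c) ∧ f ∘ p = p ∘ L

/-- The ring of integers of the imaginary quadratic field `ℚ(i√D)`, as a subring of `ℂ`. -/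
def imQuadInt (D : ℕ) : Subring ℂ :=
  (IntermediateField.adjoin ℚ {Complex.I * (Real.sqrt D : ℂ)}).toSubring ⊓
    (integralClosure ℤ ℂ).toSubring

end

/-! A quadratic map has three fixed points, counted with multiplicity, and their multipliers satisfy
abc = a + b + c - 2. Unless all three points coincide, in which case the map is conjugate to z +
1/z, it is conjugate to z(z + a)/(bz + 1), where a and b are two of these multipliers
(`exists_isConj_normalForm`). So it suffices to show that integrality leaves finitely many pairs (a,
b), and to decide each of them.

Finiteness has three sources. If no multiplier is 0 or 1, the relation says that the numbers 1/(1 -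
a), 1/(1 - b), 1/(1 - c) have sum 1. Hence the smallest of the moduli |1 - a|, |1 - b|, |1 - c| is
at most 3, and since nonzero elements of the ring have modulus at least 1, the second smallest is at
most 4 (`IsTriple.hasModel_of_le`). If a multiplier is 0, the map is a polynomial z² + c. The
multiplier of a cycle of period 3 is affine in a square root v of -4c - 7, so integrality puts v in
the ring, and (a - 1)² - v² = 8 is a factorisation of 8 (`hasModel_polynomial`). If a multiplier is
1, cycles of period 3 give in the same way v² = (b - 1)(b + 2), and (2b + 1)² - (2v)² = 9 is a
factorisation of 9 (`hasModel_parabolic`). In all cases the elements to be enumerated have bounded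
norm. For large D they are then rational integers, so that finitely many D need a search.

Each candidate is either in the list `special` or has a cycle of period 3, 4 or 5 with a multiplier
outside the ring. The second alternative is certified by integer arithmetic: a polynomial of degree
M has a root within M|p/p'| of any given point (`Polynomial.exists_root_near`), disc arithmetic
encloses the cycle and its multiplier, and a coordinate of the doubled multiplier is seen to lie
strictly between consecutive integers (`CycleCert.exists_cycle_of_check`).

The pairs in `special` belong to z², 1/z², z² - 2 and to Lattès maps. The latter come from the
endomorphisms of degree 2 of tori with complex multiplication, by 1 + i, √-2 and (1 + √-7)/2. Such a
multiplication by α, with kernel {0, t}, descends through ℘ because α²℘(αz) = ℘(z) + ℘(z + t) - ℘(t)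
(`IsIsogeny.sum_formula`) and ℘(z + t) is a Möbius function of ℘(z)
(`IsHalfPeriod.exists_translation`). Special values of ℘ determine the descended map up to scale,
and hence its fixed point multipliers. Passing to ℘², or adding a translation by a half period,
gives the remaining models. -/

noncomputable section

open Polynomial Filter Topology
open scoped OnePoint

/-! ### Homogeneous coordinates, and quadratic maps as pairs of binary forms -/

namespace RSphere

/-- The point of the Riemann sphere with homogeneous coordinates `[u : v]`. -/
def ofHom (u v : ℂ) : RSphere := if v = 0 then ∞ else ((u / v : ℂ) : RSphere)

theorem ofHom_of_ne {u v : ℂ} (hv : v ≠ 0) : ofHom u v = ((u / v : ℂ) : RSphere) := by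
  simp [ofHom, hv]

@[simp] theorem ofHom_zero_right (u : ℂ) : ofHom u 0 = ∞ := by simp [ofHom]

@[simp] theorem ofHom_one_right (u : ℂ) : ofHom u 1 = (u : RSphere) := by simp [ofHom]

theorem ofHom_mul {c : ℂ} (hc : c ≠ 0) (u v : ℂ) : ofHom (c * u) (c * v) = ofHom u v := by
  by_cases hv : v = 0
  · simp [hv]
  · rw [ofHom_of_ne hv, ofHom_of_ne (mul_ne_zero hc hv), mul_div_mul_left _ _ hc]

theorem exists_eq_ofHom (z : RSphere) : ∃ u v : ℂ, (u ≠ 0 ∨ v ≠ 0) ∧ z = ofHom u v := by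
  induction z using OnePoint.rec with
  | infty => exact ⟨1, 0, by simp, by simp⟩
  | coe w => exact ⟨w, 1, by simp, by simp⟩

theorem ofHom_eq_ofHom_iff {u v u' v' : ℂ} (h : u ≠ 0 ∨ v ≠ 0) (h' : u' ≠ 0 ∨ v' ≠ 0) :
    ofHom u v = ofHom u' v' ↔ u * v' = u' * v := by
  by_cases hv : v = 0 <;> by_cases hv' : v' = 0
  · simp [hv, hv']
  · subst hv
    have hu : u ≠ 0 := by simpa using h
    simp [ofHom, hv', hu]
  · subst hv'
    have hu : u' ≠ 0 := by simpa using h'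
    simp [ofHom, hv, hu]
  · rw [ofHom_of_ne hv, ofHom_of_ne hv', OnePoint.coe_eq_coe, div_eq_div_iff hv hv']

theorem smul_ofHom (φ : GL (Fin 2) ℂ) {u v : ℂ} (h : u ≠ 0 ∨ v ≠ 0) :
    φ • ofHom u v = ofHom (φ 0 0 * u + φ 0 1 * v) (φ 1 0 * u + φ 1 1 * v) := by
  by_cases hv : v = 0
  · subst hv
    have hu : u ≠ 0 := by simpa using h
    rw [ofHom_zero_right, OnePoint.smul_infty_eq_ite]
    by_cases h0 : φ 1 0 = 0
    · simp [h0]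
    · simp only [h0, if_false, mul_zero, add_zero]
      rw [ofHom_of_ne (mul_ne_zero h0 hu), mul_div_mul_right _ _ hu]
  · rw [ofHom_of_ne hv, OnePoint.smul_some_eq_ite]
    have e1 : φ 1 0 * (u / v) + φ 1 1 = (φ 1 0 * u + φ 1 1 * v) / v := by field_simp
    have e2 : φ 0 0 * (u / v) + φ 0 1 = (φ 0 0 * u + φ 0 1 * v) / v := by field_simp
    rw [e1, e2]
    by_cases h0 : φ 1 0 * u + φ 1 1 * v = 0
    · simp [h0]
    · rw [ofHom_of_ne h0, if_neg (div_ne_zero h0 hv), div_div_div_cancel_right₀ hv]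

theorem smul_hom_ne_zero (φ : GL (Fin 2) ℂ) {u v : ℂ} (h : u ≠ 0 ∨ v ≠ 0) :
    φ 0 0 * u + φ 0 1 * v ≠ 0 ∨ φ 1 0 * u + φ 1 1 * v ≠ 0 := by
  have hdet : φ 0 0 * φ 1 1 - φ 0 1 * φ 1 0 ≠ 0 := by
    have := φ.det_ne_zero
    rwa [Matrix.det_fin_two] at this
  by_contra hcon
  push Not at hcon
  obtain ⟨h1, h2⟩ := hcon
  rcases h with h | h
  · exact mul_ne_zero hdet h (by linear_combination φ 1 1 * h1 - φ 0 1 * h2)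
  · exact mul_ne_zero hdet h (by linear_combination φ 0 0 * h2 - φ 1 0 * h1)

/-- The Möbius transformation with the given matrix. -/
def mob (a b c d : ℂ) (h : a * d - b * c ≠ 0) : GL (Fin 2) ℂ :=
  Matrix.GeneralLinearGroup.mkOfDetNeZero !![a, b; c, d] (by rwa [Matrix.det_fin_two_of])

theorem mob_smul_ofHom (a b c d : ℂ) (h : a * d - b * c ≠ 0) {u v : ℂ} (huv : u ≠ 0 ∨ v ≠ 0) :
    mob a b c d h • ofHom u v = ofHom (a * u + b * v) (c * u + d * v) := by
  rw [smul_ofHom _ huv]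
  simp [mob, Matrix.GeneralLinearGroup.mkOfDetNeZero]

/-- A pair of binary quadratic forms, seen as a homogeneous self-map of `ℂ²`. -/
structure QuadMap where
  p₂ : ℂ
  p₁ : ℂ
  p₀ : ℂ
  q₂ : ℂ
  q₁ : ℂ
  q₀ : ℂ

namespace QuadMap

variable (F : QuadMap)

/-- The first component. -/
def num (u v : ℂ) : ℂ := F.p₂ * u ^ 2 + F.p₁ * u * v + F.p₀ * v ^ 2

/-- The second component. -/
def den (u v : ℂ) : ℂ := F.q₂ * u ^ 2 + F.q₁ * u * v + F.q₀ * v ^ 2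

/-- The Jacobian determinant of `(num, den)`. -/
def jac (u v : ℂ) : ℂ :=
  (2 * F.p₂ * u + F.p₁ * v) * (F.q₁ * u + 2 * F.q₀ * v) -
    (F.p₁ * u + 2 * F.p₀ * v) * (2 * F.q₂ * u + F.q₁ * v)

/-- The two forms have no common zero. -/
def Nondeg : Prop := ∀ u v : ℂ, F.num u v = 0 → F.den u v = 0 → u = 0 ∧ v = 0

/-- The induced self-map of the Riemann sphere. -/
def toMap (z : RSphere) : RSphere :=
  z.elim (ofHom F.p₂ F.q₂) (fun w => ofHom (F.num w 1) (F.den w 1))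

variable {F}

theorem Nondeg.ne_zero (hF : F.Nondeg) {u v : ℂ} (h : u ≠ 0 ∨ v ≠ 0) :
    F.num u v ≠ 0 ∨ F.den u v ≠ 0 := by
  by_contra hcon
  push Not at hcon
  have := hF u v hcon.1 hcon.2
  tauto

theorem toMap_ofHom (F : QuadMap) {u v : ℂ} (h : u ≠ 0 ∨ v ≠ 0) :
    F.toMap (ofHom u v) = ofHom (F.num u v) (F.den u v) := by
  by_cases hv : v = 0
  · subst hv
    have hu : u ≠ 0 := by simpa using h
    rw [ofHom_zero_right]
    simp only [toMap, OnePoint.elim_infty, num, den]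
    rw [← ofHom_mul (pow_ne_zero 2 hu)]
    congr 1 <;> ring
  · rw [ofHom_of_ne hv]
    simp only [toMap, OnePoint.elim_some]
    rw [← ofHom_mul (pow_ne_zero 2 hv)]
    congr 1 <;> simp only [num, den] <;> field_simp

end QuadMap

/-- Coprimality excludes a common zero at finite points. A common zero at `[1 : 0]` would kill both
coefficients of degree 2, although the larger degree is exactly 2. -/
theorem IsRationalMap.exists_quadMap {f : RSphere → RSphere} (hf : IsRationalMap 2 f) :
    ∃ F : QuadMap, F.Nondeg ∧ f = F.toMap := by
  obtain ⟨P, Q, hPQ, hdeg, rfl⟩ := hf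
  have hP : P.natDegree < 3 := by omega
  have hQ : Q.natDegree < 3 := by omega
  have eP (w : ℂ) : P.eval w = P.coeff 2 * w ^ 2 + P.coeff 1 * w + P.coeff 0 := by
    rw [eval_eq_sum_range' hP]; simp [Finset.sum_range_succ]; ring
  have eQ (w : ℂ) : Q.eval w = Q.coeff 2 * w ^ 2 + Q.coeff 1 * w + Q.coeff 0 := by
    rw [eval_eq_sum_range' hQ]; simp [Finset.sum_range_succ]; ring
  refine ⟨⟨P.coeff 2, P.coeff 1, P.coeff 0, Q.coeff 2, Q.coeff 1, Q.coeff 0⟩, ?_, ?_⟩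
  · intro u v h1 h2
    simp only [QuadMap.num, QuadMap.den] at h1 h2
    have hv : v = 0 := by
      by_contra hv
      obtain ⟨A, B, hAB⟩ := hPQ
      have h := congrArg (eval (u / v)) hAB
      have e1 : P.eval (u / v) = 0 := by
        rw [eP]; field_simp; linear_combination h1
      have e2 : Q.eval (u / v) = 0 := by
        rw [eQ]; field_simp; linear_combination h2
      simp [e1, e2] at h
    subst hv
    refine ⟨?_, rfl⟩
    by_contra hu
    have c1 : P.coeff 2 = 0 := by simpa [hu] using h1
    have c2 : Q.coeff 2 = 0 := by simpa [hu] using h2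
    rcases max_choice P.natDegree Q.natDegree with h | h <;> rw [hdeg] at h
    · rw [h, coeff_natDegree, leadingCoeff_eq_zero] at c1
      simp [c1] at h
    · rw [h, coeff_natDegree, leadingCoeff_eq_zero] at c2
      simp [c2] at h
  · funext z
    induction z using OnePoint.rec with
    | infty => simp [ratMap, QuadMap.toMap, hdeg, ofHom]
    | coe w => simp [ratMap, QuadMap.toMap, ofHom, QuadMap.num, QuadMap.den, eP, eQ]

theorem QuadMap.Nondeg.isRationalMap {F : QuadMap} (hF : F.Nondeg) : IsRationalMap 2 F.toMap := by
  set P : ℂ[X] := C F.p₂ * X ^ 2 + C F.p₁ * X + C F.p₀ with hP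
  set Q : ℂ[X] := C F.q₂ * X ^ 2 + C F.q₁ * X + C F.q₀ with hQ
  have dP : P.natDegree ≤ 2 := natDegree_quadratic_le
  have dQ : Q.natDegree ≤ 2 := natDegree_quadratic_le
  have cP : P.coeff 2 = F.p₂ := by simp [hP]
  have cQ : Q.coeff 2 = F.q₂ := by simp [hQ]
  have hdeg : max P.natDegree Q.natDegree = 2 := by
    apply le_antisymm (max_le dP dQ)
    by_contra hlt
    rw [not_le, max_lt_iff] at hlt
    have h1 : F.p₂ = 0 := by rw [← cP]; exact coeff_eq_zero_of_natDegree_lt hlt.1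
    have h2 : F.q₂ = 0 := by rw [← cQ]; exact coeff_eq_zero_of_natDegree_lt hlt.2
    have := hF 1 0 (by simp [num, h1]) (by simp [den, h2])
    exact one_ne_zero this.1
  refine ⟨P, Q, ?_, hdeg, ?_⟩
  · apply isCoprime_of_irreducible_dvd
    · rintro ⟨h1, h2⟩
      simp [h1, h2] at hdeg
    · intro z hz h1 h2
      obtain ⟨w, hw⟩ := IsAlgClosed.exists_root z (by
        rw [IsAlgClosed.degree_eq_one_of_irreducible ℂ hz]; exact one_ne_zero)
      have e1 : P.eval w = 0 := eval_eq_zero_of_dvd_of_eval_eq_zero h1 hw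
      have e2 : Q.eval w = 0 := eval_eq_zero_of_dvd_of_eval_eq_zero h2 hw
      have := hF w 1 (by simpa [num, hP] using e1) (by simpa [den, hQ] using e2)
      exact one_ne_zero this.2
  · funext z
    induction z using OnePoint.rec with
    | infty => simp [ratMap, QuadMap.toMap, hdeg, ofHom, cP, cQ]
    | coe w => simp [ratMap, QuadMap.toMap, ofHom, QuadMap.num, QuadMap.den, hP, hQ]

end RSphere

/-! ### Derivatives on the sphere and multipliers -/

namespace RSphere

@[simp] theorem coord_coe (a z : ℂ) : coord (a : RSphere) (z : RSphere) = z := rfl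
@[simp] theorem coord_infty_coe (z : ℂ) : coord ∞ (z : RSphere) = z⁻¹ := rfl
@[simp] theorem coord_infty_infty : coord ∞ ∞ = 0 := rfl
@[simp] theorem param_coe (a w : ℂ) : param (a : RSphere) w = (w : RSphere) := rfl

theorem param_infty (w : ℂ) : param ∞ w = ofHom 1 w := by
  simp [param, ofHom]

@[simp] theorem param_coord_self (a : RSphere) : param a (coord a a) = a := by
  induction a using OnePoint.rec with
  | infty => simp [param_infty]
  | coe w => simp

@[simp] theorem coord_param (a : RSphere) (w : ℂ) : coord a (param a w) = w := by
  induction a using OnePoint.rec with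
  | infty =>
    rw [param_infty]
    by_cases hw : w = 0
    · simp [hw]
    · simp [ofHom_of_ne hw]
  | coe a => simp

/-- Reduces limits at any point, ∞ included, to limits in ℂ. At ∞ the reason is that inversion
exchanges the cobounded filter with the punctured neighbourhoods of 0. -/
theorem nhds_eq_map_param (a : RSphere) : 𝓝 a = map (param a) (𝓝 (coord a a)) := by
  induction a using OnePoint.rec with
  | infty =>
    rw [OnePoint.nhds_infty_eq, coclosedCompact_eq_cocompact, ← Metric.cobounded_eq_cocompact]
    have h : 𝓝 (0 : ℂ) = 𝓝[≠] 0 ⊔ pure 0 := by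
      rw [← nhdsNE_sup_pure]
    rw [coord_infty_infty, h, map_sup, map_pure]
    congr 1
    · rw [← Filter.inv_cobounded₀, ← Filter.map_inv, Filter.map_map]
      apply Filter.map_congr
      filter_upwards [Bornology.le_cofinite ℂ (Set.finite_singleton 0).compl_mem_cofinite] with z hz
      have : z⁻¹ ≠ 0 := inv_ne_zero hz
      simp [param_infty, ofHom_of_ne this]
    · simp [param_infty]
  | coe a => rw [OnePoint.nhds_coe_eq]; rfl

theorem tendsto_param (a : RSphere) : Tendsto (param a) (𝓝 (coord a a)) (𝓝 a) := by
  rw [nhds_eq_map_param a]; exact tendsto_map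

theorem param_coord_eventually (a : RSphere) : ∀ᶠ z in 𝓝 a, param a (coord a z) = z := by
  rw [nhds_eq_map_param a, eventually_map]
  simp

/-- `m` is the derivative of `f` at `a`, read in the standard coordinates near `a` and `f a`. -/
def HasSDerivAt (f : RSphere → RSphere) (m : ℂ) (a : RSphere) : Prop :=
  ContinuousAt f a ∧ HasDerivAt (fun w => coord (f a) (f (param a w))) m (coord a a)

theorem HasSDerivAt.comp {f g : RSphere → RSphere} {a : RSphere} {m m' : ℂ}
    (hg : HasSDerivAt g m' (f a)) (hf : HasSDerivAt f m a) :
    HasSDerivAt (g ∘ f) (m' * m) a := by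
  refine ⟨ContinuousAt.comp hg.1 hf.1, ?_⟩
  have h1 : HasDerivAt (fun w => coord (g (f a)) (g (param (f a) w))) m'
      ((fun w => coord (f a) (f (param a w))) (coord a a)) := by
    simpa using hg.2
  refine (HasDerivAt.comp (h := fun w => coord (f a) (f (param a w))) _ h1 hf.2).congr_of_eventuallyEq ?_
  have h2 : Tendsto (fun w => f (param a w)) (𝓝 (coord a a)) (𝓝 (f a)) :=
    hf.1.tendsto.comp (tendsto_param a)
  filter_upwards [h2.eventually (param_coord_eventually (f a))] with w hw
  simp [hw]

theorem hasSDerivAt_id (a : RSphere) : HasSDerivAt id 1 a := by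
  refine ⟨continuousAt_id, ?_⟩
  simpa using! hasDerivAt_id (coord a a)

theorem HasSDerivAt.unique {f : RSphere → RSphere} {a : RSphere} {m m' : ℂ}
    (h : HasSDerivAt f m a) (h' : HasSDerivAt f m' a) : m = m' :=
  h.2.unique h'.2

theorem HasSDerivAt.iterate {f : RSphere → RSphere} {d : RSphere → ℂ}
    (hf : ∀ a, HasSDerivAt f (d a) a) (n : ℕ) (a : RSphere) :
    HasSDerivAt f^[n] (∏ i ∈ Finset.range n, d (f^[i] a)) a := by
  induction n with
  | zero => simpa using hasSDerivAt_id a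
  | succ n ih =>
    rw [Function.iterate_succ', Finset.prod_range_succ, mul_comm]
    exact (hf _).comp ih

theorem HasSDerivAt.multiplier_eq {f : RSphere → RSphere} {a : RSphere} {m : ℂ}
    (h : HasSDerivAt f^[Function.minimalPeriod f a] m a) : multiplier f a = m := by
  have h2 := h.2
  rw [Function.iterate_minimalPeriod] at h2
  exact h2.deriv

theorem continuousAt_ofHom {p : ℂ × ℂ} (hp : p.1 ≠ 0 ∨ p.2 ≠ 0) :
    ContinuousAt (fun p : ℂ × ℂ => ofHom p.1 p.2) p := by
  by_cases h2 : p.2 = 0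
  · have h1 : p.1 ≠ 0 := by tauto
    have e : (fun p : ℂ × ℂ => ofHom p.1 p.2) =ᶠ[𝓝 p] fun q => param ∞ (q.2 / q.1) := by
      filter_upwards [continuousAt_fst.eventually_ne h1] with q hq
      rw [param_infty]
      conv_lhs => rw [← ofHom_mul (inv_ne_zero hq)]
      congr 1 <;> field_simp
    refine ContinuousAt.congr ?_ e.symm
    have h3 : ContinuousAt (param ∞) (p.2 / p.1) := by
      have := tendsto_param ∞
      simpa [ContinuousAt, h2, param_infty] using this
    exact ContinuousAt.comp (f := fun q : ℂ × ℂ => q.2 / q.1) h3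
      (continuousAt_snd.div continuousAt_fst h1)
  · have e : (fun p : ℂ × ℂ => ofHom p.1 p.2) =ᶠ[𝓝 p] fun q => ((q.1 / q.2 : ℂ) : RSphere) := by
      filter_upwards [continuousAt_snd.eventually_ne h2] with q hq
      exact ofHom_of_ne hq
    refine ContinuousAt.congr ?_ e.symm
    exact ContinuousAt.comp (f := fun q : ℂ × ℂ => q.1 / q.2) OnePoint.continuous_coe.continuousAt
      (continuousAt_fst.div continuousAt_snd h2)

/-- The factor relating the homogeneous coordinates `(u, v)` to `(z, 1)` or `(I, 0)`. -/
def hscale (u v : ℂ) : ℂ := if v = 0 then u / Complex.I else v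

theorem hscale_mul {c : ℂ} (hc : c ≠ 0) (u v : ℂ) : hscale (c * u) (c * v) = c * hscale u v := by
  by_cases hv : v = 0
  · simp [hscale, hv, mul_div_assoc]
  · simp [hscale, hv, hc]

theorem hscale_ne_zero {u v : ℂ} (h : u ≠ 0 ∨ v ≠ 0) : hscale u v ≠ 0 := by
  by_cases hv : v = 0
  · simp_all [hscale]
  · simp [hscale, hv]

/-- The division by `I` in `hscale` absorbs a sign: in the chart 1/z the derivative is `-(U' V - U
V') / U ^ 2`, and `(U / I) ^ 2 = -U ^ 2`, so that one formula serves both charts. -/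
theorem hasDerivAt_coord_ofHom {U V : ℂ → ℂ} {U' V' x : ℂ} (hU : HasDerivAt U U' x)
    (hV : HasDerivAt V V' x) (h : U x ≠ 0 ∨ V x ≠ 0) :
    HasDerivAt (fun w => coord (ofHom (U x) (V x)) (ofHom (U w) (V w)))
      ((U' * V x - U x * V') / hscale (U x) (V x) ^ 2) x := by
  by_cases h2 : V x = 0
  · have h1 : U x ≠ 0 := by tauto
    have e : (fun w => coord (ofHom (U x) (V x)) (ofHom (U w) (V w))) =ᶠ[𝓝 x]
        fun w => V w / U w := by
      filter_upwards [hU.continuousAt.eventually_ne h1] with w hw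
      by_cases hv : V w = 0
      · simp [h2, hv]
      · simp [h2, ofHom_of_ne hv]
    refine ((hV.div hU h1).congr_of_eventuallyEq e).congr_deriv ?_
    have hs : hscale (U x) (V x) = U x / Complex.I := by simp [hscale, h2]
    rw [hs, h2, div_pow, Complex.I_sq]
    field_simp
    ring
  · have e : (fun w => coord (ofHom (U x) (V x)) (ofHom (U w) (V w))) =ᶠ[𝓝 x]
        fun w => U w / V w := by
      filter_upwards [hV.continuousAt.eventually_ne h2] with w hw
      simp [ofHom_of_ne hw, ofHom_of_ne h2]
    refine ((hU.div hV h2).congr_of_eventuallyEq e).congr_deriv ?_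
    simp [hscale, h2]

theorem hasSDerivAt_of_hom {f : RSphere → RSphere} {a : RSphere} {U V : ℂ → ℂ} {U' V' : ℂ}
    (hf : ∀ w, f (param a w) = ofHom (U w) (V w)) (hU : HasDerivAt U U' (coord a a))
    (hV : HasDerivAt V V' (coord a a)) (h : U (coord a a) ≠ 0 ∨ V (coord a a) ≠ 0) :
    HasSDerivAt f ((U' * V (coord a a) - U (coord a a) * V') /
      hscale (U (coord a a)) (V (coord a a)) ^ 2) a := by
  have hfa : f a = ofHom (U (coord a a)) (V (coord a a)) := by
    rw [← hf, param_coord_self]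
  constructor
  · rw [ContinuousAt, nhds_eq_map_param a, tendsto_map'_iff, hfa]
    have : f ∘ param a = (fun p : ℂ × ℂ => ofHom p.1 p.2) ∘ fun w => (U w, V w) := by
      funext w; simp [hf]
    rw [this]
    exact (continuousAt_ofHom (p := (U (coord a a), V (coord a a))) h).tendsto.comp
      (hU.continuousAt.prodMk hV.continuousAt)
  · have := hasDerivAt_coord_ofHom hU hV h
    simp only [hf]
    rwa [hfa]

/-- By Euler's relation for forms of degree 2, the Wronskian of the two components in one variable
is half the Jacobian determinant. The scale factors are arranged so as to telescope along an orbit.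
-/
theorem QuadMap.Nondeg.hasSDerivAt {F : QuadMap} (hF : F.Nondeg) {u v : ℂ} (h : u ≠ 0 ∨ v ≠ 0) :
    HasSDerivAt F.toMap
      (F.jac u v / 2 * (hscale u v / hscale (F.num u v) (F.den u v)) ^ 2) (ofHom u v) := by
  by_cases hv : v = 0
  · subst hv
    have hu : u ≠ 0 := by simpa using h
    have hU : HasDerivAt (fun w => F.num 1 w) F.p₁ (coord ∞ ∞) := by
      have := ((hasDerivAt_id (0 : ℂ)).const_mul F.p₁).add
        (((hasDerivAt_id (0 : ℂ)).pow 2).const_mul F.p₀)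
      have := this.const_add F.p₂
      refine (this.congr_of_eventuallyEq (Eventually.of_forall fun w => ?_)).congr_deriv ?_
      · simp [num]; ring
      · simp
    have hV : HasDerivAt (fun w => F.den 1 w) F.q₁ (coord ∞ ∞) := by
      have := ((hasDerivAt_id (0 : ℂ)).const_mul F.q₁).add
        (((hasDerivAt_id (0 : ℂ)).pow 2).const_mul F.q₀)
      have := this.const_add F.q₂
      refine (this.congr_of_eventuallyEq (Eventually.of_forall fun w => ?_)).congr_deriv ?_
      · simp [den]; ring
      · simp
    have h1 := hasSDerivAt_of_hom (f := F.toMap) (a := ∞)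
      (fun w => by rw [param_infty, toMap_ofHom F (by simp)]) hU hV
      (by simpa using hF.ne_zero (u := 1) (v := 0) (by simp))
    rw [ofHom_zero_right]
    convert h1 using 1
    have e1 : F.num u 0 = u ^ 2 * F.num 1 0 := by simp [num]; ring
    have e2 : F.den u 0 = u ^ 2 * F.den 1 0 := by simp [den]; ring
    rw [coord_infty_infty, e1, e2, hscale_mul (pow_ne_zero 2 hu)]
    have hs := hscale_ne_zero (hF.ne_zero (u := 1) (v := 0) (by simp))
    have hs2 : hscale u 0 = u / Complex.I := by simp [hscale]
    rw [hs2, div_pow, div_pow, Complex.I_sq]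
    simp only [jac, num, den] at *
    field_simp
    ring
  · have hU : HasDerivAt (fun w => F.num w 1) (2 * F.p₂ * (u / v) + F.p₁)
        (coord ((u / v : ℂ) : RSphere) ((u / v : ℂ) : RSphere)) := by
      have := (((hasDerivAt_id (u / v)).pow 2).const_mul F.p₂).add
        ((hasDerivAt_id (u / v)).const_mul F.p₁)
      have := this.add_const F.p₀
      refine (this.congr_of_eventuallyEq (Eventually.of_forall fun w => ?_)).congr_deriv ?_
      · simp [num]
      · simp; ring
    have hV : HasDerivAt (fun w => F.den w 1) (2 * F.q₂ * (u / v) + F.q₁)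
        (coord ((u / v : ℂ) : RSphere) ((u / v : ℂ) : RSphere)) := by
      have := (((hasDerivAt_id (u / v)).pow 2).const_mul F.q₂).add
        ((hasDerivAt_id (u / v)).const_mul F.q₁)
      have := this.add_const F.q₀
      refine (this.congr_of_eventuallyEq (Eventually.of_forall fun w => ?_)).congr_deriv ?_
      · simp [den]
      · simp; ring
    have hne := hF.ne_zero (u := u / v) (v := 1) (by simp)
    have h1 := hasSDerivAt_of_hom (f := F.toMap) (a := ((u / v : ℂ) : RSphere))
      (fun w => by rw [param_coe, ← ofHom_one_right, toMap_ofHom F (by simp)]) hU hV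
      (by simpa using hne)
    rw [ofHom_of_ne hv]
    convert h1 using 1
    have e1 : F.num u v = v ^ 2 * F.num (u / v) 1 := by simp [num]; field_simp
    have e2 : F.den u v = v ^ 2 * F.den (u / v) 1 := by simp [den]; field_simp
    rw [coord_coe, e1, e2, hscale_mul (pow_ne_zero 2 hv)]
    have hs := hscale_ne_zero hne
    have hs2 : hscale u v = v := by simp [hscale, hv]
    rw [hs2]
    simp only [jac, num, den] at *
    field_simp
    ring

theorem exists_hasSDerivAt_smul (φ : GL (Fin 2) ℂ) (a : RSphere) :
    ∃ m, HasSDerivAt (fun z => φ • z) m a := by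
  have key (U V : ℂ → ℂ) (hU : Differentiable ℂ U) (hV : Differentiable ℂ V)
      (h0 : ∀ w, U w ≠ 0 ∨ V w ≠ 0) (h : ∀ w, param a w = ofHom (U w) (V w)) :
      ∃ m, HasSDerivAt (fun z => φ • z) m a := by
    refine ⟨_, hasSDerivAt_of_hom (U := fun w => φ 0 0 * U w + φ 0 1 * V w)
      (V := fun w => φ 1 0 * U w + φ 1 1 * V w) (fun w => ?_)
      (DifferentiableAt.hasDerivAt (by fun_prop)) (DifferentiableAt.hasDerivAt (by fun_prop))
      (smul_hom_ne_zero φ (h0 _))⟩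
    rw [h, smul_ofHom _ (h0 w)]
  induction a using OnePoint.rec with
  | infty => exact key (fun _ => 1) id (by fun_prop) (by fun_prop) (by simp) param_infty
  | coe a => exact key id (fun _ => 1) (by fun_prop) (by fun_prop) (by simp) (by simp)

/-- `f` has a derivative at each point of the sphere. -/
def SDifferentiable (f : RSphere → RSphere) : Prop := ∀ a, ∃ m, HasSDerivAt f m a

theorem QuadMap.Nondeg.sdifferentiable {F : QuadMap} (hF : F.Nondeg) :
    SDifferentiable F.toMap := by
  intro a
  obtain ⟨u, v, h, rfl⟩ := exists_eq_ofHom a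
  exact ⟨_, hF.hasSDerivAt h⟩

section Conj

variable {f g : RSphere → RSphere} {φ : GL (Fin 2) ℂ}

theorem semiconj_iterate (h : ∀ z, φ • f z = g (φ • z)) (n : ℕ) (z : RSphere) :
    φ • f^[n] z = g^[n] (φ • z) :=
  (Function.Semiconj.iterate_right (f := fun z : RSphere => φ • z) h n) z

theorem isPeriodicPt_smul_iff (h : ∀ z, φ • f z = g (φ • z)) (n : ℕ) (z : RSphere) :
    Function.IsPeriodicPt g n (φ • z) ↔ Function.IsPeriodicPt f n z := by
  simp only [Function.IsPeriodicPt, Function.IsFixedPt, ← semiconj_iterate h]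
  exact (MulAction.injective φ).eq_iff

theorem minimalPeriod_smul (h : ∀ z, φ • f z = g (φ • z)) (z : RSphere) :
    Function.minimalPeriod g (φ • z) = Function.minimalPeriod f z := by
  apply Nat.dvd_antisymm
  · rw [← Function.isPeriodicPt_iff_minimalPeriod_dvd, isPeriodicPt_smul_iff h]
    exact Function.isPeriodicPt_minimalPeriod f z
  · rw [← Function.isPeriodicPt_iff_minimalPeriod_dvd, ← isPeriodicPt_smul_iff h]
    exact Function.isPeriodicPt_minimalPeriod g _

/-- The derivatives of `φ` and `φ⁻¹` at corresponding points are inverse to each other and cancel in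
the chain rule. -/
theorem multiplier_smul (hf : SDifferentiable f) (h : ∀ z, φ • f z = g (φ • z)) (a : RSphere) :
    multiplier g (φ • a) = multiplier f a := by
  choose d hd using hf
  set n := Function.minimalPeriod f a with hn
  have hF := HasSDerivAt.iterate hd n a
  set m := ∏ i ∈ Finset.range n, d (f^[i] a)
  have hfn : f^[n] a = a := Function.iterate_minimalPeriod
  obtain ⟨k, hk⟩ := exists_hasSDerivAt_smul φ a
  obtain ⟨l, hl⟩ := exists_hasSDerivAt_smul φ⁻¹ (φ • a)
  have hlk : l * k = 1 := by
    have h1 := HasSDerivAt.comp (f := fun z => φ • z) hl hk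
    have h2 : ((fun z : RSphere => φ⁻¹ • z) ∘ fun z => φ • z) = id := by funext z; simp
    rw [h2] at h1
    exact h1.unique (hasSDerivAt_id a)
  have hl' : HasSDerivAt (fun z : RSphere => φ⁻¹ • z) l (φ • a) := hl
  have hF' : HasSDerivAt f^[n] m (φ⁻¹ • φ • a) := by simpa using hF
  have hk' : HasSDerivAt (fun z : RSphere => φ • z) k (f^[n] (φ⁻¹ • φ • a)) := by
    simpa [hfn] using hk
  have hG := (hk'.comp hF').comp (f := fun z : RSphere => φ⁻¹ • z) hl'
  have e : (((fun z : RSphere => φ • z) ∘ f^[n]) ∘ fun z => φ⁻¹ • z) = g^[n] := by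
    funext z
    simp [semiconj_iterate h]
  rw [e] at hG
  rw [HasSDerivAt.multiplier_eq (hn ▸ hF : HasSDerivAt f^[Function.minimalPeriod f a] m a)]
  rw [HasSDerivAt.multiplier_eq (m := k * m * l)]
  · linear_combination m * hlk
  · rwa [minimalPeriod_smul h]

end Conj

/-- All multipliers of `f` at cycles of period at most `5` lie in `R`. -/
def SmallMultipliersIn (R : Subring ℂ) (f : RSphere → RSphere) : Prop :=
  ∀ a ∈ Function.periodicPts f, Function.minimalPeriod f a ≤ 5 → multiplier f a ∈ R

theorem SmallMultipliersIn.conj {R : Subring ℂ} {f g : RSphere → RSphere}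
    (hf : SDifferentiable f) (h : SmallMultipliersIn R f) (hfg : IsConj f g) :
    SmallMultipliersIn R g := by
  obtain ⟨φ, hφ⟩ := hfg
  intro b hb hb5
  obtain ⟨a, rfl⟩ : ∃ a, b = φ • a := ⟨φ⁻¹ • b, by simp⟩
  rw [multiplier_smul hf hφ]
  rw [minimalPeriod_smul hφ] at hb5
  refine h a ?_ hb5
  obtain ⟨n, hn, hp⟩ := hb
  exact ⟨n, hn, (isPeriodicPt_smul_iff hφ n a).1 hp⟩

/-- After telescoping, only the scale factors of the two ends remain, and their quotient is the
factor `c` of the return. Working with vectors makes cycles through ∞ no exception. -/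
theorem QuadMap.Nondeg.multiplier_eq {F : QuadMap} (hF : F.Nondeg) {n : ℕ} {u v : ℕ → ℂ} {c : ℂ}
    (h0 : u 0 ≠ 0 ∨ v 0 ≠ 0) (hc : c ≠ 0)
    (hu : ∀ i, u (i + 1) = F.num (u i) (v i)) (hv : ∀ i, v (i + 1) = F.den (u i) (v i))
    (hun : u n = c * u 0) (hvn : v n = c * v 0)
    (hn : Function.minimalPeriod F.toMap (ofHom (u 0) (v 0)) = n) :
    multiplier F.toMap (ofHom (u 0) (v 0)) =
      (∏ i ∈ Finset.range n, (F.jac (u i) (v i) / 2)) / c ^ 2 := by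
  have hne : ∀ i, u i ≠ 0 ∨ v i ≠ 0 := by
    intro i
    induction i with
    | zero => exact h0
    | succ i ih => rw [hu, hv]; exact hF.ne_zero ih
  have hit : ∀ i, F.toMap^[i] (ofHom (u 0) (v 0)) = ofHom (u i) (v i) := by
    intro i
    induction i with
    | zero => rfl
    | succ i ih => rw [Function.iterate_succ_apply', ih, toMap_ofHom F (hne i), hu, hv]
  have hd : ∀ i, HasSDerivAt F.toMap^[i] ((∏ j ∈ Finset.range i, (F.jac (u j) (v j) / 2)) *
      (hscale (u 0) (v 0) / hscale (u i) (v i)) ^ 2) (ofHom (u 0) (v 0)) := by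
    intro i
    induction i with
    | zero => simpa [div_self (hscale_ne_zero h0)] using hasSDerivAt_id _
    | succ i ih =>
      have h1 := hF.hasSDerivAt (hne i)
      rw [← hit i] at h1
      have h2 := h1.comp ih
      rw [← Function.iterate_succ'] at h2
      convert h2 using 1
      rw [Finset.prod_range_succ, ← hu, ← hv]
      have s1 := hscale_ne_zero (hne i)
      have s2 := hscale_ne_zero (hne (i + 1))
      field_simp
  have hdn := hd n
  rw [← hn] at hdn
  rw [HasSDerivAt.multiplier_eq hdn, hn, hun, hvn, hscale_mul hc]
  have s0 := hscale_ne_zero h0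
  field_simp

end RSphere

/-! ### Normal forms adapted to the fixed points -/

namespace RSphere

theorem IsConj.symm {f g : RSphere → RSphere} (h : IsConj f g) : IsConj g f := by
  obtain ⟨φ, hφ⟩ := h
  refine ⟨φ⁻¹, fun z => ?_⟩
  have := hφ (φ⁻¹ • z)
  rw [smul_inv_smul] at this
  rw [← this, inv_smul_smul]

theorem IsConj.trans {f g h : RSphere → RSphere} (h₁ : IsConj f g) (h₂ : IsConj g h) :
    IsConj f h := by
  obtain ⟨φ, hφ⟩ := h₁
  obtain ⟨ψ, hψ⟩ := h₂
  exact ⟨ψ * φ, fun z => by rw [mul_smul, hφ, hψ, mul_smul]⟩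

namespace QuadMap

theorem isConj_of_hom {F G : QuadMap} (hF : F.Nondeg) {a b c d : ℂ}
    (h : a * d - b * c ≠ 0)
    (h1 : ∀ u v, G.num (a * u + b * v) (c * u + d * v) = a * F.num u v + b * F.den u v)
    (h2 : ∀ u v, G.den (a * u + b * v) (c * u + d * v) = c * F.num u v + d * F.den u v) :
    IsConj F.toMap G.toMap := by
  refine ⟨mob a b c d h, fun z => ?_⟩
  obtain ⟨u, v, huv, rfl⟩ := exists_eq_ofHom z
  have hne : a * u + b * v ≠ 0 ∨ c * u + d * v ≠ 0 := by
    simpa [mob, Matrix.GeneralLinearGroup.mkOfDetNeZero] using smul_hom_ne_zero (mob a b c d h) huv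
  rw [toMap_ofHom F huv, mob_smul_ofHom _ _ _ _ _ (hF.ne_zero huv), mob_smul_ofHom _ _ _ _ _ huv,
    toMap_ofHom G hne, h1, h2]

/-- The map `z ↦ z (z + a) / (b z + 1)`: it fixes `0` and `∞` with multipliers `a` and `b`. -/
def normalForm (a b : ℂ) : QuadMap := ⟨1, a, 0, 0, b, 1⟩

theorem nondeg_normalForm {a b : ℂ} (h : a * b ≠ 1) : (normalForm a b).Nondeg := by
  intro u v h1 h2
  simp only [num, den, normalForm] at h1 h2
  have h3 : u * (u + a * v) = 0 := by linear_combination h1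
  have h4 : v * (b * u + v) = 0 := by linear_combination h2
  rcases mul_eq_zero.1 h3 with h5 | h5
  · subst h5
    exact ⟨rfl, by simpa using h4⟩
  · have hu : u = -(a * v) := by linear_combination h5
    subst hu
    have : v = 0 := by
      by_contra hv
      rcases mul_eq_zero.1 h4 with h6 | h6
      · exact hv h6
      · have : (1 - a * b) * v = 0 := by linear_combination h6
        rcases mul_eq_zero.1 this with h7 | h7
        · exact h (by linear_combination -h7)
        · exact hv h7
    simp [this]

/-- The map `z ↦ z + 1 / z`. -/
def parabolicMap : QuadMap := ⟨1, 0, 1, 0, 1, 0⟩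

theorem nondeg_parabolicMap : parabolicMap.Nondeg := by
  intro u v h1 h2
  simp only [num, den, parabolicMap] at h1 h2
  have h3 : u * v = 0 := by linear_combination h2
  rcases mul_eq_zero.1 h3 with h | h <;> simp_all

/-- A quadratic map with two distinct fixed points is determined up to conjugation by the
multipliers at these points. -/
theorem isConj_normalForm {F : QuadMap} (hF : F.Nondeg) {u₁ v₁ u₂ v₂ a b : ℂ}
    (hδ : u₂ * v₁ - u₁ * v₂ ≠ 0)
    (hx : F.num u₁ v₁ = u₁) (hx' : F.den u₁ v₁ = v₁)
    (hy : F.num u₂ v₂ = u₂) (hy' : F.den u₂ v₂ = v₂)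
    (hB : 2 * F.p₂ * u₁ * u₂ + F.p₁ * (u₁ * v₂ + u₂ * v₁) + 2 * F.p₀ * v₁ * v₂ = a * u₂ + b * u₁)
    (hB' : 2 * F.q₂ * u₁ * u₂ + F.q₁ * (u₁ * v₂ + u₂ * v₁) + 2 * F.q₀ * v₁ * v₂ =
      a * v₂ + b * v₁) :
    a * b ≠ 1 ∧ IsConj F.toMap (normalForm a b).toMap := by
  -- In the basis of the two fixed vectors x₂, x₁ one has F(u x₂ + v x₁) = u² x₂ + u v B + v² x₁,
  -- with B the polarisation of F. The hypotheses `hB` and `hB'` expand B in the same basis.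
  have e1 : ∀ u v, F.num (u₂ * u + u₁ * v) (v₂ * u + v₁ * v) =
      u₂ * (normalForm a b).num u v + u₁ * (normalForm a b).den u v := by
    intro u v
    simp only [num, den, normalForm] at *
    linear_combination v ^ 2 * hx + u ^ 2 * hy + u * v * hB
  have e2 : ∀ u v, F.den (u₂ * u + u₁ * v) (v₂ * u + v₁ * v) =
      v₂ * (normalForm a b).num u v + v₁ * (normalForm a b).den u v := by
    intro u v
    simp only [num, den, normalForm] at *
    linear_combination v ^ 2 * hx' + u ^ 2 * hy' + u * v * hB'
  -- If `a * b = 1`, both forms of the normal form vanish at `(-a, 1)`, which the basis carries to a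
  -- common zero of `F`.
  have hab : a * b ≠ 1 := by
    intro hab
    have h1 : (normalForm a b).num (-a) 1 = 0 := by simp [num, normalForm]; ring
    have h2 : (normalForm a b).den (-a) 1 = 0 := by
      simp [den, normalForm]; linear_combination -hab
    have f1 := e1 (-a) 1
    have f2 := e2 (-a) 1
    rw [h1, h2] at f1 f2
    obtain ⟨h3, h4⟩ := hF _ _ (by simpa using f1) (by simpa using f2)
    apply hδ
    have h5 : a * (u₂ * v₁ - u₁ * v₂) = 0 := by linear_combination u₁ * h4 - v₁ * h3
    rcases mul_eq_zero.1 h5 with h6 | h6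
    · simp [h6] at hab
    · exact h6
  exact ⟨hab, (isConj_of_hom (nondeg_normalForm hab) (by rwa [mul_comm u₁] at *) e1 e2).symm⟩

/-- Exchanging the fixed points `0` and `∞`. -/
theorem isConj_normalForm_swap {a b : ℂ} (h : a * b ≠ 1) :
    IsConj (normalForm a b).toMap (normalForm b a).toMap := by
  refine (isConj_normalForm (u₁ := 1) (v₁ := 0) (u₂ := 0) (v₂ := 1) (nondeg_normalForm h)
    (by simp) ?_ ?_ ?_ ?_ ?_ ?_).2 <;> simp [num, den, normalForm]

/-- Moving the third fixed point to `∞`. -/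
theorem isConj_normalForm_third {a b c : ℂ} (h : a * b ≠ 1) (ha : a ≠ 1)
    (hc : c * (1 - a * b) = 2 - a - b) :
    a * c ≠ 1 ∧ IsConj (normalForm a b).toMap (normalForm a c).toMap := by
  have h0 : 1 - a * b ≠ 0 := fun h' => h (by linear_combination -h')
  have ha' : 1 - a ≠ 0 := fun h' => ha (by linear_combination -h')
  have hc' : c = (2 - a - b) / (1 - a * b) := by rw [eq_div_iff h0, hc]
  -- The third fixed point is (1 - a)/(1 - b); the common denominator `1 - a * b` makes the vector
  -- itself fixed.
  refine isConj_normalForm (u₁ := 0) (v₁ := 1) (u₂ := (1 - a) / (1 - a * b))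
    (v₂ := (1 - b) / (1 - a * b)) (nondeg_normalForm h) ?_ ?_ ?_ ?_ ?_ ?_ ?_
  · simpa using ⟨ha', h0⟩
  all_goals (try simp only [num, den, normalForm, hc']); field_simp; try ring

theorem exists_quadratic_root {a b c : ℂ} (h : ¬ (a = 0 ∧ b = 0 ∧ c ≠ 0)) :
    ∃ z : ℂ, a * z ^ 2 + b * z + c = 0 := by
  by_cases ha : a = 0
  · subst ha
    by_cases hb : b = 0
    · subst hb
      have hc : c = 0 := by simpa using h
      exact ⟨0, by simp [hc]⟩
    · exact ⟨-c / b, by field_simp; ring⟩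
  · obtain ⟨s, hs⟩ := IsAlgClosed.exists_pow_nat_eq (b ^ 2 - 4 * a * c) (n := 2) (by norm_num)
    refine ⟨(-b + s) / (2 * a), ?_⟩
    field_simp
    linear_combination hs

/-- Fixed points are the zeros of the cubic form `v * num - u * den`. A vector mapped to `c` times
itself becomes a fixed vector when divided by `c`, because the forms have degree 2. -/
theorem exists_fixed (F : QuadMap) (hF : F.Nondeg) :
    ∃ u v, (u ≠ 0 ∨ v ≠ 0) ∧ F.num u v = u ∧ F.den u v = v := by
  obtain ⟨u, v, huv, h⟩ : ∃ u v : ℂ, (u ≠ 0 ∨ v ≠ 0) ∧ v * F.num u v = u * F.den u v := by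
    by_cases hq : F.q₂ = 0
    · exact ⟨1, 0, by simp, by simp [den, hq]⟩
    · set p : ℂ[X] := C F.q₂ * X ^ 3 + C (F.q₁ - F.p₂) * X ^ 2 + C (F.q₀ - F.p₁) * X + C (-F.p₀)
        with hp
      have hd : p.degree ≠ 0 := by rw [hp, degree_cubic hq]; decide
      obtain ⟨z, hz⟩ := IsAlgClosed.exists_root p hd
      refine ⟨z, 1, by simp, ?_⟩
      simp [hp, IsRoot] at hz
      simp only [num, den]
      linear_combination -hz
  obtain ⟨c, h1, h2⟩ : ∃ c, F.num u v = c * u ∧ F.den u v = c * v := by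
    by_cases hv : v = 0
    · have hu : u ≠ 0 := by tauto
      refine ⟨F.num u v / u, by field_simp, ?_⟩
      field_simp
      linear_combination -h
    · refine ⟨F.den u v / v, ?_, by field_simp⟩
      field_simp
      linear_combination h
  have hc : c ≠ 0 := by
    rintro rfl
    have := hF.ne_zero huv
    simp [h1, h2] at this
  refine ⟨u / c, v / c, by simpa [hc] using huv, ?_, ?_⟩
  · have : F.num (u / c) (v / c) = F.num u v / c ^ 2 := by simp only [num]; field_simp
    rw [this, h1]; field_simp
  · have : F.den (u / c) (v / c) = F.den u v / c ^ 2 := by simp only [den]; field_simp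
    rw [this, h2]; field_simp

/-- The homogeneous map read in another basis of `ℂ²`, whose matrix is `[a, b; c, d]`. -/
def baseChange (F : QuadMap) (a b c d : ℂ) : QuadMap :=
  let B := 2 * F.p₂ * a * b + F.p₁ * (a * d + b * c) + 2 * F.p₀ * c * d
  let B' := 2 * F.q₂ * a * b + F.q₁ * (a * d + b * c) + 2 * F.q₀ * c * d
  let δ := a * d - b * c
  ⟨(d * F.num a c - b * F.den a c) / δ, (d * B - b * B') / δ, (d * F.num b d - b * F.den b d) / δ,
    (a * F.den a c - c * F.num a c) / δ, (a * B' - c * B) / δ, (a * F.den b d - c * F.num b d) / δ⟩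

theorem baseChange_spec (F : QuadMap) {a b c d : ℂ} (h : a * d - b * c ≠ 0) (u v : ℂ) :
    F.num (a * u + b * v) (c * u + d * v) =
      a * (F.baseChange a b c d).num u v + b * (F.baseChange a b c d).den u v ∧
    F.den (a * u + b * v) (c * u + d * v) =
      c * (F.baseChange a b c d).num u v + d * (F.baseChange a b c d).den u v := by
  constructor
  all_goals
    simp only [num, den, baseChange]
    field_simp
    ring

theorem Nondeg.baseChange {F : QuadMap} (hF : F.Nondeg) {a b c d : ℂ} (h : a * d - b * c ≠ 0) :
    (F.baseChange a b c d).Nondeg := by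
  intro u v h1 h2
  obtain ⟨e1, e2⟩ := F.baseChange_spec h u v
  rw [h1, h2] at e1 e2
  obtain ⟨h3, h4⟩ := hF _ _ (by simpa using e1) (by simpa using e2)
  constructor
  · refine (mul_eq_zero.1 ?_).resolve_left h
    linear_combination d * h3 - b * h4
  · refine (mul_eq_zero.1 ?_).resolve_left h
    linear_combination a * h4 - c * h3

theorem Nondeg.isConj_baseChange {F : QuadMap} (hF : F.Nondeg) {a b c d : ℂ}
    (h : a * d - b * c ≠ 0) : IsConj F.toMap (F.baseChange a b c d).toMap :=
  (isConj_of_hom (hF.baseChange h) h (fun u v => (F.baseChange_spec h u v).1)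
    (fun u v => (F.baseChange_spec h u v).2)).symm

/-- The other fixed points solve `(1 - q₁) z² + (p₁ - q₀) z + p₀ = 0`. There is no solution only
when this is a nonzero constant, and then the map is `z + p₀ / (z + q₀)`: a translation and a
scaling by a square root of `p₀` bring it to z + 1/z. -/
theorem exists_isConj_normalForm_of_infty {F : QuadMap} (hF : F.Nondeg) (hp : F.p₂ = 1)
    (hq : F.q₂ = 0) : (∃ a b, a * b ≠ 1 ∧ IsConj F.toMap (normalForm a b).toMap) ∨
      IsConj F.toMap parabolicMap.toMap := by
  by_cases hcase : (1 - F.q₁ = 0 ∧ F.p₁ - F.q₀ = 0 ∧ F.p₀ ≠ 0)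
  · right
    obtain ⟨h1, h2, h3⟩ := hcase
    obtain ⟨s, hs⟩ := IsAlgClosed.exists_pow_nat_eq F.p₀ (n := 2) (by norm_num)
    have hs0 : s ≠ 0 := by rintro rfl; simp at hs; exact h3 hs.symm
    have hq1 : F.q₁ = 1 := by linear_combination -h1
    have hp1 : F.p₁ = F.q₀ := by linear_combination h2
    refine (isConj_of_hom (a := 1) (b := - F.q₀ / s) (c := 0) (d := 1 / s) nondeg_parabolicMap
      (by simpa using hs0) ?_ ?_).symm
    · intro u v
      simp only [num, den, parabolicMap, hp, hp1]
      field_simp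
      linear_combination -v ^ 2 * hs
    · intro u v
      simp only [num, den, parabolicMap, hq, hq1]
      field_simp
      ring
  · left
    obtain ⟨z, hz⟩ := exists_quadratic_root hcase
    have hden : F.q₁ * z + F.q₀ ≠ 0 := by
      intro h0
      have := hF z 1 (by simp only [num, hp]; linear_combination hz + z * h0)
        (by simp only [den, hq]; linear_combination h0)
      exact one_ne_zero this.2
    set k := F.q₁ * z + F.q₀ with hk
    refine ⟨(2 * z + F.p₁ - z * F.q₁) / k, F.q₁, isConj_normalForm hF (u₁ := z / k)
      (v₁ := 1 / k) (u₂ := 1) (v₂ := 0) ?_ ?_ ?_ ?_ ?_ ?_ ?_⟩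
    · simpa using hden
    · simp only [num, hp]; field_simp; linear_combination hz - z * hk
    · simp only [den, hq]; field_simp; linear_combination -hk
    · simp [num, hp]
    · simp [den, hq]
    · rw [hp]; field_simp; ring
    · rw [hq]; field_simp; ring

/-- Every quadratic map is conjugate to a normal form. -/
theorem exists_isConj_normalForm {F : QuadMap} (hF : F.Nondeg) :
    (∃ a b, a * b ≠ 1 ∧ IsConj F.toMap (normalForm a b).toMap) ∨
      IsConj F.toMap parabolicMap.toMap := by
  obtain ⟨u, v, huv, h1, h2⟩ := exists_fixed F hF
  obtain ⟨b, d, hδ⟩ : ∃ b d, u * d - b * v ≠ 0 := by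
    rcases huv with h | h
    · exact ⟨0, 1, by simpa using h⟩
    · exact ⟨1, 0, by simpa using h⟩
  have hc := hF.isConj_baseChange hδ
  have key := exists_isConj_normalForm_of_infty (hF.baseChange hδ)
    (by simp only [baseChange, h1, h2]; rw [div_eq_one_iff_eq hδ]; ring)
    (by simp only [baseChange, h1, h2]; rw [div_eq_zero_iff]; left; ring)
  rcases key with ⟨a', b', h, h'⟩ | h
  · exact Or.inl ⟨a', b', h, hc.trans h'⟩
  · exact Or.inr (hc.trans h)

end QuadMap

/-! ### Holomorphic maps to the sphere as local quotients, and conjugates of Lattès maps -/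

theorem isHolomorphic_of_hom {F : ℂ → RSphere}
    (h : ∀ z, ∃ U V : ℂ → ℂ, AnalyticAt ℂ U z ∧ AnalyticAt ℂ V z ∧ (U z ≠ 0 ∨ V z ≠ 0) ∧
      ∀ᶠ w in 𝓝 z, F w = ofHom (U w) (V w)) : IsHolomorphic F := by
  constructor
  · rw [continuous_iff_continuousAt]
    intro z
    obtain ⟨U, V, hU, hV, h0, he⟩ := h z
    refine ContinuousAt.congr ?_ (he.mono fun w hw => hw.symm)
    exact ContinuousAt.comp (f := fun w => (U w, V w))
      (continuousAt_ofHom (p := (U z, V z)) h0) (hU.continuousAt.prodMk hV.continuousAt)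
  · intro z
    obtain ⟨U, V, hU, hV, h0, he⟩ := h z
    rw [he.self_of_nhds]
    by_cases h2 : V z = 0
    · have h1 : U z ≠ 0 := by tauto
      refine (hV.div hU h1).congr ?_
      filter_upwards [he, hU.continuousAt.eventually_ne h1] with w hw hw'
      rw [hw]
      by_cases hv : V w = 0
      · simp [h2, hv]
      · simp [h2, ofHom_of_ne hv]
    · refine (hU.div hV h2).congr ?_
      filter_upwards [he, hV.continuousAt.eventually_ne h2] with w hw hw'
      simp [hw, ofHom_of_ne hw', ofHom_of_ne h2]

theorem IsHolomorphic.exists_hom {F : ℂ → RSphere} (hF : IsHolomorphic F) (z : ℂ) :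
    ∃ U V : ℂ → ℂ, AnalyticAt ℂ U z ∧ AnalyticAt ℂ V z ∧ (U z ≠ 0 ∨ V z ≠ 0) ∧
      ∀ᶠ w in 𝓝 z, F w = ofHom (U w) (V w) := by
  have h1 := hF.2 z
  have h2 : ∀ᶠ w in 𝓝 z, param (F z) (coord (F z) (F w)) = F w :=
    hF.1.continuousAt.eventually (param_coord_eventually (F z))
  generalize F z = a at h1 h2
  induction a using OnePoint.rec with
  | infty =>
    refine ⟨fun _ => 1, _, analyticAt_const, h1, by simp, ?_⟩
    filter_upwards [h2] with w hw
    rw [← param_infty, hw]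
  | coe a =>
    refine ⟨_, fun _ => 1, h1, analyticAt_const, by simp, ?_⟩
    filter_upwards [h2] with w hw
    rw [ofHom_one_right]
    exact hw.symm

theorem IsHolomorphic.smul {F : ℂ → RSphere} (hF : IsHolomorphic F) (φ : GL (Fin 2) ℂ) :
    IsHolomorphic fun z => φ • F z := by
  refine isHolomorphic_of_hom fun z => ?_
  obtain ⟨U, V, hU, hV, h0, he⟩ := hF.exists_hom z
  refine ⟨fun w => φ 0 0 * U w + φ 0 1 * V w, fun w => φ 1 0 * U w + φ 1 1 * V w,
    by fun_prop, by fun_prop, smul_hom_ne_zero φ h0, ?_⟩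
  have hne : ∀ᶠ w in 𝓝 z, U w ≠ 0 ∨ V w ≠ 0 := by
    rcases h0 with h | h
    · exact (hU.continuousAt.eventually_ne h).mono fun _ => Or.inl
    · exact (hV.continuousAt.eventually_ne h).mono fun _ => Or.inr
  filter_upwards [he, hne] with w hw hw'
  rw [hw, smul_ofHom _ hw']

theorem IsLattesMap.of_isConj {f g : RSphere → RSphere} (hf : IsRationalMap 2 f)
    (hfg : IsConj f g) (hg : IsLattesMap g) : IsLattesMap f := by
  obtain ⟨φ, hφ⟩ := hfg.symm
  obtain ⟨_, _, _, Λ, L, p, hL, hp, hne, hgp⟩ := hg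
  refine ⟨2, le_rfl, hf, Λ, L, fun t => φ • p t, hL, hp.smul φ, ?_, ?_⟩
  · rintro ⟨c, hc⟩
    exact hne ⟨φ⁻¹ • c, fun t => by rw [← hc t, inv_smul_smul]⟩
  · funext t
    have := congrFun hgp t
    simp only [Function.comp_apply] at this ⊢
    rw [← hφ, this]

end RSphere

/-! ### Integer disc arithmetic and certificates for cycles -/

/-- The element `x + y √-D` of the ring `ℤ[√-D]`; the integer `D` is an argument of the
multiplication. -/
structure ZRoot where
  x : ℤ
  y : ℤ

instance : DecidableEq ZRoot := fun a b =>
  decidable_of_iff (a.x = b.x ∧ a.y = b.y) (by cases a; cases b; simp)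

namespace ZRoot

def add (a b : ZRoot) : ZRoot := ⟨a.x + b.x, a.y + b.y⟩
def sub (a b : ZRoot) : ZRoot := ⟨a.x - b.x, a.y - b.y⟩
def mul (D : ℕ) (a b : ZRoot) : ZRoot := ⟨a.x * b.x - D * (a.y * b.y), a.x * b.y + a.y * b.x⟩
def conj (a : ZRoot) : ZRoot := ⟨a.x, -a.y⟩
def ofNat (n : ℕ) : ZRoot := ⟨n, 0⟩

/-- An upper bound of the modulus, if `D ≤ s ^ 2`. -/
def ub (s : ℕ) (a : ZRoot) : ℕ := a.x.natAbs + s * a.y.natAbs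

/-- A lower bound of the modulus. -/
def lb (a : ZRoot) : ℕ := max a.x.natAbs a.y.natAbs

end ZRoot

/-- The disc with the given centre and radius. -/
structure ZDisc where
  c : ZRoot
  ρ : ℕ

namespace ZDisc

def add (a b : ZDisc) : ZDisc := ⟨a.c.add b.c, a.ρ + b.ρ⟩
def sub (a b : ZDisc) : ZDisc := ⟨a.c.sub b.c, a.ρ + b.ρ⟩
def mul (D s : ℕ) (a b : ZDisc) : ZDisc :=
  ⟨a.c.mul D b.c, a.c.ub s * b.ρ + b.c.ub s * a.ρ + a.ρ * b.ρ⟩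
def const (a : ZRoot) : ZDisc := ⟨a, 0⟩

/-- The disc does not contain `0`. -/
def apart (a : ZDisc) : Bool := decide (a.ρ < a.c.lb)

end ZDisc

/-- Coefficients in `ℤ[√-D]` of a quadratic map. -/
structure ZQuad where
  p₂ : ZRoot
  p₁ : ZRoot
  p₀ : ZRoot
  q₂ : ZRoot
  q₁ : ZRoot
  q₀ : ZRoot

namespace ZQuad

/-- The value at `(u, v)` of the binary quadratic form with the given coefficients. -/
def form (D : ℕ) (a b c u v : ZRoot) : ZRoot :=
  ((a.mul D (u.mul D u)).add (b.mul D (u.mul D v))).add (c.mul D (v.mul D v))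

/-- The derivative of the form at `(u, v)` in the given direction. -/
def dform (D : ℕ) (a b c u v u' v' : ZRoot) : ZRoot :=
  ((a.mul D ((ZRoot.ofNat 2).mul D (u.mul D u'))).add
    (b.mul D ((u'.mul D v).add (u.mul D v')))).add
      (c.mul D ((ZRoot.ofNat 2).mul D (v.mul D v')))

def dstep (D : ℕ) (F : ZQuad) (t : (ZRoot × ZRoot) × (ZRoot × ZRoot)) :
    (ZRoot × ZRoot) × (ZRoot × ZRoot) :=
  ((form D F.p₂ F.p₁ F.p₀ t.1.1 t.1.2, form D F.q₂ F.q₁ F.q₀ t.1.1 t.1.2),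
    (dform D F.p₂ F.p₁ F.p₀ t.1.1 t.1.2 t.2.1 t.2.2,
      dform D F.q₂ F.q₁ F.q₀ t.1.1 t.1.2 t.2.1 t.2.2))

/-- The orbit of `(w, N)`, with its derivative with respect to `w`. -/
def dorbit (D : ℕ) (F : ZQuad) (w N : ZRoot) : ℕ → (ZRoot × ZRoot) × (ZRoot × ZRoot)
  | 0 => ((w, N), (⟨1, 0⟩, ⟨0, 0⟩))
  | n + 1 => dstep D F (dorbit D F w N n)

def discForm (D s : ℕ) (a b c : ZRoot) (u v : ZDisc) : ZDisc :=
  (((ZDisc.const a).mul D s (u.mul D s u)).add ((ZDisc.const b).mul D s (u.mul D s v))).add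
    ((ZDisc.const c).mul D s (v.mul D s v))

def discOrbit (D s : ℕ) (F : ZQuad) (u v : ZDisc) : ℕ → ZDisc × ZDisc
  | 0 => (u, v)
  | n + 1 => (discForm D s F.p₂ F.p₁ F.p₀ (discOrbit D s F u v n).1 (discOrbit D s F u v n).2,
      discForm D s F.q₂ F.q₁ F.q₀ (discOrbit D s F u v n).1 (discOrbit D s F u v n).2)

def discJac (D s : ℕ) (F : ZQuad) (u v : ZDisc) : ZDisc :=
  let lin (a b : ZRoot) : ZDisc :=
    ((ZDisc.const a).mul D s u).add ((ZDisc.const b).mul D s v)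
  let two (a : ZRoot) : ZRoot := ⟨2 * a.x, 2 * a.y⟩
  ((lin (two F.p₂) F.p₁).mul D s (lin F.q₁ (two F.q₀))).sub
    ((lin F.p₁ (two F.p₀)).mul D s (lin (two F.q₂) F.q₁))

def discJacProd (D s : ℕ) (F : ZQuad) (u v : ZDisc) : ℕ → ZDisc
  | 0 => ZDisc.const ⟨1, 0⟩
  | n + 1 => (discJacProd D s F u v n).mul D s
      (discJac D s F (discOrbit D s F u v n).1 (discOrbit D s F u v n).2)

/-- The orbit of the points of the disc has no period less than `n`. -/
def discAperiodic (D s : ℕ) (F : ZQuad) (u v : ZDisc) : ℕ → Bool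
  | 0 => true
  | 1 => true
  | n + 2 => discAperiodic D s F u v (n + 1) &&
      ((u.mul D s (discOrbit D s F u v (n + 1)).2).sub
        ((discOrbit D s F u v (n + 1)).1.mul D s v)).apart

end ZQuad

/-- An approximate cycle of period `n` of a quadratic map, through `w / N`, together with the
bounds `ε` on the error and `K` on the multiplier. If `im` holds, the coefficient of `√-D` in the
multiplier is examined, and the rational part otherwise. -/
structure CycleCert where
  n : ℕ
  w : ZRoot
  N : ℕ
  ε : ℕ
  K : ℕ
  im : Bool

namespace CycleCert

open ZQuad

/-- `P` is the value at the centre of the polynomial `N u_n - w v_n`, whose zeros are points of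
period dividing `n`, and `P'` is its derivative in `w`. The factor `2 ^ n + 1` bounds the degree. -/
def checkRoot (D s : ℕ) (F : ZQuad) (C : CycleCert) : Bool :=
  let t := dorbit D F C.w (ZRoot.ofNat C.N) C.n
  let P := ((ZRoot.ofNat C.N).mul D t.1.1).sub (C.w.mul D t.1.2)
  let P' := ((ZRoot.ofNat C.N).mul D t.2.1).sub (t.1.2.add (C.w.mul D t.2.2))
  decide (0 < P'.lb) && decide ((2 ^ C.n + 1) * P.ub s ≤ C.ε * P'.lb)

/-- Twice the multiplier, seen as a fraction with denominator `β` and numerator `γ`, is not in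
`ℤ + ℤ √-D`. -/
def checkNotInt (D s K : ℕ) (im : Bool) (β γ : ZDisc) : Bool :=
  let q := γ.c.mul D β.c.conj
  let t := if im then q.y else q.x
  let M := β.c.x * β.c.x + D * (β.c.y * β.c.y)
  let E : ℤ := β.c.ub s * (γ.ρ + K * β.ρ)
  β.apart && decide (γ.c.ub s + γ.ρ + K * β.ρ ≤ K * β.c.lb) &&
    decide (E < t % M) && decide (t % M + E < M)

/-- The computation is made on the whole disc of radius `ε` about `w`, so that it applies to the
exact cycle, which is unknown. The last two discs enclose the denominator `2 ^ n * v_n ^ 2` and the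
numerator `2 * N ^ 2 * ∏ jac` of the doubled multiplier: the power of 2 comes from the halved
Jacobians, and `N` from the return factor `v_n / N`. -/
def check (D s : ℕ) (F : ZQuad) (C : CycleCert) : Bool :=
  let u : ZDisc := ⟨C.w, C.ε⟩
  let v : ZDisc := ZDisc.const (ZRoot.ofNat C.N)
  let vn := (discOrbit D s F u v C.n).2
  decide (0 < C.n) && decide (C.n ≤ 5) && decide (0 < C.N) && checkRoot D s F C &&
    discAperiodic D s F u v C.n &&
    checkNotInt D s C.K C.im
      ((ZDisc.const (ZRoot.ofNat (2 ^ C.n))).mul D s (vn.mul D s vn))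
      ((ZDisc.const (ZRoot.ofNat (2 * (C.N * C.N)))).mul D s (discJacProd D s F u v C.n))

end CycleCert

/-! ### Soundness of the certificates -/

/-- A polynomial of degree at most `M` has a root at distance at most `M |p w| / |deriv p w|`. -/
theorem Polynomial.exists_root_near {p : ℂ[X]} {M : ℕ} (hM : p.natDegree ≤ M) {w : ℂ}
    (hw : p.derivative.eval w ≠ 0) :
    ∃ z, p.eval z = 0 ∧ ‖z - w‖ * ‖p.derivative.eval w‖ ≤ M * ‖p.eval w‖ := by
  by_cases h0 : p.eval w = 0
  · exact ⟨w, h0, by simp [h0]⟩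
  by_contra hcon
  push Not at hcon
  have hp0 : p ≠ 0 := by rintro rfl; simp at hw
  have hsp := IsAlgClosed.splits p
  -- The logarithmic derivative is the sum of `1 / (w - z)` over at most `M` roots. If all roots
  -- were further away than claimed, each term would be smaller than `‖p' / p‖ / M`.
  have hlog := hsp.eval_derivative_div_eval_of_ne_zero h0
  have hpos : 0 < ‖p.eval w‖ := norm_pos_iff.2 h0
  have hcard : Multiset.card p.roots ≤ M := (card_roots' p).trans hM
  have hne : p.roots ≠ 0 := by
    intro h
    rw [h] at hlog
    simp [h0, hw] at hlog
  have hterm : ∀ z ∈ p.roots, ‖1 / (w - z)‖ * (M * ‖p.eval w‖) < ‖p.derivative.eval w‖ := by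
    intro z hz
    have hz0 : p.eval z = 0 := (mem_roots'.1 hz).2
    have hwz : w - z ≠ 0 := by
      intro h
      rw [sub_eq_zero.1 h] at h0
      exact h0 hz0
    have h1 := hcon z hz0
    rw [norm_div, norm_one, norm_sub_rev w z]
    have h2 : 0 < ‖z - w‖ := by rw [norm_sub_rev]; exact norm_pos_iff.2 hwz
    rw [div_mul_eq_mul_div, one_mul, div_lt_iff₀ h2]
    linarith
  have hsum : ‖(p.roots.map fun z => 1 / (w - z)).sum‖ ≤ (p.roots.map fun z => ‖1 / (w - z)‖).sum := by
    have := norm_multiset_sum_le (p.roots.map fun z => 1 / (w - z))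
    simpa [Multiset.map_map, Function.comp_def] using this
  have hM0 : (0 : ℝ) < M := by
    have : 0 < Multiset.card p.roots := Multiset.card_pos.2 hne
    exact_mod_cast this.trans_le hcard
  have hlt : (p.roots.map fun z => ‖1 / (w - z)‖ * (M * ‖p.eval w‖)).sum <
      (p.roots.map fun _ => ‖p.derivative.eval w‖).sum := by
    apply Multiset.sum_lt_sum_of_nonempty hne
    exact hterm
  rw [Multiset.sum_map_mul_right, Multiset.map_const', Multiset.sum_replicate, nsmul_eq_mul] at hlt
  have h3 : ‖p.derivative.eval w‖ / ‖p.eval w‖ ≤ (p.roots.map fun z => ‖1 / (w - z)‖).sum := by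
    rw [← norm_div, hlog]; exact hsum
  rw [div_le_iff₀ hpos] at h3
  have h4 : (Multiset.card p.roots : ℝ) ≤ M := by exact_mod_cast hcard
  have h5 : 0 < ‖p.derivative.eval w‖ := norm_pos_iff.2 hw
  nlinarith

namespace ZRoot

/-- The complex number `x + y r`. -/
def toC (r : ℂ) (a : ZRoot) : ℂ := a.x + a.y * r

theorem toC_add (r : ℂ) (a b : ZRoot) : (a.add b).toC r = a.toC r + b.toC r := by
  simp [toC, add]; ring

theorem toC_sub (r : ℂ) (a b : ZRoot) : (a.sub b).toC r = a.toC r - b.toC r := by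
  simp [toC, sub]; ring

theorem toC_mul {D : ℕ} {r : ℂ} (hr : r ^ 2 = -D) (a b : ZRoot) :
    (a.mul D b).toC r = a.toC r * b.toC r := by
  simp [toC, mul]; linear_combination -(a.y * b.y : ℂ) * hr

@[simp] theorem toC_ofNat (r : ℂ) (n : ℕ) : (ofNat n).toC r = n := by simp [toC, ofNat]

theorem re_root {D : ℕ} {r : ℂ} (hr : r ^ 2 = -D) (hD : 0 < D) : r.re = 0 ∧ r.im ^ 2 = D := by
  have h1 := congrArg Complex.re hr
  have h2 := congrArg Complex.im hr
  simp [pow_two] at h1 h2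
  have h3 : r.re * r.im = 0 := by linarith
  have hD' : (0 : ℝ) < D := by exact_mod_cast hD
  rcases mul_eq_zero.1 h3 with h | h
  · rw [h] at h1; exact ⟨h, by linarith⟩
  · rw [h] at h1; nlinarith

theorem norm_root {D : ℕ} {r : ℂ} (hr : r ^ 2 = -D) : ‖r‖ ^ 2 = D := by
  rw [← norm_pow, hr]; simp

theorem norm_toC_le {D s : ℕ} {r : ℂ} (hr : r ^ 2 = -D) (hs : D ≤ s ^ 2) (a : ZRoot) :
    ‖a.toC r‖ ≤ a.ub s := by
  have h1 : ‖r‖ ≤ s := by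
    have : ‖r‖ ^ 2 ≤ (s : ℝ) ^ 2 := by rw [norm_root hr]; exact_mod_cast hs
    exact le_of_sq_le_sq this (by positivity)
  calc ‖a.toC r‖ ≤ ‖(a.x : ℂ)‖ + ‖(a.y : ℂ)‖ * ‖r‖ := by
        rw [toC, ← norm_mul]; exact norm_add_le _ _
    _ ≤ ‖(a.x : ℂ)‖ + ‖(a.y : ℂ)‖ * s := by gcongr
    _ = a.ub s := by
        simp [ub, Complex.norm_intCast, Nat.cast_natAbs]; ring

theorem sq_norm_toC {D : ℕ} {r : ℂ} (hr : r ^ 2 = -D) (hD : 0 < D) (x y : ℝ) :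
    ‖(x + y * r : ℂ)‖ ^ 2 = x ^ 2 + D * y ^ 2 := by
  obtain ⟨h1, h2⟩ := re_root hr hD
  rw [Complex.sq_norm, Complex.normSq_apply]
  simp [h1]
  linear_combination y ^ 2 * h2

theorem lb_le_norm_toC {D : ℕ} {r : ℂ} (hr : r ^ 2 = -D) (hD : 0 < D) (a : ZRoot) :
    (a.lb : ℝ) ≤ ‖a.toC r‖ := by
  have h := sq_norm_toC hr hD a.x a.y
  have hD' : (1 : ℝ) ≤ D := by exact_mod_cast hD
  have e : ‖a.toC r‖ ^ 2 = (a.x : ℝ) ^ 2 + D * (a.y : ℝ) ^ 2 := by rw [← h]; simp [toC]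
  rw [lb, Nat.cast_max]
  apply max_le
  · rw [Nat.cast_natAbs]
    push_cast
    apply abs_le_of_sq_le_sq _ (norm_nonneg _)
    rw [e]; nlinarith [sq_nonneg (a.y : ℝ)]
  · rw [Nat.cast_natAbs]
    push_cast
    apply abs_le_of_sq_le_sq _ (norm_nonneg _)
    rw [e]; nlinarith [sq_nonneg (a.x : ℝ), sq_nonneg (a.y : ℝ)]

end ZRoot

namespace ZDisc

/-- The point `z` lies in the disc. -/
def Mem (r : ℂ) (d : ZDisc) (z : ℂ) : Prop := ‖z - d.c.toC r‖ ≤ d.ρ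

variable {D s : ℕ} {r : ℂ} {a b : ZDisc} {z w : ℂ}

theorem mem_const (r : ℂ) (a : ZRoot) : (const a).Mem r (a.toC r) := by simp [Mem, const]

theorem mem_add (hz : a.Mem r z) (hw : b.Mem r w) : (a.add b).Mem r (z + w) := by
  simp only [Mem, add, ZRoot.toC_add, Nat.cast_add] at *
  calc _ = ‖(z - a.c.toC r) + (w - b.c.toC r)‖ := by ring_nf
    _ ≤ _ := (norm_add_le _ _).trans (add_le_add hz hw)

theorem mem_sub (hz : a.Mem r z) (hw : b.Mem r w) : (a.sub b).Mem r (z - w) := by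
  simp only [Mem, sub, ZRoot.toC_sub, Nat.cast_add] at *
  calc _ = ‖(z - a.c.toC r) - (w - b.c.toC r)‖ := by ring_nf
    _ ≤ _ := (norm_sub_le _ _).trans (add_le_add hz hw)

theorem mem_mul (hr : r ^ 2 = -D) (hs : D ≤ s ^ 2) (hz : a.Mem r z) (hw : b.Mem r w) :
    (a.mul D s b).Mem r (z * w) := by
  have ha := ZRoot.norm_toC_le hr hs a.c
  have hb := ZRoot.norm_toC_le hr hs b.c
  simp only [Mem, mul, ZRoot.toC_mul hr, Nat.cast_add, Nat.cast_mul] at *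
  calc ‖z * w - a.c.toC r * b.c.toC r‖
      = ‖a.c.toC r * (w - b.c.toC r) + b.c.toC r * (z - a.c.toC r) +
        (z - a.c.toC r) * (w - b.c.toC r)‖ := by ring_nf
    _ ≤ ‖a.c.toC r‖ * ‖w - b.c.toC r‖ + ‖b.c.toC r‖ * ‖z - a.c.toC r‖ +
        ‖z - a.c.toC r‖ * ‖w - b.c.toC r‖ := by
      simp only [← norm_mul]; exact norm_add₃_le
    _ ≤ _ := by gcongr

theorem ne_zero_of_apart (hr : r ^ 2 = -D) (hD : 0 < D) (h : a.apart = true) (hz : a.Mem r z) :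
    z ≠ 0 := by
  rintro rfl
  have h1 : (a.ρ : ℝ) < a.c.lb := by exact_mod_cast (of_decide_eq_true h)
  have h2 := ZRoot.lb_le_norm_toC hr hD a.c
  simp [Mem] at hz
  linarith

end ZDisc

namespace ZQuad

open RSphere

/-- The quadratic map with the given coefficients. -/
def toQuad (r : ℂ) (F : ZQuad) : QuadMap :=
  ⟨F.p₂.toC r, F.p₁.toC r, F.p₀.toC r, F.q₂.toC r, F.q₁.toC r, F.q₀.toC r⟩

variable {D s : ℕ} {r : ℂ} (F : ZQuad)

/-- The orbit of `(u, v)` in any commutative algebra. -/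
def orb {R : Type*} [CommRing R] (p₂ p₁ p₀ q₂ q₁ q₀ u v : R) : ℕ → R × R
  | 0 => (u, v)
  | n + 1 =>
    let t := orb p₂ p₁ p₀ q₂ q₁ q₀ u v n
    (p₂ * t.1 ^ 2 + p₁ * t.1 * t.2 + p₀ * t.2 ^ 2, q₂ * t.1 ^ 2 + q₁ * t.1 * t.2 + q₀ * t.2 ^ 2)

/-- The orbit of `(u, v)` under a quadratic map. -/
def corb (G : QuadMap) (u v : ℂ) : ℕ → ℂ × ℂ := orb G.p₂ G.p₁ G.p₀ G.q₂ G.q₁ G.q₀ u v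

/-- The orbit of `(X, N)`, with polynomial components. -/
def porb (G : QuadMap) (N : ℂ) : ℕ → ℂ[X] × ℂ[X] :=
  orb (C G.p₂) (C G.p₁) (C G.p₀) (C G.q₂) (C G.q₁) (C G.q₀) X (C N)

theorem eval_porb (G : QuadMap) (N u : ℂ) (n : ℕ) :
    (porb G N n).1.eval u = (corb G u N n).1 ∧ (porb G N n).2.eval u = (corb G u N n).2 := by
  induction n with
  | zero => simp [porb, corb, orb]
  | succ n ih => simp [porb, corb, orb] at ih ⊢; simp [ih]

theorem natDegree_porb (G : QuadMap) (N : ℂ) (n : ℕ) :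
    (porb G N n).1.natDegree ≤ 2 ^ n ∧ (porb G N n).2.natDegree ≤ 2 ^ n := by
  induction n with
  | zero => simp [porb, orb]
  | succ n ih =>
    obtain ⟨h1, h2⟩ := ih
    simp only [porb, orb] at h1 h2 ⊢
    generalize orb (C G.p₂) (C G.p₁) (C G.p₀) (C G.q₂) (C G.q₁) (C G.q₀) X (C N) n = t at h1 h2
    have key (a b c : ℂ) : (C a * t.1 ^ 2 + C b * t.1 * t.2 + C c * t.2 ^ 2).natDegree ≤
        2 ^ (n + 1) := by
      have e1 : (t.1 ^ 2).natDegree ≤ 2 ^ (n + 1) :=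
        natDegree_pow_le.trans (by rw [pow_succ]; omega)
      have e2 : (t.1 * t.2).natDegree ≤ 2 ^ (n + 1) :=
        natDegree_mul_le.trans (by rw [pow_succ]; omega)
      have e3 : (t.2 ^ 2).natDegree ≤ 2 ^ (n + 1) :=
        natDegree_pow_le.trans (by rw [pow_succ]; omega)
      refine natDegree_add_le_of_degree_le (natDegree_add_le_of_degree_le ?_ ?_) ?_
      · exact (natDegree_C_mul_le _ _).trans e1
      · rw [mul_assoc]; exact (natDegree_C_mul_le _ _).trans e2
      · exact (natDegree_C_mul_le _ _).trans e3
    exact ⟨key _ _ _, key _ _ _⟩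

/-- The recursion propagates value and derivative together, so the polynomials of degree up to `2 ^
n` are never expanded. -/
theorem toC_dorbit (hr : r ^ 2 = -D) (w : ZRoot) (N n : ℕ) :
    let t := dorbit D F w (ZRoot.ofNat N) n
    let p := porb (F.toQuad r) N n
    t.1.1.toC r = p.1.eval (w.toC r) ∧ t.1.2.toC r = p.2.eval (w.toC r) ∧
    t.2.1.toC r = p.1.derivative.eval (w.toC r) ∧ t.2.2.toC r = p.2.derivative.eval (w.toC r) := by
  induction n with
  | zero => simp [porb, orb, dorbit]; simp [ZRoot.toC]
  | succ n ih =>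
    obtain ⟨h1, h2, h3, h4⟩ := ih
    have e : porb (F.toQuad r) N (n + 1) =
      let t := porb (F.toQuad r) N n
      (C (F.p₂.toC r) * t.1 ^ 2 + C (F.p₁.toC r) * t.1 * t.2 + C (F.p₀.toC r) * t.2 ^ 2,
        C (F.q₂.toC r) * t.1 ^ 2 + C (F.q₁.toC r) * t.1 * t.2 + C (F.q₀.toC r) * t.2 ^ 2) := rfl
    simp only [e, dorbit, dstep]
    generalize porb (F.toQuad r) N n = p at *
    generalize dorbit D F w (ZRoot.ofNat N) n = t at *
    simp only [form, dform, ZRoot.toC_add, ZRoot.toC_mul hr, h1, h2, h3, h4, ZRoot.toC_ofNat]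
    simp [derivative_pow]
    refine ⟨?_, ?_, ?_, ?_⟩ <;> ring

theorem mem_discForm (hr : r ^ 2 = -D) (hs : D ≤ s ^ 2) (a b c : ZRoot) {u v : ZDisc} {z w : ℂ}
    (hz : u.Mem r z) (hw : v.Mem r w) : (discForm D s a b c u v).Mem r
      (a.toC r * z ^ 2 + b.toC r * z * w + c.toC r * w ^ 2) := by
  have h := ZDisc.mem_add (ZDisc.mem_add
    (ZDisc.mem_mul hr hs (ZDisc.mem_const r a) (ZDisc.mem_mul hr hs hz hz))
    (ZDisc.mem_mul hr hs (ZDisc.mem_const r b) (ZDisc.mem_mul hr hs hz hw)))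
    (ZDisc.mem_mul hr hs (ZDisc.mem_const r c) (ZDisc.mem_mul hr hs hw hw))
  rw [discForm]
  convert h using 1
  ring

theorem mem_discOrbit (hr : r ^ 2 = -D) (hs : D ≤ s ^ 2) {u v : ZDisc} {z w : ℂ}
    (hz : u.Mem r z) (hw : v.Mem r w) (n : ℕ) :
    (discOrbit D s F u v n).1.Mem r (corb (F.toQuad r) z w n).1 ∧
    (discOrbit D s F u v n).2.Mem r (corb (F.toQuad r) z w n).2 := by
  induction n with
  | zero => exact ⟨hz, hw⟩
  | succ n ih => exact ⟨mem_discForm hr hs _ _ _ ih.1 ih.2, mem_discForm hr hs _ _ _ ih.1 ih.2⟩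

theorem mem_discJac (hr : r ^ 2 = -D) (hs : D ≤ s ^ 2) {u v : ZDisc} {z w : ℂ}
    (hz : u.Mem r z) (hw : v.Mem r w) :
    (discJac D s F u v).Mem r ((F.toQuad r).jac z w) := by
  have hlin (a b : ZRoot) : (((ZDisc.const a).mul D s u).add ((ZDisc.const b).mul D s v)).Mem r
      (a.toC r * z + b.toC r * w) :=
    ZDisc.mem_add (ZDisc.mem_mul hr hs (ZDisc.mem_const r a) hz)
      (ZDisc.mem_mul hr hs (ZDisc.mem_const r b) hw)
  have h := ZDisc.mem_sub (ZDisc.mem_mul hr hs (hlin ⟨2 * F.p₂.x, 2 * F.p₂.y⟩ F.p₁)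
    (hlin F.q₁ ⟨2 * F.q₀.x, 2 * F.q₀.y⟩)) (ZDisc.mem_mul hr hs (hlin F.p₁ ⟨2 * F.p₀.x, 2 * F.p₀.y⟩)
    (hlin ⟨2 * F.q₂.x, 2 * F.q₂.y⟩ F.q₁))
  rw [discJac]
  convert h using 1
  simp [QuadMap.jac, toQuad, ZRoot.toC]
  ring

theorem mem_discJacProd (hr : r ^ 2 = -D) (hs : D ≤ s ^ 2) {u v : ZDisc} {z w : ℂ}
    (hz : u.Mem r z) (hw : v.Mem r w) (n : ℕ) :
    (discJacProd D s F u v n).Mem r (∏ i ∈ Finset.range n,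
      (F.toQuad r).jac (corb (F.toQuad r) z w i).1 (corb (F.toQuad r) z w i).2) := by
  induction n with
  | zero => simpa [ZRoot.toC, discJacProd] using ZDisc.mem_const r ⟨1, 0⟩
  | succ n ih =>
    rw [Finset.prod_range_succ]
    have h := mem_discOrbit F hr hs hz hw n
    exact ZDisc.mem_mul hr hs ih (mem_discJac F hr hs h.1 h.2)

theorem ne_of_discAperiodic (hr : r ^ 2 = -D) (hD : 0 < D) (hs : D ≤ s ^ 2) {u v : ZDisc} {z w : ℂ}
    (hz : u.Mem r z) (hw : v.Mem r w) (n : ℕ) (h : discAperiodic D s F u v n = true) (k : ℕ)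
    (hk0 : 0 < k) (hk : k < n) :
    z * (corb (F.toQuad r) z w k).2 ≠ (corb (F.toQuad r) z w k).1 * w := by
  induction n with
  | zero => omega
  | succ n ih =>
    match n, h, ih with
    | 0, _, _ => omega
    | n + 1, h, ih =>
      simp only [discAperiodic, Bool.and_eq_true] at h
      rcases Nat.lt_succ_iff_lt_or_eq.1 hk with hk' | rfl
      · exact ih h.1 hk'
      · have hm := mem_discOrbit F hr hs hz hw (n + 1)
        exact sub_ne_zero.1 (ZDisc.ne_zero_of_apart hr hD h.2
          (ZDisc.mem_sub (ZDisc.mem_mul hr hs hz hm.2) (ZDisc.mem_mul hr hs hm.1 hw)))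

end ZQuad

namespace CycleCert

open ZQuad RSphere

variable {D s : ℕ} {r : ℂ} {F : ZQuad} {C : CycleCert}

/-- This is `exists_root_near` for `N u_n - X v_n`, with the value at `w` bounded above by `ub` and
the derivative bounded below by `lb`. -/
theorem exists_root_of_checkRoot (hr : r ^ 2 = -D) (hD : 0 < D) (hs : D ≤ s ^ 2)
    (h : C.checkRoot D s F = true) :
    ∃ z : ℂ, (⟨C.w, C.ε⟩ : ZDisc).Mem r z ∧
      C.N * (corb (F.toQuad r) z C.N C.n).1 = z * (corb (F.toQuad r) z C.N C.n).2 := by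
  simp only [checkRoot, Bool.and_eq_true, decide_eq_true_eq] at h
  obtain ⟨h1, h2, h3, h4⟩ := toC_dorbit (r := r) F hr C.w C.N C.n
  set t := dorbit D F C.w (ZRoot.ofNat C.N) C.n
  set p := porb (F.toQuad r) C.N C.n with hp
  set P := ((ZRoot.ofNat C.N).mul D t.1.1).sub (C.w.mul D t.1.2)
  set P' := ((ZRoot.ofNat C.N).mul D t.2.1).sub (t.1.2.add (C.w.mul D t.2.2))
  set q : ℂ[X] := Polynomial.C (C.N : ℂ) * p.1 - X * p.2 with hq
  have e1 : q.eval (C.w.toC r) = P.toC r := by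
    simp [hq, P, ZRoot.toC_sub, ZRoot.toC_mul hr, h1, h2]
  have e2 : q.derivative.eval (C.w.toC r) = P'.toC r := by
    simp [hq, P', ZRoot.toC_sub, ZRoot.toC_add, ZRoot.toC_mul hr, h2, h3, h4]
  have hdeg : q.natDegree ≤ 2 ^ C.n + 1 := by
    obtain ⟨d1, d2⟩ := natDegree_porb (F.toQuad r) C.N C.n
    rw [← hp] at d1 d2
    refine (natDegree_sub_le _ _).trans (max_le ?_ ?_)
    · exact (natDegree_C_mul_le _ _).trans (d1.trans (by omega))
    · refine natDegree_mul_le.trans ?_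
      rw [natDegree_X]
      omega
  have hlb := ZRoot.lb_le_norm_toC hr hD P'
  have hub := ZRoot.norm_toC_le hr hs P
  have hpos : (0 : ℝ) < P'.lb := by exact_mod_cast h.1
  have hle : ((2 ^ C.n + 1 : ℕ) : ℝ) * P.ub s ≤ C.ε * P'.lb := by exact_mod_cast h.2
  have hne : q.derivative.eval (C.w.toC r) ≠ 0 := by
    rw [e2, ← norm_pos_iff]; linarith
  obtain ⟨z, hz, hz'⟩ := exists_root_near hdeg hne
  refine ⟨z, ?_, ?_⟩
  · rw [e1, e2] at hz'
    have h5 : ‖z - C.w.toC r‖ * P'.lb ≤ C.ε * P'.lb :=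
      calc ‖z - C.w.toC r‖ * P'.lb ≤ ‖z - C.w.toC r‖ * ‖P'.toC r‖ := by gcongr
        _ ≤ _ := hz'
        _ ≤ ((2 ^ C.n + 1 : ℕ) : ℝ) * P.ub s := by gcongr
        _ ≤ _ := hle
    exact le_of_mul_le_mul_right h5 hpos
  · obtain ⟨e3, e4⟩ := eval_porb (F.toQuad r) C.N z C.n
    rw [← e3, ← e4]
    simp only [hq, eval_sub, eval_mul, eval_C, eval_X] at hz
    linear_combination hz

/-- The selected component of `X + Y r`. -/
def sel (im : Bool) (X Y : ℝ) : ℝ := if im then Y else X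

/-- The bound `‖x‖ ≤ K` for `x = c / b` turns the uncertainty on `b` and `c` into one on `x` times
the centre of `β`. Multiplying by the conjugate of that centre shows that `M * x` is within `E` of
the ring element `q`. If the residue modulo `M` of the chosen coordinate of `q` lies strictly
between `E` and `M - E`, no multiple of `M` is that close. -/
theorem not_int_of_checkNotInt (hr : r ^ 2 = -D) (hD : 0 < D) (hs : D ≤ s ^ 2) {K : ℕ} {im : Bool}
    {β γ : ZDisc} (h : checkNotInt D s K im β γ = true) {b c : ℂ} (hb : β.Mem r b)
    (hc : γ.Mem r c) (X Y : ℝ) (hXY : (X + Y * r) * b = c) (m : ℤ) : sel im X Y ≠ m := by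
  simp only [checkNotInt, Bool.and_eq_true, decide_eq_true_eq] at h
  obtain ⟨⟨⟨ha, hK⟩, hE1⟩, hE2⟩ := h
  have hb0 := ZDisc.ne_zero_of_apart hr hD ha hb
  set q := γ.c.mul D β.c.conj with hq
  set M : ℤ := β.c.x * β.c.x + D * (β.c.y * β.c.y) with hM
  set E : ℤ := β.c.ub s * (γ.ρ + K * β.ρ) with hE
  set x : ℂ := X + Y * r with hx
  have hβu := ZRoot.norm_toC_le hr hs β.c
  have hβl := ZRoot.lb_le_norm_toC hr hD β.c
  have hγu := ZRoot.norm_toC_le hr hs γ.c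
  have hK' : (γ.c.ub s : ℝ) + γ.ρ + K * β.ρ ≤ K * β.c.lb := by exact_mod_cast hK
  have hρ : (β.ρ : ℝ) < β.c.lb := by exact_mod_cast of_decide_eq_true ha
  simp only [ZDisc.Mem] at hb hc
  have hbn : (β.c.lb : ℝ) - β.ρ ≤ ‖b‖ := by
    have : ‖β.c.toC r‖ ≤ ‖b‖ + ‖b - β.c.toC r‖ := by
      have := norm_sub_le b (b - β.c.toC r)
      simpa using this
    linarith
  have hcn : ‖c‖ ≤ γ.c.ub s + γ.ρ := by
    have : ‖c‖ ≤ ‖γ.c.toC r‖ + ‖c - γ.c.toC r‖ := by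
      have := norm_add_le (γ.c.toC r) (c - γ.c.toC r)
      simpa using this
    linarith
  have hxn : ‖x‖ ≤ K := by
    have h1 : ‖x‖ * ‖b‖ = ‖c‖ := by rw [← norm_mul, hXY]
    by_contra hlt
    push Not at hlt
    have h2 : (K : ℝ) * (β.c.lb - β.ρ) < ‖x‖ * ‖b‖ := by
      apply mul_lt_mul hlt hbn (by linarith) (norm_nonneg _)
    linarith
  have hEn : ‖x * β.c.toC r - γ.c.toC r‖ ≤ γ.ρ + K * β.ρ := by
    have e : x * β.c.toC r - γ.c.toC r = (c - γ.c.toC r) - x * (b - β.c.toC r) := by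
      rw [← hXY]; ring
    rw [e]
    refine (norm_sub_le _ _).trans (add_le_add hc ?_)
    rw [norm_mul]
    gcongr
  have hconj : β.c.toC r * β.c.conj.toC r = (M : ℂ) := by
    simp only [ZRoot.toC, ZRoot.conj, hM]
    push_cast
    linear_combination -(β.c.y : ℂ) ^ 2 * hr
  have hconjn : ‖β.c.conj.toC r‖ ≤ β.c.ub s := by
    have := ZRoot.norm_toC_le hr hs β.c.conj
    simpa [ZRoot.conj, ZRoot.ub] using this
  have hfin : ‖(((X * M - q.x : ℝ) : ℂ) + ((Y * M - q.y : ℝ) : ℂ) * r)‖ ≤ E := by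
    have e : (((X * M - q.x : ℝ) : ℂ) + ((Y * M - q.y : ℝ) : ℂ) * r) =
        (x * β.c.toC r - γ.c.toC r) * β.c.conj.toC r := by
      have hq' : γ.c.toC r * β.c.conj.toC r = q.x + q.y * r := (ZRoot.toC_mul hr _ _).symm
      push_cast
      linear_combination hq' - x * hconj - (M : ℂ) * hx
    rw [e, norm_mul, hE]
    push_cast
    rw [mul_comm (β.c.ub s : ℝ)]
    gcongr
  have hcomp : |sel im X Y * M - (if im then q.y else q.x : ℤ)| ≤ E := by
    have h1 := ZRoot.sq_norm_toC hr hD (X * M - q.x) (Y * M - q.y)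
    have hE0 : (0 : ℝ) ≤ E := (norm_nonneg _).trans hfin
    have hD' : (1 : ℝ) ≤ D := by exact_mod_cast hD
    have h2 : ‖(((X * M - q.x : ℝ) : ℂ) + ((Y * M - q.y : ℝ) : ℂ) * r)‖ ^ 2 ≤ (E : ℝ) ^ 2 := by
      gcongr
    rw [h1] at h2
    apply abs_le_of_sq_le_sq _ hE0
    cases im
    · simp only [sel, Bool.false_eq_true, if_false]
      nlinarith [sq_nonneg (Y * M - q.y : ℝ)]
    · simp only [sel, if_true]
      nlinarith [sq_nonneg (X * M - q.x : ℝ), sq_nonneg (Y * M - q.y : ℝ)]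
  intro hm
  rw [hm] at hcomp
  set t : ℤ := if im then q.y else q.x with ht
  have hcomp' : |m * M - t| ≤ E := by exact_mod_cast hcomp
  rw [abs_le] at hcomp'
  have hdiv := Int.emod_add_mul_ediv t M
  have hM0 : 0 < M := by
    have := Int.add_nonneg (mul_self_nonneg β.c.x)
      (mul_nonneg (Int.natCast_nonneg D) (mul_self_nonneg β.c.y))
    have : M ≠ 0 := by
      intro h0
      have := mul_ne_zero (a := β.c.toC r) (b := β.c.conj.toC r) ?_ ?_
      · rw [hconj, h0] at this; simp at this
      · rw [← norm_pos_iff]; have : (0 : ℝ) ≤ β.ρ := by positivity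
        linarith
      · rw [← norm_pos_iff]
        have h1 := ZRoot.lb_le_norm_toC hr hD β.c.conj
        have h2 : β.c.conj.lb = β.c.lb := by simp [ZRoot.conj, ZRoot.lb]
        rw [h2] at h1
        have : (0 : ℝ) ≤ β.ρ := by positivity
        linarith
    omega
  have h1 : E < t - M * (t / M) := by linarith
  have h2 : t - M * (t / M) + E < M := by linarith
  have h3 : M * (m - t / M) < M * 1 := by linarith [hcomp'.2, mul_comm m M, mul_sub M m (t / M)]
  have h4 : M * 0 < M * (m - t / M) := by linarith [hcomp'.1, mul_comm m M, mul_sub M m (t / M)]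
  have h5 := lt_of_mul_lt_mul_left h3 hM0.le
  have h6 := lt_of_mul_lt_mul_left h4 hM0.le
  omega

/-- A valid certificate proves the existence of a cycle whose multiplier is not an integer. -/
theorem exists_cycle_of_check (hr : r ^ 2 = -D) (hD : 0 < D) (hs : D ≤ s ^ 2)
    (hF : (F.toQuad r).Nondeg) (h : C.check D s F = true) :
    ∃ a ∈ Function.periodicPts (F.toQuad r).toMap,
      Function.minimalPeriod (F.toQuad r).toMap a ≤ 5 ∧
      ∀ X Y : ℝ, 2 * multiplier (F.toQuad r).toMap a = X + Y * r → ∀ m : ℤ, sel C.im X Y ≠ m := by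
  simp only [check, Bool.and_eq_true, decide_eq_true_eq] at h
  obtain ⟨⟨⟨⟨⟨hn, hn5⟩, hN⟩, hroot⟩, hap⟩, hni⟩ := h
  obtain ⟨z, hz, heq⟩ := exists_root_of_checkRoot hr hD hs hroot
  set G := F.toQuad r
  have hN' : (C.N : ℂ) ≠ 0 := by exact_mod_cast hN.ne'
  set u : ℕ → ℂ := fun i => (corb G z C.N i).1
  set v : ℕ → ℂ := fun i => (corb G z C.N i).2
  have hv : (ZDisc.const (ZRoot.ofNat C.N)).Mem r (C.N : ℂ) := by
    simpa using ZDisc.mem_const r (ZRoot.ofNat C.N)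
  have hu0 : u 0 = z := rfl
  have hv0 : v 0 = C.N := rfl
  have hu : ∀ i, u (i + 1) = G.num (u i) (v i) := fun i => rfl
  have hv' : ∀ i, v (i + 1) = G.den (u i) (v i) := fun i => rfl
  have h0 : u 0 ≠ 0 ∨ v 0 ≠ 0 := Or.inr hN'
  have hne : ∀ i, u i ≠ 0 ∨ v i ≠ 0 := by
    intro i
    induction i with
    | zero => exact h0
    | succ i ih => rw [hu, hv']; exact hF.ne_zero ih
  have hit : ∀ i, G.toMap^[i] (ofHom (u 0) (v 0)) = ofHom (u i) (v i) := by
    intro i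
    induction i with
    | zero => rfl
    | succ i ih => rw [Function.iterate_succ_apply', ih, QuadMap.toMap_ofHom G (hne i), hu, hv']
  have hmem := mem_discOrbit F hr hs hz hv C.n
  set vn := (discOrbit D s F ⟨C.w, C.ε⟩ (ZDisc.const (ZRoot.ofNat C.N)) C.n).2
  have hβ : ((ZDisc.const (ZRoot.ofNat (2 ^ C.n))).mul D s (vn.mul D s vn)).Mem r
      (2 ^ C.n * (v C.n * v C.n)) := by
    have := ZDisc.mem_mul hr hs (ZDisc.mem_const r (ZRoot.ofNat (2 ^ C.n)))
      (ZDisc.mem_mul hr hs hmem.2 hmem.2)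
    simpa using this
  have hγ := ZDisc.mem_mul hr hs (ZDisc.mem_const r (ZRoot.ofNat (2 * (C.N * C.N))))
    (mem_discJacProd F hr hs hz hv C.n)
  have hβ0 : (2 : ℂ) ^ C.n * (v C.n * v C.n) ≠ 0 := by
    have h1 := hni
    simp only [checkNotInt, Bool.and_eq_true, decide_eq_true_eq] at h1
    exact ZDisc.ne_zero_of_apart hr hD h1.1.1.1 hβ
  have hvn : v C.n ≠ 0 := by
    intro h
    simp [h] at hβ0
  -- The factor by which the vector is multiplied after one turn of the cycle.
  set c := v C.n / C.N with hc
  have hc0 : c ≠ 0 := div_ne_zero hvn hN'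
  have hun : u C.n = c * u 0 := by
    rw [hc, hu0]; field_simp; linear_combination heq
  have hvn' : v C.n = c * v 0 := by
    rw [hc, hv0]; field_simp
  have hper : Function.IsPeriodicPt G.toMap C.n (ofHom (u 0) (v 0)) := by
    rw [Function.IsPeriodicPt, Function.IsFixedPt, hit, hun, hvn', ofHom_mul hc0]
  -- A smaller period would identify the starting point with an intermediate one, and
  -- `discAperiodic` separates these.
  have hmin : Function.minimalPeriod G.toMap (ofHom (u 0) (v 0)) = C.n := by
    have hle := hper.minimalPeriod_le hn
    have hpos := hper.minimalPeriod_pos hn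
    by_contra hlt
    set k := Function.minimalPeriod G.toMap (ofHom (u 0) (v 0)) with hk
    have hk' : k < C.n := lt_of_le_of_ne hle hlt
    have hkp : G.toMap^[k] (ofHom (u 0) (v 0)) = ofHom (u 0) (v 0) :=
      Function.iterate_minimalPeriod
    rw [hit, ofHom_eq_ofHom_iff (hne k) h0] at hkp
    exact ne_of_discAperiodic F hr hD hs hz hv C.n hap k hpos hk' hkp.symm
  refine ⟨_, ⟨C.n, hn, hper⟩, hmin.trans_le hn5, fun X Y hXY m => ?_⟩
  refine not_int_of_checkNotInt hr hD hs hni hβ hγ X Y ?_ m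
  rw [← hXY, hF.multiplier_eq h0 hc0 hu hv' hun hvn' hmin]
  rw [Finset.prod_div_distrib, Finset.prod_const, Finset.card_range, hc]
  simp only [ZRoot.toC_ofNat]
  push_cast
  field_simp
  rfl

end CycleCert

/-! ### The ring of integers, and certificates against integrality -/

/-- The square root `i √D` of `-D`. -/
def rootNeg (D : ℕ) : ℂ := Complex.I * (Real.sqrt D : ℂ)

theorem rootNeg_sq (D : ℕ) : rootNeg D ^ 2 = -D := by
  rw [rootNeg, mul_pow, Complex.I_sq, ← Complex.ofReal_pow, Real.sq_sqrt (by positivity)]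
  simp

theorem exists_rat_of_mem_adjoin {D : ℕ} {z : ℂ}
    (hz : z ∈ IntermediateField.adjoin ℚ {rootNeg D}) : ∃ p q : ℚ, z = p + q * rootNeg D := by
  have hzint : IsIntegral ℚ (rootNeg D) := by
    refine ⟨X ^ 2 + C (D : ℚ), by monicity!, ?_⟩
    simp [rootNeg_sq]
  rw [← IntermediateField.mem_toSubalgebra,
    IntermediateField.adjoin_simple_toSubalgebra_of_isAlgebraic hzint.isAlgebraic] at hz
  induction hz using Algebra.adjoin_induction with
  | mem x hx =>
    rw [Set.mem_singleton_iff] at hx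
    exact ⟨0, 1, by simp [hx]⟩
  | algebraMap x => exact ⟨x, 0, by simp⟩
  | add x y _ _ hx hy =>
    obtain ⟨p, q, rfl⟩ := hx
    obtain ⟨p', q', rfl⟩ := hy
    exact ⟨p + p', q + q', by push_cast; ring⟩
  | mul x y _ _ hx hy =>
    obtain ⟨p, q, rfl⟩ := hx
    obtain ⟨p', q', rfl⟩ := hy
    refine ⟨p * p' - D * (q * q'), p * q' + q * p', ?_⟩
    push_cast
    linear_combination (q * q' : ℂ) * rootNeg_sq D

theorem exists_int_of_isIntegral {q : ℚ} (h : IsIntegral ℤ (q : ℂ)) : ∃ n : ℤ, q = n := by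
  have h1 : IsIntegral ℤ q := by
    rw [← isIntegral_algebraMap_iff (A := ℚ) (B := ℂ) (algebraMap ℚ ℂ).injective]
    simpa using h
  obtain ⟨n, hn⟩ := IsIntegrallyClosed.isIntegral_iff.1 h1
  exact ⟨n, by simpa using hn.symm⟩

/-- In `D * num ^ 2 = n * den ^ 2` coprimality forces `den ^ 2` to divide the squarefree number `D`.
-/
theorem Rat.exists_int_of_sq_mul {D : ℕ} (hsq : Squarefree D) {q : ℚ} {n : ℤ}
    (h : D * q ^ 2 = n) : ∃ m : ℤ, q = m := by
  have hden : (q.den : ℤ) ^ 2 ∣ D := by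
    have h1 : (D : ℤ) * q.num ^ 2 = n * q.den ^ 2 := by
      have hd : (q.den : ℚ) ≠ 0 := by exact_mod_cast q.den_nz
      have h2 : (D : ℚ) * (q.num / q.den) ^ 2 = n := by rw [Rat.num_div_den]; exact h
      field_simp at h2
      rw [mul_comm n]
      exact_mod_cast h2
    have h3 : (q.den : ℤ) ^ 2 ∣ D * q.num ^ 2 := ⟨n, by rw [h1]; ring⟩
    refine IsCoprime.dvd_of_dvd_mul_right ?_ h3
    have := q.reduced
    exact ((Nat.isCoprime_iff_coprime.2 this.symm).pow.of_isCoprime_of_dvd_right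
      (by rw [Int.natCast_natAbs]; exact pow_dvd_pow_of_dvd (self_dvd_abs _) 2))
  have hden' : q.den * q.den ∣ D := by
    rw [← pow_two]; exact_mod_cast hden
  have h1 := Nat.isUnit_iff.1 (hsq _ hden')
  exact ⟨q.num, ((Rat.den_eq_one_iff q).1 h1).symm⟩

/-- The elements of the ring of integers are half of some `X + Y √-D`. -/
theorem exists_of_mem_imQuadInt {D : ℕ} (hsq : Squarefree D) {z : ℂ}
    (hz : z ∈ imQuadInt D) :
    ∃ X Y : ℤ, 2 * z = X + Y * rootNeg D ∧ (4 : ℤ) ∣ X ^ 2 + D * Y ^ 2 := by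
  obtain ⟨h1, h2⟩ := Subring.mem_inf.1 hz
  obtain ⟨p, q, hpq⟩ := exists_rat_of_mem_adjoin (D := D) h1
  have hzint : IsIntegral ℤ z := h2
  have hconj : (starRingEnd ℂ) z = p - q * rootNeg D := by
    rw [hpq]; simp [rootNeg, sub_eq_add_neg]
  have hzint' : IsIntegral ℤ ((starRingEnd ℂ) z) := hzint.map ((starRingEnd ℂ).toIntAlgHom)
  have hr := rootNeg_sq D
  -- The trace `2 * p` and the norm `p ^ 2 + D * q ^ 2` are integers. Hence so is `D * (2 * q) ^ 2`,
  -- and squarefreeness makes `2 * q` an integer; four times the norm is the number divisible by 4.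
  obtain ⟨X, hX⟩ := exists_int_of_isIntegral (q := 2 * p) (by
    have := hzint.add hzint'
    rw [hconj, hpq] at this
    have e : ((2 * p : ℚ) : ℂ) = p + q * rootNeg D + (p - q * rootNeg D) := by push_cast; ring
    rwa [e])
  obtain ⟨m, hm⟩ := exists_int_of_isIntegral (q := p ^ 2 + D * q ^ 2) (by
    have := hzint.mul hzint'
    rw [hconj, hpq] at this
    have e : ((p ^ 2 + D * q ^ 2 : ℚ) : ℂ) = (p + q * rootNeg D) * (p - q * rootNeg D) := by
      push_cast; linear_combination (q : ℂ) ^ 2 * hr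
    rwa [e])
  have hY : D * (2 * q) ^ 2 = ((4 * m - X ^ 2 : ℤ) : ℚ) := by
    push_cast; rw [← hm, ← hX]; ring
  obtain ⟨Y, hY'⟩ := Rat.exists_int_of_sq_mul hsq hY
  refine ⟨X, Y, ?_, m, ?_⟩
  · rw [hpq]
    have e1 : (X : ℂ) = 2 * p := by exact_mod_cast congrArg (fun x : ℚ => (x : ℂ)) hX.symm
    have e2 : (Y : ℂ) = 2 * q := by exact_mod_cast congrArg (fun x : ℚ => (x : ℂ)) hY'.symm
    rw [e1, e2]; ring
  · rw [hY'] at hY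
    have : (D : ℤ) * Y ^ 2 = 4 * m - X ^ 2 := by exact_mod_cast hY
    linarith

namespace RSphere

open CycleCert

theorem QuadMap.toMap_smul (F : QuadMap) {c : ℂ} (hc : c ≠ 0) :
    (⟨c * F.p₂, c * F.p₁, c * F.p₀, c * F.q₂, c * F.q₁, c * F.q₀⟩ : QuadMap).toMap = F.toMap := by
  funext z
  obtain ⟨u, v, h, rfl⟩ := exists_eq_ofHom z
  rw [toMap_ofHom _ h, toMap_ofHom F h, ← ofHom_mul hc (F.num u v)]
  simp only [num, den]
  congr 1 <;> ring

theorem QuadMap.Nondeg.smul {F : QuadMap} (hF : F.Nondeg) {c : ℂ} (hc : c ≠ 0) :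
    (⟨c * F.p₂, c * F.p₁, c * F.p₀, c * F.q₂, c * F.q₁, c * F.q₀⟩ : QuadMap).Nondeg := by
  intro u v h1 h2
  refine hF u v ?_ ?_
  · apply (mul_eq_zero.1 (?_ : c * F.num u v = 0)).resolve_left hc
    rw [← h1]; simp only [num]; ring
  · apply (mul_eq_zero.1 (?_ : c * F.den u v = 0)).resolve_left hc
    rw [← h2]; simp only [den]; ring

/-- A valid certificate contradicts integrality of the multipliers. -/
theorem not_smallMultipliersIn_of_check {D s D' : ℕ} {F : ZQuad} {C : CycleCert} {r : ℂ}
    (hD' : 0 < D') (hsq : Squarefree D')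
    (hr : r ^ 2 = -D) (hD : 0 < D) (hs : D ≤ s ^ 2) (him : C.im = true → D = D')
    (hF : (F.toQuad r).Nondeg) (h : C.check D s F = true) :
    ¬ SmallMultipliersIn (imQuadInt D') (F.toQuad r).toMap := by
  intro hsm
  obtain ⟨a, ha, ha5, hmul⟩ := exists_cycle_of_check hr hD hs hF h
  obtain ⟨X, Y, hXY, -⟩ := exists_of_mem_imQuadInt hsq (hsm a ha ha5)
  set μ := multiplier (F.toQuad r).toMap a
  obtain ⟨hr1, hr2⟩ := ZRoot.re_root hr hD
  obtain ⟨hr3, hr4⟩ := ZRoot.re_root (rootNeg_sq D') hD'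
  cases him' : C.im
  -- Only the rational part is tested. As `r` and `rootNeg D'` are both purely imaginary, that part
  -- is the integer `X` whatever field contains the multiplier, so `D` and `D'` may differ.
  · rw [him'] at hmul
    have hri : r.im ≠ 0 := by
      intro h0
      rw [h0] at hr2
      have : (0 : ℝ) < D := by exact_mod_cast hD
      simp at hr2
      exact this.ne hr2
    refine hmul X ((2 * μ).im / r.im) ?_ X rfl
    rw [hXY]
    apply Complex.ext
    · simp [hr1, hr3]
    · simp; field_simp
  · have hDD := him him'
    subst hDD
    rw [him'] at hmul
    -- `r` is one of the two square roots; the other choice only changes the sign of `Y`.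
    have h3 : (r - rootNeg D) * (r + rootNeg D) = 0 := by
      linear_combination hr - rootNeg_sq D
    rcases mul_eq_zero.1 h3 with h4 | h4
    · refine hmul X Y ?_ Y rfl
      rw [hXY, sub_eq_zero.1 h4]; simp
    · refine hmul X (-Y : ℤ) ?_ (-Y) rfl
      rw [hXY, eq_neg_of_add_eq_zero_left h4]; simp

end RSphere

/-! ### Multipliers at fixed points and at cycles of period 3 -/

namespace RSphere
namespace QuadMap

theorem Nondeg.mem_of_fixed {F : QuadMap} (hF : F.Nondeg) {R : Subring ℂ}
    (hR : SmallMultipliersIn R F.toMap) {u v : ℂ} (h : u ≠ 0 ∨ v ≠ 0) (h1 : F.num u v = u)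
    (h2 : F.den u v = v) : F.jac u v / 2 ∈ R := by
  have hfix : F.toMap (ofHom u v) = ofHom u v := by rw [toMap_ofHom F h, h1, h2]
  have hp : Function.minimalPeriod F.toMap (ofHom u v) = 1 :=
    Function.minimalPeriod_eq_one_iff_isFixedPt.2 hfix
  have hm := hR (ofHom u v) ⟨1, one_pos, hfix⟩ (by omega)
  have hd := hF.hasSDerivAt h
  rw [h1, h2, div_self (hscale_ne_zero h), one_pow, mul_one] at hd
  rwa [HasSDerivAt.multiplier_eq (m := F.jac u v / 2) (by rw [hp]; exact hd)] at hm

theorem mem_of_normalForm {a b : ℂ} (h : a * b ≠ 1) {R : Subring ℂ}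
    (hR : SmallMultipliersIn R (normalForm a b).toMap) : a ∈ R ∧ b ∈ R := by
  have h1 := (nondeg_normalForm h).mem_of_fixed hR (u := 0) (v := 1) (by simp)
    (by simp [num, normalForm]) (by simp [den, normalForm])
  have h2 := (nondeg_normalForm h).mem_of_fixed hR (u := 1) (v := 0) (by simp)
    (by simp [num, normalForm]) (by simp [den, normalForm])
  simp only [jac, normalForm] at h1 h2
  ring_nf at h1 h2
  exact ⟨h1, h2⟩

/-- The derivative of a quadratic map at a finite point that is not a pole. -/
theorem Nondeg.hasSDerivAt_coe {F : QuadMap} (hF : F.Nondeg) {x y : ℂ} (hx : F.den x 1 ≠ 0)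
    (hxy : F.num x 1 = y * F.den x 1) :
    F.toMap (x : RSphere) = y ∧ HasSDerivAt F.toMap (F.jac x 1 / 2 / F.den x 1 ^ 2) x := by
  have h := hF.hasSDerivAt (u := x) (v := 1) (by simp)
  rw [ofHom_one_right] at h
  constructor
  · rw [← ofHom_one_right, toMap_ofHom F (by simp), ofHom_of_ne hx, hxy, mul_div_cancel_right₀ _ hx]
  · simpa [hscale, hx, div_eq_mul_inv] using h

/-- Since 3 is prime, a point that returns after three steps and is not fixed has least period 3;
the chain rule gives the multiplier. -/
theorem Nondeg.mem_of_cycle_three {F : QuadMap} (hF : F.Nondeg) {R : Subring ℂ}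
    (hR : SmallMultipliersIn R F.toMap) {x y z : ℂ} (hx : F.den x 1 ≠ 0) (hy : F.den y 1 ≠ 0)
    (hz : F.den z 1 ≠ 0) (hxy : F.num x 1 = y * F.den x 1) (hyz : F.num y 1 = z * F.den y 1)
    (hzx : F.num z 1 = x * F.den z 1) (hne : x ≠ y) :
    F.jac x 1 / 2 / F.den x 1 ^ 2 * (F.jac y 1 / 2 / F.den y 1 ^ 2) *
      (F.jac z 1 / 2 / F.den z 1 ^ 2) ∈ R := by
  obtain ⟨ex, dx⟩ := hF.hasSDerivAt_coe hx hxy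
  obtain ⟨ey, dy⟩ := hF.hasSDerivAt_coe hy hyz
  obtain ⟨ez, dz⟩ := hF.hasSDerivAt_coe hz hzx
  have h3 : Function.IsPeriodicPt F.toMap 3 x := by
    change F.toMap (F.toMap (F.toMap x)) = x
    rw [ex, ey, ez]
  have hp : Function.minimalPeriod F.toMap x = 3 := by
    rcases (Nat.dvd_prime Nat.prime_three).1 h3.minimalPeriod_dvd with h | h
    · have := Function.minimalPeriod_eq_one_iff_isFixedPt.1 h
      rw [Function.IsFixedPt, ex, OnePoint.coe_eq_coe] at this
      exact absurd this.symm hne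
    · exact h
  have hm := hR x ⟨3, by norm_num, h3⟩ (by omega)
  have d1 : HasSDerivAt (F.toMap ∘ F.toMap) _ (x : RSphere) :=
    HasSDerivAt.comp (by rw [ex]; exact dy) dx
  have d2 : HasSDerivAt (F.toMap ∘ (F.toMap ∘ F.toMap)) _ (x : RSphere) :=
    HasSDerivAt.comp (by rw [Function.comp_apply, ex, ey]; exact dz) d1
  rw [HasSDerivAt.multiplier_eq (m := _) (by rw [hp]; exact d2)] at hm
  convert hm using 1
  ring

end QuadMap
end RSphere

/-! ### Tables of excluded pairs and of models -/

/-- A pair of doubled fixed point multipliers `a`, `b` in `ℤ[√-D]`, with an approximate cycle of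
the map `z (z + a / 2) / (b z / 2 + 1)`. -/
structure NormalFormCert where
  D : ℕ
  a : ZRoot
  b : ZRoot
  cert : CycleCert

namespace NormalFormCert

/-- The normal form of quadratic maps, with the coefficients doubled. -/
def quad (a b : ZRoot) : ZQuad := ⟨⟨2, 0⟩, a, ⟨0, 0⟩, ⟨0, 0⟩, b, ⟨2, 0⟩⟩

/-- A rough upper bound for the square root, if `D ≤ 16`. -/
def rootBound (D : ℕ) : ℕ := if D ≤ 1 then 1 else if D ≤ 4 then 2 else 4

def check (e : NormalFormCert) : Bool :=
  decide (0 < e.D) && decide (e.D ≤ rootBound e.D ^ 2) &&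
    e.cert.check e.D (rootBound e.D) (quad e.a e.b)

/-- Pairs of fixed point multipliers of quadratic maps that have a cycle of period at most `5`
whose multiplier is not integral. -/
def excluded : List NormalFormCert := [
  ⟨1, ⟨2, 2⟩, ⟨0, -2⟩, ⟨5, ⟨11988825, -543334⟩, 10000000, 21, 15, false⟩⟩,
  ⟨1, ⟨0, 2⟩, ⟨2, -4⟩, ⟨3, ⟨-362179, -203507⟩, 1000000, 6, 12, false⟩⟩,
  ⟨1, ⟨0, 2⟩, ⟨0, -4⟩, ⟨4, ⟨39125, -474882⟩, 1000000, 5, 14, true⟩⟩,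
  ⟨1, ⟨0, 2⟩, ⟨-2, 0⟩, ⟨3, ⟨78414, -43170⟩, 100000, 6, 21, true⟩⟩,
  ⟨1, ⟨0, 2⟩, ⟨-2, -2⟩, ⟨3, ⟨62045, -26710⟩, 100000, 7, 7, false⟩⟩,
  ⟨1, ⟨0, 2⟩, ⟨-2, -4⟩, ⟨5, ⟨-832292808, -721792937⟩, 100000000, 24, 74, false⟩⟩,
  ⟨1, ⟨-2, 2⟩, ⟨-4, -2⟩, ⟨5, ⟨-27584917, 17069103⟩, 10000000, 3, 19, false⟩⟩,
  ⟨1, ⟨-2, 0⟩, ⟨-2, 4⟩, ⟨4, ⟨6492286, 3431962⟩, 10000000, 4, 50, true⟩⟩,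
  ⟨1, ⟨-2, 0⟩, ⟨-2, 2⟩, ⟨3, ⟨62038, 68062⟩, 100000, 7, 10, true⟩⟩,
  ⟨1, ⟨-2, 0⟩, ⟨-4, 2⟩, ⟨3, ⟨697265, 151208⟩, 1000000, 4, 35, true⟩⟩,
  ⟨2, ⟨0, 2⟩, ⟨-2, -2⟩, ⟨5, ⟨34185571, 30083695⟩, 100000000, 9, 16, true⟩⟩,
  ⟨2, ⟨-2, 2⟩, ⟨-2, -2⟩, ⟨4, ⟨9802203, -13887019⟩, 10000000, 8, 25, true⟩⟩,
  ⟨2, ⟨-2, 0⟩, ⟨-2, 2⟩, ⟨3, ⟨314293, 436187⟩, 1000000, 7, 22, false⟩⟩,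
  ⟨3, ⟨2, 2⟩, ⟨-1, -1⟩, ⟨5, ⟨647949, -988686⟩, 10000000, 4, 34, false⟩⟩,
  ⟨3, ⟨1, 1⟩, ⟨2, -2⟩, ⟨4, ⟨-34772233, -11772113⟩, 100000000, 13, 39, true⟩⟩,
  ⟨3, ⟨1, 1⟩, ⟨0, -2⟩, ⟨5, ⟨294937370, 112504557⟩, 100000000, 10, 57, false⟩⟩,
  ⟨3, ⟨1, 1⟩, ⟨-1, -1⟩, ⟨4, ⟨465442, -173397⟩, 1000000, 25, 13, false⟩⟩,
  ⟨3, ⟨0, 2⟩, ⟨0, -2⟩, ⟨3, ⟨-250991, 33532⟩, 100000, 3, 13, true⟩⟩,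
  ⟨3, ⟨0, 2⟩, ⟨-2, 0⟩, ⟨3, ⟨36816, 9576⟩, 100000, 2, 17, true⟩⟩,
  ⟨3, ⟨-1, 1⟩, ⟨0, -2⟩, ⟨4, ⟨6055043, 4758584⟩, 10000000, 23, 31, false⟩⟩,
  ⟨3, ⟨-1, 1⟩, ⟨-1, 1⟩, ⟨5, ⟨-10489885, 7040027⟩, 10000000, 15, 35, false⟩⟩,
  ⟨3, ⟨-1, 1⟩, ⟨-1, -3⟩, ⟨4, ⟨-5078064, -289502⟩, 10000000, 7, 24, true⟩⟩,
  ⟨3, ⟨-1, 1⟩, ⟨-2, 0⟩, ⟨4, ⟨-582015, -633183⟩, 1000000, 8, 19, false⟩⟩,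
  ⟨3, ⟨-1, 1⟩, ⟨-2, -2⟩, ⟨4, ⟨20827561, -22528242⟩, 100000000, 19, 48, true⟩⟩,
  ⟨3, ⟨-1, 1⟩, ⟨-3, -1⟩, ⟨4, ⟨-9945956, -1929735⟩, 10000000, 21, 21, false⟩⟩,
  ⟨3, ⟨-1, 1⟩, ⟨-4, 0⟩, ⟨4, ⟨-908759, -434535⟩, 1000000, 6, 24, false⟩⟩,
  ⟨3, ⟨-1, 1⟩, ⟨-4, -2⟩, ⟨5, ⟨460022295, -163833984⟩, 1000000000, 20, 37, false⟩⟩,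
  ⟨3, ⟨-2, 2⟩, ⟨-3, -1⟩, ⟨5, ⟨40213170, -20000577⟩, 100000000, 8, 23, false⟩⟩,
  ⟨3, ⟨-2, 0⟩, ⟨-3, 1⟩, ⟨3, ⟨-1042110, 80326⟩, 1000000, 5, 41, false⟩⟩,
  ⟨3, ⟨-2, 0⟩, ⟨-4, 2⟩, ⟨3, ⟨6302109, 1302736⟩, 10000000, 4, 49, true⟩⟩,
  ⟨3, ⟨-3, 1⟩, ⟨-3, 1⟩, ⟨5, ⟨52328018, 21317559⟩, 100000000, 30, 30, true⟩⟩,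
  ⟨7, ⟨1, 1⟩, ⟨1, -1⟩, ⟨4, ⟨-42658825, -15119960⟩, 100000000, 33, 28, false⟩⟩,
  ⟨7, ⟨-1, 1⟩, ⟨-1, -1⟩, ⟨4, ⟨75556728, 49359715⟩, 100000000, 28, 18, false⟩⟩,
  ⟨7, ⟨-1, 1⟩, ⟨-2, 0⟩, ⟨3, ⟨945926, -182620⟩, 1000000, 15, 26, true⟩⟩,
  ⟨7, ⟨-2, 0⟩, ⟨-3, 1⟩, ⟨3, ⟨7247085, 919000⟩, 10000000, 17, 43, true⟩⟩,
  ⟨7, ⟨-2, 0⟩, ⟨-5, 1⟩, ⟨3, ⟨3338411, 731017⟩, 10000000, 11, 25, true⟩⟩,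
  ⟨15, ⟨-2, 0⟩, ⟨-1, 1⟩, ⟨3, ⟨698599, 121166⟩, 1000000, 20, 16, true⟩⟩,
  ⟨15, ⟨-2, 0⟩, ⟨-3, 1⟩, ⟨3, ⟨6434369, 770113⟩, 10000000, 10, 19, true⟩⟩,
  ⟨1, ⟨-2, 0⟩, ⟨0, 0⟩, ⟨4, ⟨74150, 58611⟩, 100000, 6, 15, false⟩⟩,
  ⟨1, ⟨2, -2⟩, ⟨0, 0⟩, ⟨4, ⟨-119325, 100089⟩, 100000, 5, 50, false⟩⟩,
  ⟨1, ⟨6, 0⟩, ⟨0, 0⟩, ⟨4, ⟨-2938156, -57670⟩, 1000000, 12, 75, false⟩⟩,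
  ⟨3, ⟨-1, -1⟩, ⟨0, 0⟩, ⟨4, ⟨82916, 73761⟩, 100000, 4, 37, false⟩⟩,
  ⟨3, ⟨5, -1⟩, ⟨0, 0⟩, ⟨4, ⟨-2335326, 647397⟩, 1000000, 18, 37, false⟩⟩,
  ⟨1, ⟨-2, 0⟩, ⟨-6, 0⟩, ⟨5, ⟨21491688, 0⟩, 1000000, 1, 203, false⟩⟩,
  ⟨1, ⟨-2, 0⟩, ⟨-4, 0⟩, ⟨4, ⟨-64676, 0⟩, 100000, 1, 34, false⟩⟩,
  ⟨1, ⟨2, 0⟩, ⟨-2, 0⟩, ⟨4, ⟨289935, 118161⟩, 1000000, 3, 34, false⟩⟩,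
  ⟨1, ⟨2, 0⟩, ⟨-6, 0⟩, ⟨4, ⟨512703, 0⟩, 100000, 1, 119, false⟩⟩,
  ⟨1, ⟨2, 0⟩, ⟨-4, 0⟩, ⟨4, ⟨290616, 0⟩, 100000, 3, 20, false⟩⟩,
  ⟨1, ⟨2, 0⟩, ⟨0, 0⟩, ⟨4, ⟨30250, 54534⟩, 100000, 4, 43, false⟩⟩,
  ⟨1, ⟨2, 0⟩, ⟨4, 0⟩, ⟨4, ⟨-2606452, 0⟩, 10000000, 3, 100, false⟩⟩,
  ⟨3, ⟨2, 0⟩, ⟨-1, -1⟩, ⟨4, ⟨273310, 1230590⟩, 1000000, 2, 63, false⟩⟩]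

/-- The numerical core for normal forms: exact integer arithmetic validates every tabulated cycle.
-/
theorem check_excluded : excluded.all check = true := by decide +kernel

/-- Pairs of doubled fixed point multipliers of power maps, Chebyshev maps and Lattès maps. -/
def special : List (ℕ × ZRoot × ZRoot) := [
  (1, ⟨0, 0⟩, ⟨0, 0⟩), (1, ⟨4, 0⟩, ⟨0, 0⟩), (1, ⟨-4, 0⟩, ⟨-4, 0⟩),
  (1, ⟨8, 0⟩, ⟨0, 0⟩), (1, ⟨-4, 0⟩, ⟨0, 0⟩),
  (1, ⟨-2, -2⟩, ⟨-2, 2⟩), (1, ⟨0, 4⟩, ⟨-2, -2⟩), (1, ⟨-2, -2⟩, ⟨-2, -2⟩),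
  (2, ⟨0, 2⟩, ⟨0, -2⟩), (7, ⟨-1, -1⟩, ⟨-3, 1⟩), (7, ⟨1, 1⟩, ⟨-1, -1⟩)]

/-- The pair occurs in one of the lists. -/
def listed (D : ℕ) (im : Bool) (a b : ZRoot) : Bool :=
  special.any (fun e => decide (e = (D, a, b))) ||
    excluded.any fun e => decide (e.D = D) && decide (e.a = a) && decide (e.b = b) &&
      (im || !e.cert.im)

/-- The pair occurs in one of the lists, up to order and conjugation. -/
def listedUpTo (D : ℕ) (im : Bool) (a b : ZRoot) : Bool :=
  listed D im a b || listed D im b a || listed D im a.conj b.conj || listed D im b.conj a.conj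

/-- The pair occurs in one of the lists, up to order and conjugation; pairs of integers are
not considered as elements of a particular quadratic ring. -/
def resolved (D : ℕ) (a b : ZRoot) : Bool :=
  if a.y = 0 ∧ b.y = 0 then listedUpTo 1 false a b else listedUpTo D true a b

end NormalFormCert

/-- Lets one table entry serve a pair and its conjugate: the opposite square root undoes the
conjugation. -/
theorem ZRoot.toC_conj (r : ℂ) (a : ZRoot) : a.conj.toC (-r) = a.toC r := by
  simp [ZRoot.toC, ZRoot.conj]

namespace RSphere

open QuadMap NormalFormCert

/-- The numbers `a` and `b` are the multipliers of a listed power map, Chebyshev map or Lattès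
map. -/
def IsModelPair (a b : ℂ) : Prop :=
  ∃ e ∈ NormalFormCert.special, ∃ r : ℂ, r ^ 2 = -(e.1 : ℂ) ∧ 2 * a = e.2.1.toC r ∧
    2 * b = e.2.2.toC r

/-- A pair found in `excluded` contradicts the integrality of the multipliers, so only `special`
remains. The doubled coefficients in `quad` define the same map as the normal form. -/
theorem isModelPair_of_listed {D D' : ℕ} (hD' : 0 < D') (hsq : Squarefree D') {r a b : ℂ}
    (hr : r ^ 2 = -D) {im : Bool} (him : im = true → D = D') (hab : a * b ≠ 1) {A B : ZRoot}
    (hA : 2 * a = A.toC r) (hB : 2 * b = B.toC r)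
    (hR : SmallMultipliersIn (imQuadInt D') (normalForm a b).toMap)
    (h : listed D im A B = true) : IsModelPair a b := by
  rw [listed, Bool.or_eq_true, List.any_eq_true, List.any_eq_true] at h
  rcases h with ⟨e, he, h⟩ | ⟨e, he, h⟩
  · have := of_decide_eq_true h
    subst this
    exact ⟨_, he, r, hr, hA, hB⟩
  · simp only [Bool.and_eq_true, decide_eq_true_eq, Bool.or_eq_true, Bool.not_eq_true'] at h
    obtain ⟨⟨⟨rfl, rfl⟩, rfl⟩, h4⟩ := h
    have hc := List.all_eq_true.1 check_excluded e he
    simp only [check, Bool.and_eq_true, decide_eq_true_eq] at hc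
    have hq : (quad e.a e.b).toQuad r = ⟨2 * (normalForm a b).p₂, 2 * (normalForm a b).p₁,
        2 * (normalForm a b).p₀, 2 * (normalForm a b).q₂, 2 * (normalForm a b).q₁,
        2 * (normalForm a b).q₀⟩ := by
      simp [quad, ZQuad.toQuad, normalForm, hA, hB]
      simp [ZRoot.toC]
    refine absurd ?_ (not_smallMultipliersIn_of_check (F := quad e.a e.b) hD' hsq hr hc.1.1 hc.1.2
      ?_ ?_ hc.2)
    · rw [hq, toMap_smul _ two_ne_zero]
      exact hR
    · intro h5
      rcases h4 with h4 | h4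
      · exact him h4
      · rw [h4] at h5; cases h5
    · rw [hq]
      exact (nondeg_normalForm hab).smul two_ne_zero

theorem isModelPair_of_listedUpTo {D D' : ℕ} (hD' : 0 < D') (hsq : Squarefree D') {r a b : ℂ}
    (hr : r ^ 2 = -D) {im : Bool} (him : im = true → D = D') (hab : a * b ≠ 1) {A B : ZRoot}
    (hA : 2 * a = A.toC r) (hB : 2 * b = B.toC r)
    (hR : SmallMultipliersIn (imQuadInt D') (normalForm a b).toMap)
    (h : listedUpTo D im A B = true) : IsModelPair a b ∨ IsModelPair b a := by
  have hR' := hR.conj (nondeg_normalForm hab).sdifferentiable (isConj_normalForm_swap hab)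
  have hab' : b * a ≠ 1 := by rwa [mul_comm]
  have hr' : (-r) ^ 2 = -D := by rw [neg_sq, hr]
  simp only [listedUpTo, Bool.or_eq_true] at h
  rcases h with ((h | h) | h) | h
  · exact Or.inl (isModelPair_of_listed hD' hsq hr him hab hA hB hR h)
  · exact Or.inr (isModelPair_of_listed hD' hsq hr him hab' hB hA hR' h)
  · exact Or.inl (isModelPair_of_listed hD' hsq hr' him hab (by rw [hA, ZRoot.toC_conj])
      (by rw [hB, ZRoot.toC_conj]) hR h)
  · exact Or.inr (isModelPair_of_listed hD' hsq hr' him hab' (by rw [hB, ZRoot.toC_conj])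
      (by rw [hA, ZRoot.toC_conj]) hR' h)

theorem isModelPair_of_resolved {D : ℕ} (hD : 0 < D) (hsq : Squarefree D) {r a b : ℂ}
    (hr : r ^ 2 = -D) {A B : ZRoot} (hab : a * b ≠ 1)
    (hA : 2 * a = A.toC r) (hB : 2 * b = B.toC r)
    (hR : SmallMultipliersIn (imQuadInt D) (normalForm a b).toMap)
    (h : resolved D A B = true) : IsModelPair a b ∨ IsModelPair b a := by
  rw [resolved] at h
  split_ifs at h with h0
  -- For two rational integers the field is irrelevant: the tables use the root `I` of -1, and only
  -- certificates about the rational part are admitted.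
  · refine isModelPair_of_listedUpTo hD hsq (r := Complex.I) (by simp) (by simp) hab ?_ ?_ hR h
    · rw [hA]; simp [ZRoot.toC, h0.1]
    · rw [hB]; simp [ZRoot.toC, h0.2]
  · exact isModelPair_of_listedUpTo hD hsq hr (fun _ => rfl) hab hA hB hR h

/-- The map `z + 1 / z` has a cycle whose multiplier is not integral. -/
theorem not_smallMultipliersIn_parabolicMap {D : ℕ} (hD : 0 < D) (hsq : Squarefree D) :
    ¬ SmallMultipliersIn (imQuadInt D) parabolicMap.toMap := by
  -- A cycle of period 5 through a point near 1.50182 i. Its rational part is tested, hence it works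
  -- for every field.
  have h := not_smallMultipliersIn_of_check (D := 1) (s := 1) (r := Complex.I)
    (F := ⟨⟨1, 0⟩, ⟨0, 0⟩, ⟨1, 0⟩, ⟨0, 0⟩, ⟨1, 0⟩, ⟨0, 0⟩⟩)
    (C := ⟨5, ⟨0, 150182⟩, 100000, 1, 90, false⟩) hD hsq (by simp) one_pos (by norm_num) (by simp)
  have hq : ZQuad.toQuad Complex.I ⟨⟨1, 0⟩, ⟨0, 0⟩, ⟨1, 0⟩, ⟨0, 0⟩, ⟨1, 0⟩, ⟨0, 0⟩⟩ =
      parabolicMap := by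
    simp [ZQuad.toQuad, ZRoot.toC, parabolicMap]
  rw [hq] at h
  exact h nondeg_parabolicMap (by decide +kernel)

end RSphere

/-! ### Finite searches for the candidate pairs -/

namespace ZRoot

def norm (D : ℕ) (a : ZRoot) : ℤ := a.x * a.x + D * (a.y * a.y)

/-- The quotient, if the division is exact. -/
def quo (D : ℕ) (a b : ZRoot) : ZRoot :=
  ⟨(a.mul D b.conj).x / norm D b, (a.mul D b.conj).y / norm D b⟩

theorem eq_quo {D : ℕ} {a b c : ZRoot} (hb : norm D b ≠ 0) (h : c.mul D b = a) : c = quo D a b := by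
  subst h
  have h1 : ((c.mul D b).mul D b.conj).x = norm D b * c.x := by simp only [mul, conj, norm]; ring
  have h2 : ((c.mul D b).mul D b.conj).y = norm D b * c.y := by simp only [mul, conj, norm]; ring
  cases c
  simp only [quo, h1, h2, Int.mul_ediv_cancel_left _ hb]

theorem norm_nonneg (D : ℕ) (a : ZRoot) : 0 ≤ norm D a :=
  add_nonneg (mul_self_nonneg _) (mul_nonneg (Int.natCast_nonneg _) (mul_self_nonneg _))

theorem eq_zero_of_norm_eq_zero {D : ℕ} (hD : 0 < D) {a : ZRoot} (h : norm D a = 0) :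
    a = ⟨0, 0⟩ := by
  have hD' : (0 : ℤ) < D := by exact_mod_cast hD
  have h1 := mul_self_nonneg a.x
  have h2 := mul_self_nonneg a.y
  have h3 : a.x * a.x = 0 := by rw [norm] at h; nlinarith
  have h4 : a.y * a.y = 0 := by rw [norm] at h; nlinarith
  cases a
  simp_all

/-- The elements of the ring of norm at most `b ^ 2`, divisible by `4`. -/
def ball (D b : ℕ) : List ZRoot :=
  ((List.range (2 * b + 1)).flatMap fun i : ℕ =>
    (List.range (2 * b + 1)).map fun j : ℕ => (⟨(i : ℤ) - b, (j : ℤ) - b⟩ : ZRoot)).filter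
      fun a => decide (norm D a ≤ b ^ 2) && decide (norm D a % 4 = 0)

theorem mem_ball {D b : ℕ} (hD : 0 < D) {a : ZRoot} (h : norm D a ≤ b ^ 2)
    (h4 : 4 ∣ norm D a) : a ∈ ball D b := by
  have hD' : (1 : ℤ) ≤ D := by exact_mod_cast hD
  have h1 := mul_self_nonneg a.x
  have h2 := mul_self_nonneg a.y
  have hx : |a.x| ≤ b := abs_le_of_sq_le_sq (by rw [norm] at h; nlinarith) (by positivity)
  have hy : |a.y| ≤ b := abs_le_of_sq_le_sq (by rw [norm] at h; nlinarith) (by positivity)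
  rw [abs_le] at hx hy
  simp only [ball, List.mem_filter, List.mem_flatMap, List.mem_map, List.mem_range,
    Bool.and_eq_true, decide_eq_true_eq]
  refine ⟨⟨(a.x + b).toNat, by omega, (a.y + b).toNat, by omega, ?_⟩, h, by omega⟩
  obtain ⟨x, y⟩ := a
  simp only [mk.injEq] at hx hy ⊢
  omega

/-- A nonzero `y` contributes at least `D` to the norm. This is what reduces large `D` to rational
integers. -/
theorem y_eq_zero_of_norm_le {D b : ℕ} {a : ZRoot} (h : norm D a ≤ b) (hb : b < D) :
    a.y = 0 := by
  by_contra h0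
  have h1 := mul_self_nonneg a.x
  have h2 : 0 < a.y * a.y := mul_self_pos.2 h0
  have h3 : (b : ℤ) < D := by exact_mod_cast hb
  rw [norm] at h
  nlinarith

theorem norm_of_y_eq_zero {a : ZRoot} (h : a.y = 0) (D D' : ℕ) : norm D a = norm D' a := by
  simp [norm, h]

theorem mul_of_y_eq_zero {a b : ZRoot} (h : a.y = 0) (D D' : ℕ) :
    a.mul D b = a.mul D' b := by
  simp [mul, h]

def two : ZRoot := ofNat 2

/-- A necessary condition for squarefreeness, sufficient for small numbers. -/
def squarefreeTest (D : ℕ) : Bool :=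
  decide (0 < D) && decide (D % 4 ≠ 0) && decide (D % 9 ≠ 0) && decide (D % 25 ≠ 0) &&
    decide (D % 49 ≠ 0)

theorem squarefreeTest_eq_true {D : ℕ} (hD : 0 < D) (h : Squarefree D) :
    squarefreeTest D = true := by
  have key : ∀ p, 1 < p → D % (p * p) ≠ 0 := fun p hp h0 =>
    hp.ne' (Nat.isUnit_iff.1 (h p (Nat.dvd_of_mod_eq_zero h0)))
  simp only [squarefreeTest, Bool.and_eq_true, decide_eq_true_eq]
  exact ⟨⟨⟨⟨hD, key 2 (by norm_num)⟩, key 3 (by norm_num)⟩, key 5 (by norm_num)⟩,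
    key 7 (by norm_num)⟩

open NormalFormCert

/-- Here `α = 2 (1 - a)` and `β = 2 (1 - b)`. With `γ = 2 (1 - c)` the fixed point relation becomes
`γ * W = P`, and `W` is `4 (a b - 1)`. The alternatives before the last one discard multipliers
equal to 0 or 1, a `γ` that fails the integrality test, and triples not sorted by norm. -/
def checkTriple (D : ℕ) (α β : ZRoot) : Bool :=
  let P := two.mul D (α.mul D β)
  let W := (α.mul D β).sub (two.mul D (α.add β))
  let γ := quo D P W
  decide (α = ⟨0, 0⟩) || decide (β = ⟨0, 0⟩) || decide (α = two) || decide (β = two) ||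
    decide (norm D W = 0) || !decide (γ.mul D W = P) || decide (γ = two) ||
    !decide (norm D γ % 4 = 0) || decide (norm D γ < norm D β) ||
    decide (norm D β < norm D α) ||
    resolved D (two.sub α) (two.sub β)

theorem checkTriple_eq_true :
    ((List.range 65).filter squarefreeTest).all (fun D => (ball D 6).all fun α =>
      (ball D 8).all fun β => checkTriple D α β) = true := by
  decide +kernel

/-- With `v² = (a - 1)² - 8`, the elements `2 (a - 1 - v)` and `2 (a - 1 + v)`, in either order,
have product 32. Half their sum plus 2 is the doubled multiplier, which is the local `a`. -/
def checkPoly (D : ℕ) (σ : ZRoot) : Bool :=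
  let τ := quo D (ofNat 32) σ
  let a : ZRoot := ⟨(σ.x + τ.x) / 2 + 2, (σ.y + τ.y) / 2⟩
  decide (norm D σ = 0) || !decide (τ.mul D σ = ofNat 32) || !decide (norm D τ % 4 = 0) ||
    !decide (σ.add τ = two.mul D (a.sub two)) || !decide (norm D a % 4 = 0) ||
    resolved D a ⟨0, 0⟩

theorem checkPoly_eq_true :
    ((List.range 37).filter squarefreeTest).all (fun D => (ball D 6).all (checkPoly D)) = true := by
  decide +kernel

/-- With `v² = (b - 1)(b + 2)`, the elements `2 (2 b + 1 - 2 v)` and `2 (2 b + 1 + 2 v)`, in either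
order, have product 36. A quarter of their sum minus 1 is the doubled multiplier `2 b`, which is the
local `a`. -/
def checkParabolic (D : ℕ) (σ : ZRoot) : Bool :=
  let τ := quo D (ofNat 36) σ
  let a : ZRoot := ⟨(σ.x + τ.x) / 4 - 1, (σ.y + τ.y) / 4⟩
  decide (norm D σ = 0) || !decide (τ.mul D σ = ofNat 36) || !decide (norm D τ % 4 = 0) ||
    !decide (σ.add τ = (ofNat 4).mul D (a.add ⟨1, 0⟩)) || !decide (norm D a % 4 = 0) ||
    decide (a = two) || resolved D two a

theorem checkParabolic_eq_true :
    ((List.range 37).filter squarefreeTest).all (fun D => (ball D 6).all (checkParabolic D)) = true := by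
  decide +kernel

/-- The doubled multipliers of a quadratic map with three fixed points whose multipliers are
integers other than `0` and `1` are listed. -/
theorem resolved_of_triple {D : ℕ} (hD : 0 < D) (hsq : Squarefree D) {α β γ : ZRoot}
    (hα : 4 ∣ norm D α) (hβ : 4 ∣ norm D β) (hγ : 4 ∣ norm D γ) (hα' : norm D α ≤ 36)
    (hβ' : norm D β ≤ 64) (hαβ : norm D α ≤ norm D β) (hβγ : norm D β ≤ norm D γ)
    (hα0 : α ≠ ⟨0, 0⟩) (hβ0 : β ≠ ⟨0, 0⟩) (hα2 : α ≠ two) (hβ2 : β ≠ two) (hγ2 : γ ≠ two)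
    (hW : (α.mul D β).sub (two.mul D (α.add β)) ≠ ⟨0, 0⟩)
    (h : γ.mul D ((α.mul D β).sub (two.mul D (α.add β))) = two.mul D (α.mul D β)) :
    resolved D (two.sub α) (two.sub β) = true := by
  -- The discriminant is generalised because this step is used a second time with `D = 1`: beyond
  -- 64, the bound on the norm of `β`, all elements are rational integers.
  have key : ∀ {D : ℕ}, D ≤ 64 → 0 < D → Squarefree D → 4 ∣ norm D α → 4 ∣ norm D β →
      4 ∣ norm D γ → norm D α ≤ 36 → norm D β ≤ 64 → norm D α ≤ norm D β →
      norm D β ≤ norm D γ → (α.mul D β).sub (two.mul D (α.add β)) ≠ ⟨0, 0⟩ →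
      γ.mul D ((α.mul D β).sub (two.mul D (α.add β))) = two.mul D (α.mul D β) →
      resolved D (two.sub α) (two.sub β) = true := by
    intro D h64 hD hsq hα hβ hγ hα' hβ' hαβ hβγ hW h
    have hW' := mt (eq_zero_of_norm_eq_zero hD) hW
    have hq := eq_quo hW' h
    have hc := checkTriple_eq_true
    simp only [List.all_eq_true, List.mem_filter, List.mem_range] at hc
    have hc' := hc D ⟨by omega, squarefreeTest_eq_true hD hsq⟩ α (mem_ball hD hα' hα) β
      (mem_ball hD hβ' hβ)
    simp only [checkTriple, ← hq] at hc'
    simpa [hα0, hβ0, hα2, hβ2, hγ2, hW', h, hαβ.not_gt, hβγ.not_gt, Int.dvd_iff_emod_eq_zero.1 hγ]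
      using hc'
  by_cases h64 : D ≤ 64
  · exact key h64 hD hsq hα hβ hγ hα' hβ' hαβ hβγ hW h
  have yα : α.y = 0 := y_eq_zero_of_norm_le (b := 36) hα' (by omega)
  have yβ : β.y = 0 := y_eq_zero_of_norm_le (b := 64) hβ' (by omega)
  have e1 : α.mul D β = α.mul 1 β := mul_of_y_eq_zero yα _ _
  have e2 : ∀ ζ : ZRoot, two.mul D ζ = two.mul 1 ζ := fun _ => mul_of_y_eq_zero rfl _ _
  rw [e1, e2] at h hW
  rw [e2] at h
  set W := (α.mul 1 β).sub (two.mul 1 (α.add β)) with hWdef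
  have yW : W.y = 0 := by simp [hWdef, mul, sub, add, two, ofNat, yα, yβ]
  have yγ : γ.y = 0 := by
    have := congrArg ZRoot.y h
    have h0 : (two.mul 1 (α.mul 1 β)).y = 0 := by simp [mul, two, ofNat, yα, yβ]
    rw [h0] at this
    simp only [mul, yW, mul_zero, zero_add] at this
    rcases mul_eq_zero.1 this with h1 | h1
    · exact h1
    · exact absurd (show (⟨W.x, W.y⟩ : ZRoot) = _ by rw [h1, yW]) hW
  rw [mul_of_y_eq_zero yγ D 1] at h
  have hr := key (D := 1) (by norm_num) one_pos squarefree_one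
    (by rwa [norm_of_y_eq_zero yα 1 D]) (by rwa [norm_of_y_eq_zero yβ 1 D])
    (by rwa [norm_of_y_eq_zero yγ 1 D]) (by rwa [norm_of_y_eq_zero yα 1 D])
    (by rwa [norm_of_y_eq_zero yβ 1 D])
    (by rwa [norm_of_y_eq_zero yα 1 D, norm_of_y_eq_zero yβ 1 D])
    (by rwa [norm_of_y_eq_zero yγ 1 D, norm_of_y_eq_zero yβ 1 D]) hW h
  simpa [resolved, sub, two, ofNat, yα, yβ] using hr

/-- Two factors of a positive integer, the first one small, are integers if `D` is large. -/
theorem y_eq_zero_of_mul_eq_ofNat {D m : ℕ} (hm : 0 < m) {σ τ : ZRoot} (hσ : σ.y = 0)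
    (h : τ.mul D σ = ofNat m) : τ.y = 0 := by
  have h1 := congrArg ZRoot.y h
  have h2 := congrArg ZRoot.x h
  simp only [mul, hσ, ofNat, mul_zero, zero_add, sub_zero] at h1 h2
  rcases mul_eq_zero.1 h1 with h3 | h3
  · exact h3
  · rw [h3, mul_zero] at h2
    omega

theorem norm_ne_zero_of_mul_eq_ofNat {D m : ℕ} (hD : 0 < D) (hm : 0 < m) {σ τ : ZRoot}
    (h : τ.mul D σ = ofNat m) : norm D σ ≠ 0 := by
  intro h0
  have h2 := congrArg ZRoot.x h
  simp [eq_zero_of_norm_eq_zero hD h0, mul, ofNat] at h2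
  omega

theorem resolved_of_poly {D : ℕ} (hD : 0 < D) (hsq : Squarefree D) {σ τ a : ZRoot}
    (hσ : 4 ∣ norm D σ) (hτ : 4 ∣ norm D τ) (ha : 4 ∣ norm D a) (hσ' : norm D σ ≤ 36)
    (h : τ.mul D σ = ofNat 32) (hadd : σ.add τ = two.mul D (a.sub two)) :
    resolved D a ⟨0, 0⟩ = true := by
  have key : ∀ {D : ℕ}, D ≤ 36 → 0 < D → Squarefree D → 4 ∣ norm D σ → 4 ∣ norm D τ →
      4 ∣ norm D a → norm D σ ≤ 36 → τ.mul D σ = ofNat 32 → σ.add τ = two.mul D (a.sub two) →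
      resolved D a ⟨0, 0⟩ = true := by
    intro D h36 hD hsq hσ hτ ha hσ' h hadd
    have hW' : norm D σ ≠ 0 := norm_ne_zero_of_mul_eq_ofNat hD (by norm_num) h
    have hq := eq_quo hW' h
    have hc := checkPoly_eq_true
    simp only [List.all_eq_true, List.mem_filter, List.mem_range] at hc
    have hc' := hc D ⟨by omega, squarefreeTest_eq_true hD hsq⟩ σ (mem_ball hD hσ' hσ)
    have ea : (⟨(σ.x + τ.x) / 2 + 2, (σ.y + τ.y) / 2⟩ : ZRoot) = a := by
      have h1 := congrArg ZRoot.x hadd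
      have h2 := congrArg ZRoot.y hadd
      simp only [add, mul, sub, two, ofNat] at h1 h2
      obtain ⟨x, y⟩ := a
      simp only [mk.injEq] at h1 h2 ⊢
      push_cast at h1 h2
      omega
    simp only [checkPoly, ← hq, ea] at hc'
    simpa [hW', h, hadd, Int.dvd_iff_emod_eq_zero.1 hτ, Int.dvd_iff_emod_eq_zero.1 ha] using hc'
  by_cases h36 : D ≤ 36
  · exact key h36 hD hsq hσ hτ ha hσ' h hadd
  have yσ : σ.y = 0 := y_eq_zero_of_norm_le (b := 36) hσ' (by omega)
  have yτ : τ.y = 0 := y_eq_zero_of_mul_eq_ofNat (by norm_num) yσ h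
  have e2 : ∀ ζ : ZRoot, two.mul D ζ = two.mul 1 ζ := fun _ => mul_of_y_eq_zero rfl _ _
  have ya : a.y = 0 := by
    have := congrArg ZRoot.y hadd
    simpa [add, mul, sub, two, ofNat, yσ, yτ] using this
  rw [e2] at hadd
  rw [mul_of_y_eq_zero yτ D 1] at h
  have hr := key (D := 1) (by norm_num) one_pos squarefree_one
    (by rwa [norm_of_y_eq_zero yσ 1 D]) (by rwa [norm_of_y_eq_zero yτ 1 D])
    (by rwa [norm_of_y_eq_zero ya 1 D]) (by rwa [norm_of_y_eq_zero yσ 1 D]) h hadd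
  simpa [resolved, ya] using hr

theorem resolved_of_parabolic {D : ℕ} (hD : 0 < D) (hsq : Squarefree D) {σ τ a : ZRoot}
    (hσ : 4 ∣ norm D σ) (hτ : 4 ∣ norm D τ) (ha : 4 ∣ norm D a) (hσ' : norm D σ ≤ 36)
    (h : τ.mul D σ = ofNat 36) (hadd : σ.add τ = (ofNat 4).mul D (a.add ⟨1, 0⟩)) (ha2 : a ≠ two) :
    resolved D two a = true := by
  have key : ∀ {D : ℕ}, D ≤ 36 → 0 < D → Squarefree D → 4 ∣ norm D σ → 4 ∣ norm D τ →
      4 ∣ norm D a → norm D σ ≤ 36 → τ.mul D σ = ofNat 36 →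
      σ.add τ = (ofNat 4).mul D (a.add ⟨1, 0⟩) → resolved D two a = true := by
    intro D h36 hD hsq hσ hτ ha hσ' h hadd
    have hW' : norm D σ ≠ 0 := norm_ne_zero_of_mul_eq_ofNat hD (by norm_num) h
    have hq := eq_quo hW' h
    have hc := checkParabolic_eq_true
    simp only [List.all_eq_true, List.mem_filter, List.mem_range] at hc
    have hc' := hc D ⟨by omega, squarefreeTest_eq_true hD hsq⟩ σ (mem_ball hD hσ' hσ)
    have ea : (⟨(σ.x + τ.x) / 4 - 1, (σ.y + τ.y) / 4⟩ : ZRoot) = a := by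
      have h1 := congrArg ZRoot.x hadd
      have h2 := congrArg ZRoot.y hadd
      simp only [add, mul, ofNat] at h1 h2
      obtain ⟨x, y⟩ := a
      simp only [mk.injEq] at h1 h2 ⊢
      push_cast at h1 h2
      omega
    simp only [checkParabolic, ← hq, ea] at hc'
    simpa [hW', h, hadd, ha2, Int.dvd_iff_emod_eq_zero.1 hτ, Int.dvd_iff_emod_eq_zero.1 ha] using hc'
  by_cases h36 : D ≤ 36
  · exact key h36 hD hsq hσ hτ ha hσ' h hadd
  have yσ : σ.y = 0 := y_eq_zero_of_norm_le (b := 36) hσ' (by omega)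
  have yτ : τ.y = 0 := y_eq_zero_of_mul_eq_ofNat (by norm_num) yσ h
  have e2 : ∀ ζ : ZRoot, (ofNat 4).mul D ζ = (ofNat 4).mul 1 ζ := fun _ => mul_of_y_eq_zero rfl _ _
  have ya : a.y = 0 := by
    have := congrArg ZRoot.y hadd
    simpa [add, mul, ofNat, yσ, yτ] using this
  rw [e2] at hadd
  rw [mul_of_y_eq_zero yτ D 1] at h
  have hr := key (D := 1) (by norm_num) one_pos squarefree_one
    (by rwa [norm_of_y_eq_zero yσ 1 D]) (by rwa [norm_of_y_eq_zero yτ 1 D])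
    (by rwa [norm_of_y_eq_zero ya 1 D]) (by rwa [norm_of_y_eq_zero yσ 1 D]) h hadd
  simpa [resolved, ya, two, ofNat] using hr

end ZRoot

/-! ### Bounds for three fixed point multipliers other than 0 and 1 -/

namespace ZRoot

theorem cast_norm {D : ℕ} {r : ℂ} (hr : r ^ 2 = -D) (hD : 0 < D) (a : ZRoot) :
    (norm D a : ℝ) = ‖a.toC r‖ ^ 2 := by
  have h := sq_norm_toC hr hD a.x a.y
  have e : ‖a.toC r‖ ^ 2 = (a.x : ℝ) ^ 2 + D * (a.y : ℝ) ^ 2 := by rw [← h]; simp [toC]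
  rw [e, norm]; push_cast; ring

theorem toC_injective {D : ℕ} {r : ℂ} (hr : r ^ 2 = -D) (hD : 0 < D) :
    Function.Injective (toC r) := by
  intro a b h
  have h1 := cast_norm hr hD (a.sub b)
  rw [toC_sub, h, sub_self, norm_zero] at h1
  have h2 := eq_zero_of_norm_eq_zero hD (a := a.sub b) (by exact_mod_cast h1)
  obtain ⟨x, y⟩ := a
  obtain ⟨x', y'⟩ := b
  simp only [sub, mk.injEq] at h2 ⊢
  omega

theorem toC_two (r : ℂ) : two.toC r = 2 := by simp [two]

theorem toC_zero (r : ℂ) : (⟨0, 0⟩ : ZRoot).toC r = 0 := by simp [toC]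

end ZRoot

theorem exists_zroot {D : ℕ} (hsq : Squarefree D) {z : ℂ} (hz : z ∈ imQuadInt D) :
    ∃ ζ : ZRoot, 2 * z = ζ.toC (rootNeg D) ∧ 4 ∣ ZRoot.norm D ζ := by
  obtain ⟨X, Y, h, h4⟩ := exists_of_mem_imQuadInt hsq hz
  exact ⟨⟨X, Y⟩, h, by rw [ZRoot.norm]; simpa [pow_two] using h4⟩

/-- The norm of the doubled element is a positive multiple of 4. -/
theorem one_le_norm_of_mem_imQuadInt {D : ℕ} (hD : 0 < D) (hsq : Squarefree D) {z : ℂ}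
    (hz : z ∈ imQuadInt D) (h0 : z ≠ 0) : 1 ≤ ‖z‖ := by
  obtain ⟨ζ, h1, h4⟩ := exists_zroot hsq hz
  have h2 := ZRoot.cast_norm (rootNeg_sq D) hD ζ
  rw [← h1, norm_mul, mul_pow, Complex.norm_ofNat] at h2
  have h3 : ZRoot.norm D ζ ≠ 0 := by
    intro h5
    rw [h5] at h2
    have : ‖z‖ ^ 2 = 0 := by push_cast at h2; linarith
    simp [h0] at this
  have h6 : 4 ≤ ZRoot.norm D ζ :=
    Int.le_of_dvd (lt_of_le_of_ne (ZRoot.norm_nonneg D ζ) h3.symm) h4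
  have h7 : (4 : ℝ) ≤ ZRoot.norm D ζ := by exact_mod_cast h6
  nlinarith [norm_nonneg z]

/-- `v` is a quotient of two elements of the field, and it is integral because its square is. This
extracts `v` from a multiplier that is affine in `v`. -/
theorem mem_imQuadInt_of_sq_mem {D : ℕ} {k v : ℂ} (hk : k ∈ imQuadInt D) (hk0 : k ≠ 0)
    (hkv : k * v ∈ imQuadInt D) (hv : v ^ 2 ∈ imQuadInt D) : v ∈ imQuadInt D := by
  refine Subring.mem_inf.2 ⟨?_, ?_⟩
  · have h1 := (Subring.mem_inf.1 hk).1
    have h2 := (Subring.mem_inf.1 hkv).1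
    rw [← mul_div_cancel_left₀ v hk0]
    exact div_mem (S := IntermediateField ℚ ℂ) h2 h1
  · have h1 : IsIntegral ℤ (v ^ 2) := (Subring.mem_inf.1 hv).2
    exact IsIntegral.of_pow (by norm_num) h1

namespace RSphere
namespace QuadMap

/-- Conjugacy to a normal form from the list of models. -/
def HasModel (f : RSphere → RSphere) : Prop :=
  ∃ a b : ℂ, a * b ≠ 1 ∧ IsModelPair a b ∧ IsConj f (normalForm a b).toMap

theorem HasModel.of_isConj {f g : RSphere → RSphere} (h : HasModel g) (hfg : IsConj f g) :
    HasModel f := by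
  obtain ⟨a, b, hab, hm, hc⟩ := h
  exact ⟨a, b, hab, hm, hfg.trans hc⟩

theorem isConj_refl (f : RSphere → RSphere) : IsConj f f := ⟨1, fun z => by simp⟩

theorem hasModel_of_isModelPair {a b : ℂ} (hab : a * b ≠ 1)
    (h : IsModelPair a b ∨ IsModelPair b a) : HasModel (normalForm a b).toMap := by
  rcases h with h | h
  · exact ⟨a, b, hab, h, isConj_refl _⟩
  · exact ⟨b, a, by rwa [mul_comm], h, isConj_normalForm_swap hab⟩

/-- Three numbers different from `0` and `1` that satisfy the relation between the fixed point
multipliers of a quadratic map. -/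
structure IsTriple (R : Subring ℂ) (a b c : ℂ) : Prop where
  mul_eq : a * b * c = a + b + c - 2
  ne_zero : a ≠ 0 ∧ b ≠ 0 ∧ c ≠ 0
  ne_one : a ≠ 1 ∧ b ≠ 1 ∧ c ≠ 1
  mem : a ∈ R ∧ b ∈ R ∧ c ∈ R

namespace IsTriple

variable {R : Subring ℂ} {a b c : ℂ}

theorem mul_ne_one (h : IsTriple R a b c) : a * b ≠ 1 := by
  intro hab
  have h1 : (a - 1) ^ 2 = 0 := by linear_combination -hab - a * h.mul_eq + a * c * hab
  exact h.ne_one.1 (by linear_combination pow_eq_zero_iff two_ne_zero |>.1 h1)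

theorem swap (h : IsTriple R a b c) : IsTriple R b a c :=
  ⟨by linear_combination h.mul_eq, ⟨h.ne_zero.2.1, h.ne_zero.1, h.ne_zero.2.2⟩,
    ⟨h.ne_one.2.1, h.ne_one.1, h.ne_one.2.2⟩, ⟨h.mem.2.1, h.mem.1, h.mem.2.2⟩⟩

theorem third (h : IsTriple R a b c) : IsTriple R a c b :=
  ⟨by linear_combination h.mul_eq, ⟨h.ne_zero.1, h.ne_zero.2.2, h.ne_zero.2.1⟩,
    ⟨h.ne_one.1, h.ne_one.2.2, h.ne_one.2.1⟩, ⟨h.mem.1, h.mem.2.2, h.mem.2.1⟩⟩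

theorem isConj_swap (h : IsTriple R a b c) :
    IsConj (normalForm a b).toMap (normalForm b a).toMap :=
  isConj_normalForm_swap h.mul_ne_one

theorem isConj_third (h : IsTriple R a b c) :
    IsConj (normalForm a b).toMap (normalForm a c).toMap :=
  (isConj_normalForm_third h.mul_ne_one h.ne_one.1 (by linear_combination -h.mul_eq)).2

theorem hasModel_of_le {D : ℕ} (hD : 0 < D) (hsq : Squarefree D)
    (h : IsTriple (imQuadInt D) a b c)
    (hR : SmallMultipliersIn (imQuadInt D) (normalForm a b).toMap)
    (hab : ‖1 - a‖ ≤ ‖1 - b‖) (hbc : ‖1 - b‖ ≤ ‖1 - c‖) : HasModel (normalForm a b).toMap := by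
  refine hasModel_of_isModelPair h.mul_ne_one ?_
  obtain ⟨α, hα, hα4⟩ := exists_zroot hsq (sub_mem (one_mem _) h.mem.1)
  obtain ⟨β, hβ, hβ4⟩ := exists_zroot hsq (sub_mem (one_mem _) h.mem.2.1)
  obtain ⟨γ, hγ, hγ4⟩ := exists_zroot hsq (sub_mem (one_mem _) h.mem.2.2)
  have hr := rootNeg_sq D
  have nα := ZRoot.cast_norm hr hD α
  have nβ := ZRoot.cast_norm hr hD β
  have nγ := ZRoot.cast_norm hr hD γ
  rw [← hα, norm_mul, mul_pow, Complex.norm_ofNat] at nα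
  rw [← hβ, norm_mul, mul_pow, Complex.norm_ofNat] at nβ
  rw [← hγ, norm_mul, mul_pow, Complex.norm_ofNat] at nγ
  obtain ⟨a0, b0, c0⟩ := h.ne_zero
  obtain ⟨a1, b1, c1⟩ := h.ne_one
  have hA : 0 < ‖1 - a‖ := norm_pos_iff.2 (sub_ne_zero.2 a1.symm)
  have hB : 0 < ‖1 - b‖ := hA.trans_le hab
  have hC : 0 < ‖1 - c‖ := hB.trans_le hbc
  have ha1 : 1 ≤ ‖a‖ := one_le_norm_of_mem_imQuadInt hD hsq h.mem.1 a0
  -- The relation with denominators cleared: three numbers of modulus at most `1 / ‖1 - a‖` have sum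
  -- 1.
  have hA3 : ‖1 - a‖ ≤ 3 := by
    have e : (1 - a) * (1 - b) * (1 - c) =
        (1 - a) * (1 - b) + (1 - b) * (1 - c) + (1 - a) * (1 - c) := by
      linear_combination -h.mul_eq
    have h1 : ‖1 - a‖ * ‖1 - b‖ * ‖1 - c‖ ≤
        ‖1 - a‖ * ‖1 - b‖ + ‖1 - b‖ * ‖1 - c‖ + ‖1 - a‖ * ‖1 - c‖ := by
      simp only [← norm_mul]
      rw [e]
      exact norm_add₃_le
    have h2 : ‖1 - a‖ * ‖1 - b‖ ≤ ‖1 - b‖ * ‖1 - c‖ := by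
      rw [mul_comm]; exact mul_le_mul_of_nonneg_left (hab.trans hbc) hB.le
    have h3 : ‖1 - a‖ * ‖1 - c‖ ≤ ‖1 - b‖ * ‖1 - c‖ := mul_le_mul_of_nonneg_right hab hC.le
    have h4 : 0 < ‖1 - b‖ * ‖1 - c‖ := mul_pos hB hC
    nlinarith
  -- The relation solved for `a`. Since `1 ≤ ‖a‖`, one has `‖1 - a‖ ≤ 2 * ‖a‖`, and the factor `‖a‖`
  -- cancels.
  have hB4 : ‖1 - b‖ ≤ 4 := by
    have e : (1 - b) * (1 - c) * a = -((1 - a) * ((1 - b) + (1 - c))) := by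
      linear_combination h.mul_eq
    have h1 : ‖1 - b‖ * ‖1 - c‖ * ‖a‖ ≤ ‖1 - a‖ * (‖1 - b‖ + ‖1 - c‖) := by
      rw [← norm_mul, ← norm_mul, e, norm_neg, norm_mul]
      exact mul_le_mul_of_nonneg_left (norm_add_le _ _) hA.le
    have h2 : ‖1 - a‖ ≤ 1 + ‖a‖ := (norm_sub_le _ _).trans (by simp)
    have h3 : ‖1 - a‖ * (‖1 - b‖ + ‖1 - c‖) ≤ (2 * ‖a‖) * (2 * ‖1 - c‖) := by
      gcongr <;> linarith
    have h4 : 0 < ‖a‖ * ‖1 - c‖ := mul_pos (by linarith) hC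
    nlinarith
  have ne_of : ∀ {ζ : ZRoot} {z w : ℂ}, 2 * z = ζ.toC (rootNeg D) → z ≠ w → ∀ ξ : ZRoot,
      ξ.toC (rootNeg D) = 2 * w → ζ ≠ ξ := by
    rintro ζ z w h1 h2 ξ h3 rfl
    exact h2 (mul_left_cancel₀ two_ne_zero (h1.trans h3))
  have t0 : (⟨0, 0⟩ : ZRoot).toC (rootNeg D) = 2 * 0 := by simp [ZRoot.toC_zero]
  have t2 : ZRoot.two.toC (rootNeg D) = 2 * 1 := by simp [ZRoot.toC_two]
  have hres := ZRoot.resolved_of_triple hD hsq hα4 hβ4 hγ4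
    (by have : (ZRoot.norm D α : ℝ) ≤ 36 := by rw [nα]; nlinarith
        exact_mod_cast this)
    (by have : (ZRoot.norm D β : ℝ) ≤ 64 := by rw [nβ]; nlinarith
        exact_mod_cast this)
    (by have : (ZRoot.norm D α : ℝ) ≤ ZRoot.norm D β := by rw [nα, nβ]; gcongr
        exact_mod_cast this)
    (by have : (ZRoot.norm D β : ℝ) ≤ ZRoot.norm D γ := by rw [nβ, nγ]; gcongr
        exact_mod_cast this)
    (ne_of hα (sub_ne_zero.2 a1.symm) _ t0) (ne_of hβ (sub_ne_zero.2 b1.symm) _ t0)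
    (ne_of hα (fun h => a0 (by linear_combination -h)) _ t2)
    (ne_of hβ (fun h => b0 (by linear_combination -h)) _ t2)
    (ne_of hγ (fun h => c0 (by linear_combination -h)) _ t2)
    (by
      intro h0
      have h1 := congrArg (ZRoot.toC (rootNeg D)) h0
      rw [ZRoot.toC_zero, ZRoot.toC_sub, ZRoot.toC_mul hr, ZRoot.toC_mul hr, ZRoot.toC_add,
        ZRoot.toC_two, ← hα, ← hβ] at h1
      exact h.mul_ne_one (by linear_combination h1 / 4))
    (by
      apply ZRoot.toC_injective hr hD
      rw [ZRoot.toC_mul hr, ZRoot.toC_sub, ZRoot.toC_mul hr, ZRoot.toC_mul hr, ZRoot.toC_add,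
        ZRoot.toC_two, ← hα, ← hβ, ZRoot.toC_mul hr, ZRoot.toC_mul hr, ← hα, ← hβ, ← hγ,
        ZRoot.toC_two]
      linear_combination -8 * h.mul_eq)
  refine isModelPair_of_resolved hD hsq hr h.mul_ne_one ?_ ?_ hR hres
  · rw [ZRoot.toC_sub, ZRoot.toC_two, ← hα]; ring
  · rw [ZRoot.toC_sub, ZRoot.toC_two, ← hβ]; ring

/-- The relation is symmetric and any two of the three fixed points can be moved to 0 and ∞, so the
multipliers may be sorted by their distance to 1. -/
theorem hasModel {D : ℕ} (hD : 0 < D) (hsq : Squarefree D)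
    (h : IsTriple (imQuadInt D) a b c)
    (hR : SmallMultipliersIn (imQuadInt D) (normalForm a b).toMap) :
    HasModel (normalForm a b).toMap := by
  have sd : ∀ {x y z : ℂ}, IsTriple (imQuadInt D) x y z → SDifferentiable (normalForm x y).toMap :=
    fun h => (nondeg_normalForm h.mul_ne_one).sdifferentiable
  have key : ∀ {x y z : ℂ}, IsTriple (imQuadInt D) x y z →
      IsConj (normalForm a b).toMap (normalForm x y).toMap → ‖1 - x‖ ≤ ‖1 - y‖ →
      ‖1 - y‖ ≤ ‖1 - z‖ → HasModel (normalForm a b).toMap := fun h' hc h1 h2 =>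
    (h'.hasModel_of_le hD hsq (hR.conj (sd h) hc) h1 h2).of_isConj hc
  have c1 := h.isConj_swap
  have c2 := h.isConj_third
  have c3 := c2.trans h.third.isConj_swap
  have c4 := c1.trans h.swap.isConj_third
  have c5 := c4.trans h.swap.third.isConj_swap
  rcases le_total ‖1 - a‖ ‖1 - b‖ with h1 | h1 <;> rcases le_total ‖1 - b‖ ‖1 - c‖ with h2 | h2 <;>
    rcases le_total ‖1 - a‖ ‖1 - c‖ with h3 | h3
  · exact key h (isConj_refl _) h1 h2
  · exact key h (isConj_refl _) h1 h2
  · exact key h.third c2 h3 h2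
  · exact key h.third.swap c3 h3 h1
  · exact key h.swap c1 h1 h3
  · exact key h.swap.third c4 h2 h3
  · exact key h.swap.third.swap c5 h2 h1
  · exact key h.swap.third.swap c5 h2 h1

end IsTriple

end QuadMap
end RSphere

/-! ### Quadratic polynomials and their cycles of period 3 -/

theorem Complex.exists_root_sextic (c₅ c₄ c₃ c₂ c₁ c₀ : ℂ) :
    ∃ x : ℂ, x ^ 6 + c₅ * x ^ 5 + c₄ * x ^ 4 + c₃ * x ^ 3 + c₂ * x ^ 2 + c₁ * x + c₀ = 0 := by
  obtain ⟨x, hx⟩ := IsAlgClosed.exists_root (X ^ 6 + C c₅ * X ^ 5 + C c₄ * X ^ 4 + C c₃ * X ^ 3 +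
    C c₂ * X ^ 2 + C c₁ * X + C c₀ : ℂ[X]) (by
      rw [show degree _ = (6 : ℕ) by compute_degree!]; norm_num)
  exact ⟨x, by simpa using hx⟩

/-- If the norm of `ζ` is `-3`, the ring is that of the Eisenstein integers. -/
theorem ZRoot.eq_of_sq_eq_neg_three {D : ℕ} {ζ : ZRoot} (h : ζ.mul D ζ = ⟨-3, 0⟩) :
    D = 3 ∧ (ζ = ⟨0, 1⟩ ∨ ζ = ⟨0, -1⟩) := by
  obtain ⟨x, y⟩ := ζ
  simp only [mul, mk.injEq] at h ⊢
  obtain ⟨h1, h2⟩ := h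
  have hy : y ≠ 0 := by
    rintro rfl
    nlinarith [mul_self_nonneg x]
  have hx : x = 0 := by
    have : x * y = 0 := by linarith
    exact (mul_eq_zero.1 this).resolve_right hy
  subst hx
  have h3 : (D : ℤ) * (y * y) = 3 := by linarith
  have hy1 : 0 < y * y := mul_self_pos.2 hy
  have hD0 : (0 : ℤ) < D := by
    by_contra h0
    have : (D : ℤ) = 0 := by omega
    rw [this] at h3
    norm_num at h3
  have hy2 : y * y ≤ 3 := by nlinarith
  have hy3 : y ≤ 1 := by nlinarith
  have hy4 : -1 ≤ y := by nlinarith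
  have hy5 : y = 1 ∨ y = -1 := by omega
  rcases hy5 with rfl | rfl
  · exact ⟨by omega, by simp⟩
  · exact ⟨by omega, by simp⟩

namespace RSphere
namespace QuadMap

open NormalFormCert

/-- Two integers whose product is `m ^ 2 / 4` and their doubles. -/
theorem exists_zroot_factors {D : ℕ} (hD : 0 < D) (hsq : Squarefree D) {m : ℕ} (hm : m ≤ 36)
    {s t : ℂ} (hs : s ∈ imQuadInt D) (ht : t ∈ imQuadInt D) (hst : 4 * (s * t) = m) :
    ∃ σ τ : ZRoot, 4 ∣ ZRoot.norm D σ ∧ 4 ∣ ZRoot.norm D τ ∧ ZRoot.norm D σ ≤ 36 ∧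
      τ.mul D σ = ZRoot.ofNat m ∧ (σ.add τ).toC (rootNeg D) = 2 * (s + t) := by
  wlog h : ‖s‖ ≤ ‖t‖ generalizing s t
  · obtain ⟨σ, τ, h1, h2, h3, h4, h5⟩ := this ht hs (by rw [mul_comm t, hst]) (le_of_not_ge h)
    exact ⟨σ, τ, h1, h2, h3, h4, by rw [h5, add_comm]⟩
  obtain ⟨σ, hσ, hσ4⟩ := exists_zroot hsq hs
  obtain ⟨τ, hτ, hτ4⟩ := exists_zroot hsq ht
  have hr := rootNeg_sq D
  have nσ := ZRoot.cast_norm hr hD σ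
  rw [← hσ, norm_mul, mul_pow, Complex.norm_ofNat] at nσ
  refine ⟨σ, τ, hσ4, hτ4, ?_, ?_, ?_⟩
  · have e : 4 * (‖s‖ * ‖t‖) = m := by
      have := congrArg norm hst
      simpa using this
    have hm' : (m : ℝ) ≤ 36 := by exact_mod_cast hm
    have : (ZRoot.norm D σ : ℝ) ≤ 36 := by rw [nσ]; nlinarith [norm_nonneg s]
    exact_mod_cast this
  · apply ZRoot.toC_injective hr hD
    rw [ZRoot.toC_mul hr, ← hσ, ← hτ, ZRoot.toC_ofNat, ← hst]
    ring
  · rw [ZRoot.toC_add, ← hσ, ← hτ]; ring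

/-- A quadratic polynomial `z ^ 2 + a z` whose multipliers at small cycles are integers. -/
theorem hasModel_polynomial {D : ℕ} (hD : 0 < D) (hsq : Squarefree D) {a : ℂ}
    (hR : SmallMultipliersIn (imQuadInt D) (normalForm a 0).toMap) :
    HasModel (normalForm a 0).toMap := by
  have hab : a * 0 ≠ 1 := by simp
  have hnd := nondeg_normalForm hab
  have haR := (mem_of_normalForm hab hR).1
  have hr := rootNeg_sq D
  obtain ⟨A, hA, hA4⟩ := exists_zroot hsq haR
  have h00 : 2 * (0 : ℂ) = (⟨0, 0⟩ : ZRoot).toC (rootNeg D) := by simp [ZRoot.toC]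
  refine hasModel_of_isModelPair hab ?_
  suffices hres : resolved D A ⟨0, 0⟩ = true from isModelPair_of_resolved hD hsq hr hab hA h00 hR hres
  have inj := ZRoot.toC_injective hr hD
  by_cases ha0 : a = 0
  · have : A = ⟨0, 0⟩ := inj (by rw [← hA, ha0, ← h00])
    rw [this]
    simp only [resolved, and_self, if_true]
    decide +kernel
  by_cases ha2 : a = 2
  · have : A = ⟨4, 0⟩ := inj (by rw [← hA, ha2]; simp [ZRoot.toC]; norm_num)
    rw [this]
    simp only [resolved, and_self, if_true]
    decide +kernel
  set c : ℂ := a / 2 - a ^ 2 / 4 with hc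
  -- A root of the third dynatomic polynomial of z² + c, which is conjugate to z² + az by the
  -- translation by `a / 2`. Its product with `x ^ 2 - x + c` is the third iterate minus the
  -- identity.
  obtain ⟨x, hx⟩ := Complex.exists_root_sextic 1 (3 * c + 1) (2 * c + 1) (3 * c ^ 2 + 3 * c + 1)
    (c ^ 2 + 2 * c + 1) (c ^ 3 + 2 * c ^ 2 + c + 1)
  set x₁ := x ^ 2 + c with hx₁
  set x₂ := x₁ ^ 2 + c with hx₂
  have hx₃ : x₂ ^ 2 + c = x := by
    rw [hx₂, hx₁]
    linear_combination (x ^ 2 - x + c) * hx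
  -- At a fixed point of multiplier m = 2x the dynatomic polynomial takes the value 1 + m + m². So m
  -- is a primitive cube root of unity, equal to `a` or to `2 - a`; this forces `D = 3`, and the
  -- resulting values of `a` are tabulated.
  by_cases hfix : x = x₁
  · have h1 : 1 + 2 * x + 4 * x ^ 2 = 0 := by
      linear_combination hx + (x ^ 4 + 2 * x ^ 3 + (2 * c + 3) * x ^ 2 + (2 * c + 4) * x +
        c ^ 2 + 2 * c + 1) * (hfix.trans hx₁)
    have h2 : (a - 2 * x) * (a - (2 - 2 * x)) = 0 := by
      linear_combination 4 * (hfix.trans hx₁) + 4 * hc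
    rcases mul_eq_zero.1 h2 with h3 | h3
    · have hz : (A.add ⟨1, 0⟩).mul D (A.add ⟨1, 0⟩) = ⟨-3, 0⟩ := by
        apply inj
        rw [ZRoot.toC_mul hr, ZRoot.toC_add, ← hA, sub_eq_zero.1 h3]
        simp only [ZRoot.toC]; push_cast
        linear_combination 4 * h1
      obtain ⟨rfl, h4⟩ := ZRoot.eq_of_sq_eq_neg_three hz
      obtain ⟨X, Y⟩ := A
      simp only [ZRoot.add, ZRoot.mk.injEq] at h4
      rcases h4 with ⟨h4, h5⟩ | ⟨h4, h5⟩
      · obtain rfl : X = -1 := by omega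
        obtain rfl : Y = 1 := by omega
        decide +kernel
      · obtain rfl : X = -1 := by omega
        obtain rfl : Y = -1 := by omega
        decide +kernel
    · have hz : (A.add ⟨-5, 0⟩).mul D (A.add ⟨-5, 0⟩) = ⟨-3, 0⟩ := by
        apply inj
        rw [ZRoot.toC_mul hr, ZRoot.toC_add, ← hA, sub_eq_zero.1 h3]
        simp only [ZRoot.toC]; push_cast
        linear_combination 4 * h1
      obtain ⟨rfl, h4⟩ := ZRoot.eq_of_sq_eq_neg_three hz
      obtain ⟨X, Y⟩ := A
      simp only [ZRoot.add, ZRoot.mk.injEq] at h4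
      rcases h4 with ⟨h4, h5⟩ | ⟨h4, h5⟩
      · obtain rfl : X = 5 := by omega
        obtain rfl : Y = 1 := by omega
        decide +kernel
      · obtain rfl : X = 5 := by omega
        obtain rfl : Y = -1 := by omega
        decide +kernel
  have hden : ∀ z, (normalForm a 0).den z 1 = 1 := fun z => by simp [den, normalForm]
  have hjac : ∀ z, (normalForm a 0).jac (z - a / 2) 1 / 2 = 2 * z := fun z => by
    simp [jac, normalForm]; ring
  have hstep : ∀ z w, w = z ^ 2 + c → (normalForm a 0).num (z - a / 2) 1 =
      (w - a / 2) * (normalForm a 0).den (z - a / 2) 1 := fun z w h => by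
    rw [hden, h, hc]; simp [num, normalForm]; ring
  have hμ := hnd.mem_of_cycle_three hR (x := x - a / 2) (y := x₁ - a / 2) (z := x₂ - a / 2)
    (by simp [hden]) (by simp [hden]) (by simp [hden]) (hstep _ _ rfl) (hstep _ _ rfl)
    (hstep _ _ hx₃.symm) (fun h => hfix (by linear_combination h))
  simp only [hden, hjac, one_pow, div_one] at hμ
  -- The square of `v` depends on `c` only, and the multiplier is affine in `v` with slope `4 * c`,
  -- which is nonzero because `a` is neither 0 nor 2. Hence `v` lies in the ring.
  set v := 2 * (x + x₁ + x₂) + 1 with hv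
  have hv2 : v ^ 2 = -4 * c - 7 := by
    rw [hv, hx₂, hx₁]
    linear_combination 4 * (x ^ 2 - x + c + 2) * hx
  have hμ' : 2 * x * (2 * x₁) * (2 * x₂) = 4 * (c + 2) + 4 * c * v := by
    rw [hv, hx₂, hx₁]
    linear_combination 8 * (x - 1) * hx
  have h4c : 4 * c ∈ imQuadInt D := by
    have : 4 * c = a * (2 - a) := by rw [hc]; ring
    rw [this]
    exact mul_mem haR (sub_mem (ofNat_mem _ 2) haR)
  have hvR : v ∈ imQuadInt D := by
    refine mem_imQuadInt_of_sq_mem h4c ?_ ?_ ?_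
    · have : 4 * c = a * (2 - a) := by rw [hc]; ring
      rw [this]
      exact mul_ne_zero ha0 (sub_ne_zero.2 (Ne.symm ha2))
    · have : 4 * c * v = 2 * x * (2 * x₁) * (2 * x₂) - (4 * c + 8) := by rw [hμ']; ring
      rw [this]
      exact sub_mem hμ (add_mem h4c (ofNat_mem _ 8))
    · rw [hv2, neg_mul]
      exact sub_mem (neg_mem h4c) (ofNat_mem _ 7)
  have huR : a - 1 ∈ imQuadInt D := sub_mem haR (one_mem _)
  -- The identity `(a - 1) ^ 2 - v ^ 2 = 8`, doubled in each factor.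
  obtain ⟨σ, τ, h1, h2, h3, h4, h5⟩ := exists_zroot_factors hD hsq (m := 32) (by norm_num)
    (sub_mem huR hvR) (add_mem huR hvR) (by
      push_cast
      linear_combination -4 * hv2 + 16 * hc)
  refine ZRoot.resolved_of_poly hD hsq h1 h2 hA4 h3 h4 (inj ?_)
  rw [h5, ZRoot.toC_mul hr, ZRoot.toC_sub, ← hA, ZRoot.toC_two]
  ring

end QuadMap
end RSphere

/-! ### Maps with a double fixed point and their cycles of period 3 -/

namespace RSphere
namespace QuadMap

open NormalFormCert

/-- A root of the dynatomic polynomial of `z (z + 1) / (b z + 1)` gives a cycle of period `3`. -/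
theorem exists_cycle_three_parabolic {b : ℂ} (hb : b ≠ 1) (hm : 1 + b + b ^ 2 ≠ 0) :
    ∃ x y z : ℂ, x ≠ y ∧ x ≠ 0 ∧ y ≠ 0 ∧ z ≠ 0 ∧ b * x + 1 ≠ 0 ∧ b * y + 1 ≠ 0 ∧ b * z + 1 ≠ 0 ∧
      x * (x + 1) = y * (b * x + 1) ∧ y * (y + 1) = z * (b * y + 1) ∧
      z * (z + 1) = x * (b * z + 1) := by
  -- The third dynatomic polynomial, made monic. Its leading coefficient `1 + b + b ^ 2` vanishes
  -- exactly when the multiplier at ∞ is a primitive cube root of unity.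
  obtain ⟨x, hx⟩ := Complex.exists_root_sextic
    ((2 * b ^ 3 + 6 * b ^ 2 + 6 * b + 4) / (1 + b + b ^ 2))
    ((7 * b ^ 3 + 15 * b ^ 2 + 15 * b + 8) / (1 + b + b ^ 2))
    ((6 * b ^ 3 + 22 * b ^ 2 + 22 * b + 10) / (1 + b + b ^ 2))
    ((15 * b ^ 2 + 21 * b + 9) / (1 + b + b ^ 2)) ((12 * b + 6) / (1 + b + b ^ 2))
    (3 / (1 + b + b ^ 2))
  have hΦ : (1 + b + b ^ 2) * x ^ 6 + (2 * b ^ 3 + 6 * b ^ 2 + 6 * b + 4) * x ^ 5 +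
      (7 * b ^ 3 + 15 * b ^ 2 + 15 * b + 8) * x ^ 4 +
      (6 * b ^ 3 + 22 * b ^ 2 + 22 * b + 10) * x ^ 3 + (15 * b ^ 2 + 21 * b + 9) * x ^ 2 +
      (12 * b + 6) * x + 3 = 0 := by
    field_simp at hx
    linear_combination hx
  have hx0 : x ≠ 0 := by
    rintro rfl
    norm_num at hΦ
  have hnd := nondeg_normalForm (a := 1) (b := b) (by simpa using hb)
  set p₁ := x * (x + 1) with hp₁
  set q₁ := b * x + 1 with hq₁
  set p₂ := p₁ * (p₁ + q₁) with hp₂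
  set q₂ := q₁ * (b * p₁ + q₁) with hq₂
  set p₃ := p₂ * (p₂ + q₂) with hp₃
  set q₃ := q₂ * (b * p₂ + q₂) with hq₃
  -- `p₃ - x * q₃` is the dynatomic polynomial times `(1 - b) * x ^ 2`, the square accounting for
  -- the double fixed point 0.
  have h3 : p₃ = x * q₃ := by
    simp only [hp₃, hq₃, hp₂, hq₂, hp₁, hq₁]
    linear_combination (1 - b) * x ^ 2 * hΦ
  have step : ∀ u v : ℂ, u * (u + v) = 0 → v * (b * u + v) = 0 → u = 0 ∧ v = 0 := fun u v h1 h2 =>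
    hnd u v (by simp only [num, normalForm]; linear_combination h1)
      (by simp only [den, normalForm]; linear_combination h2)
  have hq₃0 : q₃ ≠ 0 := by
    intro h0
    rw [h0, mul_zero] at h3
    obtain ⟨h4, h5⟩ := step p₂ q₂ h3 h0
    obtain ⟨h6, h7⟩ := step p₁ q₁ h4 h5
    obtain ⟨h8, h9⟩ := step x 1 h6 (by linear_combination h7)
    exact hx0 h8
  have hq₂0 : q₂ ≠ 0 := fun h => hq₃0 (by rw [hq₃, h, zero_mul])
  have hq₁0 : q₁ ≠ 0 := fun h => hq₂0 (by rw [hq₂, h, zero_mul])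
  have f₂ : b * p₁ + q₁ ≠ 0 := fun h => hq₂0 (by rw [hq₂, h, mul_zero])
  have f₃ : b * p₂ + q₂ ≠ 0 := fun h => hq₃0 (by rw [hq₃, h, mul_zero])
  have hp₃0 : p₃ ≠ 0 := by rw [h3]; exact mul_ne_zero hx0 hq₃0
  have hp₂0 : p₂ ≠ 0 := fun h => hp₃0 (by rw [hp₃, h, zero_mul])
  have hp₁0 : p₁ ≠ 0 := fun h => hp₂0 (by rw [hp₂, h, zero_mul])
  refine ⟨x, p₁ / q₁, p₂ / q₂, ?_, hx0, div_ne_zero hp₁0 hq₁0, div_ne_zero hp₂0 hq₂0, hq₁0, ?_, ?_,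
    ?_, ?_, ?_⟩
  · rw [Ne, eq_div_iff hq₁0, hp₁, hq₁]
    intro h
    have : x ^ 2 * (b - 1) = 0 := by linear_combination h
    rcases mul_eq_zero.1 this with h | h
    · exact hx0 (pow_eq_zero_iff two_ne_zero |>.1 h)
    · exact hb (sub_eq_zero.1 h)
  · rw [← mul_div_assoc, div_add_one hq₁0]
    exact div_ne_zero f₂ hq₁0
  · rw [← mul_div_assoc, div_add_one hq₂0]
    exact div_ne_zero f₃ hq₂0
  · rw [div_mul_cancel₀ _ hq₁0]
  · rw [div_add_one hq₁0, ← mul_div_assoc b, div_add_one hq₁0, hp₂, hq₂]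
    have f₂' : p₁ * b + q₁ ≠ 0 := by rwa [mul_comm p₁ b]
    field_simp
  · rw [div_add_one hq₂0, ← mul_div_assoc b, div_add_one hq₂0]
    have : p₂ / q₂ * ((p₂ + q₂) / q₂) = p₃ / q₂ ^ 2 := by rw [hp₃]; field_simp
    rw [this, h3, hq₃]
    field_simp

/-- The multiplier of a cycle of period `3` of `z (z + 1) / (b z + 1)`. -/
theorem cycle_three_parabolic {b x y z : ℂ} (hb : b ≠ 1) (hm : 1 + b + b ^ 2 ≠ 0)
    (hq : b + 2 ≠ 0) (hx0 : x ≠ 0) (hy0 : y ≠ 0) (hz0 : z ≠ 0)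
    (hx : b * x + 1 ≠ 0) (hy : b * y + 1 ≠ 0) (hz : b * z + 1 ≠ 0)
    (hxy : x * (x + 1) = y * (b * x + 1)) (hyz : y * (y + 1) = z * (b * y + 1))
    (hzx : z * (z + 1) = x * (b * z + 1)) :
    (x + y + z + b + 2) ^ 2 = (b - 1) * (b + 2) ∧
      2 * ((b * x ^ 2 + 2 * x + 1) * (b * y ^ 2 + 2 * y + 1) * (b * z ^ 2 + 2 * z + 1) /
        ((b * x + 1) * (b * y + 1) * (b * z + 1)) ^ 2) =
      4 * b ^ 2 + 16 * b + 18 - 4 * (b - 1) * (x + y + z + b + 2) := by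
  obtain ⟨e₁, he₁⟩ : ∃ e, e = x + y + z := ⟨_, rfl⟩
  obtain ⟨e₂, he₂⟩ : ∃ e, e = x * y + y * z + z * x := ⟨_, rfl⟩
  obtain ⟨e₃, he₃⟩ : ∃ e, e = x * y * z := ⟨_, rfl⟩
  have he₃0 : e₃ ≠ 0 := by rw [he₃]; exact mul_ne_zero (mul_ne_zero hx0 hy0) hz0
  -- The equations of the cycle give three relations between the symmetric functions of its points:
  -- `r1` from their product, after division by `x * y * z` and `b - 1`, `r2` from their sum and
  -- `r3` from a weighted sum.
  have r1 : e₁ + (1 + b) * e₂ + (1 + b + b ^ 2) * e₃ = 0 := by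
    have hprod : (x + 1) * (y + 1) * (z + 1) = (b * x + 1) * (b * y + 1) * (b * z + 1) := by
      refine mul_left_cancel₀ he₃0 ?_
      calc e₃ * ((x + 1) * (y + 1) * (z + 1)) =
          (x * (x + 1)) * (y * (y + 1)) * (z * (z + 1)) := by rw [he₃]; ring
        _ = _ := by rw [hxy, hyz, hzx, he₃]; ring
    refine mul_left_cancel₀ (sub_ne_zero.2 hb) ?_
    rw [he₁, he₂, he₃]
    linear_combination -hprod
  have r2 : e₁ ^ 2 = (b + 2) * e₂ := by
    rw [he₁, he₂]; linear_combination hxy + hyz + hzx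
  have r3 : b ^ 2 * (e₁ * e₂ - 3 * e₃) =
      (b + 1) * (e₁ ^ 3 - 3 * e₁ * e₂ + 3 * e₃) + e₁ ^ 2 - 3 * e₂ := by
    rw [he₁, he₂, he₃]
    linear_combination (-(b + 1) * x - b * y) * hxy + (-(b + 1) * y - b * z) * hyz +
      (-(b + 1) * z - b * x) * hzx
  have hN : (b * x ^ 2 + 2 * x + 1) * (b * y ^ 2 + 2 * y + 1) * (b * z ^ 2 + 2 * z + 1) =
      b ^ 3 * e₃ ^ 2 + (2 * b ^ 2 * e₂ - 2 * b ^ 2 * e₁ + 4 * b * e₁ - 6 * b + 8) * e₃ +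
      (b ^ 2 * e₂ ^ 2 + 2 * b * e₁ * e₂ + b * (e₁ ^ 2 - 2 * e₂) + 4 * e₂ + 2 * e₁ + 1) := by
    rw [he₁, he₂, he₃]; ring
  have hd : (b * x + 1) * (b * y + 1) * (b * z + 1) =
      1 + b * e₁ + b ^ 2 * e₂ + b ^ 3 * e₃ := by
    rw [he₁, he₂, he₃]; ring
  have hd0 : (b * x + 1) * (b * y + 1) * (b * z + 1) ≠ 0 := mul_ne_zero (mul_ne_zero hx hy) hz
  rw [hd] at hd0 ⊢
  rw [hN, ← he₁]
  clear hN hd hxy hyz hzx he₁ he₂ he₃ hx hy hz hx0 hy0 hz0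
  -- The substitution parametrises `r2`, and the other relations then leave a quadratic equation for
  -- `t`. The quantity in the first claim is `(b + 2) * (t + 1)`, so completing the square in that
  -- equation proves it.
  obtain ⟨t, ht⟩ : ∃ t, e₁ = (b + 2) * t := ⟨e₁ / (b + 2), by rw [mul_div_cancel₀ _ hq]⟩
  have ht2 : e₂ = (b + 2) * t ^ 2 := by
    refine mul_left_cancel₀ hq ?_
    rw [← r2, ht]; ring
  subst ht ht2
  have hg : (1 + b + b ^ 2) * e₃ = -((b + 2) * t * (1 + (1 + b) * t)) := by
    linear_combination r1
  have ht0 : t ≠ 0 := by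
    rintro rfl
    simp at hg
    rcases hg with h | h
    · exact hm h
    · exact he₃0 h
  have hquad : (b + 2) * (t ^ 2 + 2 * t) + 3 = 0 := by
    refine mul_left_cancel₀ (mul_ne_zero (mul_ne_zero hq hm) ht0) ?_
    linear_combination (1 + b + b ^ 2) * r3 + (3 * b ^ 2 + 3 * (b + 1)) * hg
  constructor
  · linear_combination (b + 2) * hquad
  · rw [← mul_div_assoc, div_eq_iff (pow_ne_zero 2 hd0)]
    refine mul_left_cancel₀ (pow_ne_zero 2 hm) ?_
    -- Here `g` stands for `(1 + b + b ^ 2) * e₃`, which is polynomial in `t` and `b`. The identity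
    -- cleared of denominators is then a multiple of the quadratic equation for `t`.
    have key : ∀ g : ℂ, g = -((b + 2) * t * (1 + (1 + b) * t)) →
        2 * (b ^ 3 * g ^ 2 + (2 * b ^ 2 * ((b + 2) * t ^ 2) - 2 * b ^ 2 * ((b + 2) * t) +
          4 * b * ((b + 2) * t) - 6 * b + 8) * (1 + b + b ^ 2) * g +
          (1 + b + b ^ 2) ^ 2 * (b ^ 2 * ((b + 2) * t ^ 2) ^ 2 +
            2 * b * ((b + 2) * t) * ((b + 2) * t ^ 2) +
            b * (((b + 2) * t) ^ 2 - 2 * ((b + 2) * t ^ 2)) + 4 * ((b + 2) * t ^ 2) +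
            2 * ((b + 2) * t) + 1)) =
        (4 * b ^ 2 + 16 * b + 18 - 4 * (b - 1) * ((b + 2) * t + b + 2)) *
          ((1 + b + b ^ 2) * (1 + b * ((b + 2) * t) + b ^ 2 * ((b + 2) * t ^ 2)) + b ^ 3 * g) ^ 2 := by
      rintro g rfl
      linear_combination (4 * t ^ 3 * b ^ 7 + 12 * t ^ 3 * b ^ 6 - 16 * t ^ 3 * b ^ 4 +
        2 * t ^ 2 * b ^ 7 + 2 * t ^ 2 * b ^ 6 - 20 * t ^ 2 * b ^ 5 - 50 * t ^ 2 * b ^ 4 -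
        38 * t ^ 2 * b ^ 3 - 4 * t ^ 2 * b ^ 2 - 4 * t * b ^ 6 - 28 * t * b ^ 5 - 64 * t * b ^ 4 -
        68 * t * b ^ 3 - 44 * t * b ^ 2 - 8 * t * b - 4 * b ^ 5 - 16 * b ^ 4 - 28 * b ^ 3 -
        32 * b ^ 2 - 20 * b - 8) * hquad
    linear_combination key _ hg

/-- A quadratic map with a double fixed point whose multipliers at small cycles are integers. -/
theorem hasModel_parabolic {D : ℕ} (hD : 0 < D) (hsq : Squarefree D) {b : ℂ} (hb : b ≠ 1)
    (hR : SmallMultipliersIn (imQuadInt D) (normalForm 1 b).toMap) :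
    HasModel (normalForm 1 b).toMap := by
  have hab : 1 * b ≠ 1 := by simpa using hb
  have hnd := nondeg_normalForm hab
  have hbR := (mem_of_normalForm hab hR).2
  have hr := rootNeg_sq D
  obtain ⟨B, hB, hB4⟩ := exists_zroot hsq hbR
  have h2 : 2 * (1 : ℂ) = ZRoot.two.toC (rootNeg D) := by simp [ZRoot.toC_two]
  refine hasModel_of_isModelPair hab ?_
  suffices hres : resolved D ZRoot.two B = true from
    isModelPair_of_resolved hD hsq hr hab h2 hB hR hres
  have inj := ZRoot.toC_injective hr hD
  -- For `b = -2` the division by `b + 2` breaks down; a tabulated cycle of period 4 excludes this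
  -- pair.
  by_cases hq : b + 2 = 0
  · have : B = ⟨-4, 0⟩ := inj (by
      rw [← hB, eq_neg_of_add_eq_zero_left hq]; simp [ZRoot.toC]; norm_num)
    rw [this]
    simp only [resolved, ZRoot.two, ZRoot.ofNat, and_self, if_true]
    decide +kernel
  by_cases hm : 1 + b + b ^ 2 = 0
  · have hz : (B.add ⟨1, 0⟩).mul D (B.add ⟨1, 0⟩) = ⟨-3, 0⟩ := by
      apply inj
      rw [ZRoot.toC_mul hr, ZRoot.toC_add, ← hB]
      simp only [ZRoot.toC]; push_cast
      linear_combination 4 * hm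
    obtain ⟨rfl, h4⟩ := ZRoot.eq_of_sq_eq_neg_three hz
    obtain ⟨X, Y⟩ := B
    simp only [ZRoot.add, ZRoot.mk.injEq] at h4
    rcases h4 with ⟨h4, h5⟩ | ⟨h4, h5⟩
    · obtain rfl : X = -1 := by omega
      obtain rfl : Y = 1 := by omega
      decide +kernel
    · obtain rfl : X = -1 := by omega
      obtain rfl : Y = -1 := by omega
      decide +kernel
  obtain ⟨x, y, z, hne, hx0, hy0, hz0, hx, hy, hz, hxy, hyz, hzx⟩ :=
    exists_cycle_three_parabolic hb hm
  obtain ⟨hv, hμ⟩ := cycle_three_parabolic hb hm hq hx0 hy0 hz0 hx hy hz hxy hyz hzx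
  have hden : ∀ s, (normalForm 1 b).den s 1 = b * s + 1 := fun s => by simp [den, normalForm]
  have hnum : ∀ s, (normalForm 1 b).num s 1 = s * (s + 1) := fun s => by
    simp [num, normalForm]; ring
  have hjac : ∀ s, (normalForm 1 b).jac s 1 / 2 = b * s ^ 2 + 2 * s + 1 := fun s => by
    simp [jac, normalForm]; ring
  have hmem := hnd.mem_of_cycle_three hR (x := x) (y := y) (z := z)
    (by rwa [hden]) (by rwa [hden]) (by rwa [hden]) (by rwa [hden, hnum]) (by rwa [hden, hnum])
    (by rwa [hden, hnum]) hne
  simp only [hden, hjac, div_mul_div_comm, ← mul_pow] at hmem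
  set v := x + y + z + b + 2
  set μ := (b * x ^ 2 + 2 * x + 1) * (b * y ^ 2 + 2 * y + 1) * (b * z ^ 2 + 2 * z + 1) /
        ((b * x + 1) * (b * y + 1) * (b * z + 1)) ^ 2
  have hb1 : b - 1 ∈ imQuadInt D := sub_mem hbR (one_mem _)
  have hvR : v ∈ imQuadInt D := by
    refine mem_imQuadInt_of_sq_mem (k := 4 * (b - 1)) (mul_mem (ofNat_mem _ 4) hb1)
      (mul_ne_zero (by norm_num) (sub_ne_zero.2 hb)) ?_ ?_
    · have : 4 * (b - 1) * v = 4 * b ^ 2 + 16 * b + 18 - 2 * μ := by rw [hμ]; ring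
      rw [this]
      exact sub_mem (add_mem (add_mem (mul_mem (ofNat_mem _ 4) (pow_mem hbR 2))
        (mul_mem (ofNat_mem _ 16) hbR)) (ofNat_mem _ 18)) (mul_mem (ofNat_mem _ 2) hmem)
    · rw [hv]
      exact mul_mem hb1 (add_mem hbR (ofNat_mem _ 2))
  have hw : 2 * b + 1 ∈ imQuadInt D := add_mem (mul_mem (ofNat_mem _ 2) hbR) (one_mem _)
  have h2v : 2 * v ∈ imQuadInt D := mul_mem (ofNat_mem _ 2) hvR
  -- The identity `(2 * b + 1) ^ 2 - (2 * v) ^ 2 = 9`, doubled in each factor.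
  obtain ⟨σ, τ, h1, h2, h3, h4, h5⟩ := exists_zroot_factors hD hsq (m := 36) (by norm_num)
    (sub_mem hw h2v) (add_mem hw h2v) (by
      push_cast
      linear_combination -16 * hv)
  refine ZRoot.resolved_of_parabolic hD hsq h1 h2 hB4 h3 h4 (inj ?_) ?_
  · rw [h5, ZRoot.toC_mul hr, ZRoot.toC_add, ← hB, ZRoot.toC_ofNat]
    simp [ZRoot.toC]
    ring
  · rintro rfl
    rw [ZRoot.toC_two] at hB
    exact hb (by linear_combination hB / 2)

/-- A quadratic map whose multipliers at small cycles are integers is conjugate to a model. -/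
theorem Nondeg.hasModel {D : ℕ} (hD : 0 < D) (hsq : Squarefree D) {F : QuadMap} (hF : F.Nondeg)
    (hR : SmallMultipliersIn (imQuadInt D) F.toMap) : HasModel F.toMap := by
  rcases exists_isConj_normalForm hF with ⟨a, b, hab, hc⟩ | hc
  swap
  · exact absurd (hR.conj hF.sdifferentiable hc) (not_smallMultipliersIn_parabolicMap hD hsq)
  refine HasModel.of_isConj ?_ hc
  replace hR := hR.conj hF.sdifferentiable hc
  have hsd := (nondeg_normalForm hab).sdifferentiable
  have hswap := isConj_normalForm_swap hab
  by_cases ha1 : a = 1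
  · subst ha1
    exact hasModel_parabolic hD hsq (by simpa using hab) hR
  by_cases hb1 : b = 1
  · subst hb1
    exact (hasModel_parabolic hD hsq ha1 (hR.conj hsd hswap)).of_isConj hswap
  by_cases hb0 : b = 0
  · subst hb0
    exact hasModel_polynomial hD hsq hR
  by_cases ha0 : a = 0
  · subst ha0
    exact (hasModel_polynomial hD hsq (hR.conj hsd hswap)).of_isConj hswap
  have h0 : 1 - a * b ≠ 0 := sub_ne_zero.2 (Ne.symm hab)
  set c := (2 - a - b) / (1 - a * b) with hcdef
  have hc' : c * (1 - a * b) = 2 - a - b := by rw [hcdef, div_mul_cancel₀ _ h0]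
  obtain ⟨hac, hthird⟩ := isConj_normalForm_third hab ha1 hc'
  have hR' := hR.conj hsd hthird
  by_cases hc0 : c = 0
  · rw [hc0] at hthird hR'
    exact (hasModel_polynomial hD hsq hR').of_isConj hthird
  have hc1 : c ≠ 1 := by
    intro h
    rw [h] at hc'
    have : (a - 1) * (b - 1) = 0 := by linear_combination -hc'
    rcases mul_eq_zero.1 this with h | h
    · exact ha1 (sub_eq_zero.1 h)
    · exact hb1 (sub_eq_zero.1 h)
  have hmem := mem_of_normalForm hab hR
  have htr : IsTriple (imQuadInt D) a b c :=
    ⟨by linear_combination -hc', ⟨ha0, hb0, hc0⟩, ⟨ha1, hb1, hc1⟩,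
      ⟨hmem.1, hmem.2, (mem_of_normalForm hac hR').2⟩⟩
  exact htr.hasModel hD hsq hR

end QuadMap
end RSphere

/-! ### The Weierstrass function, Liouville's theorem and half periods -/

namespace PeriodPair

variable (Λ : PeriodPair)

/-- A function with removable singularities and a lattice of periods is constant. -/
theorem exists_eq_const_of_periodic {h : ℂ → ℂ} (hper : ∀ z, ∀ l ∈ Λ.lattice, h (z + l) = h z)
    (hloc : ∀ z, ∃ g : ℂ → ℂ, AnalyticAt ℂ g z ∧ h =ᶠ[𝓝[≠] z] g) :
    ∃ c : ℂ, (∀ z, ContinuousAt h z → h z = c) ∧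
      ∀ (z : ℂ) (g : ℂ → ℂ), AnalyticAt ℂ g z → h =ᶠ[𝓝[≠] z] g → g z = c := by
  -- Taking limits fills the removable singularities. The result is entire and periodic, hence of
  -- compact range, and Liouville's theorem applies.
  set H : ℂ → ℂ := fun z => limUnder (𝓝[≠] z) h with hH
  have hlim : ∀ (z : ℂ) (g : ℂ → ℂ), ContinuousAt g z → h =ᶠ[𝓝[≠] z] g → H z = g z :=
    fun z g hg he => Tendsto.limUnder_eq
      ((hg.tendsto.mono_left nhdsWithin_le_nhds).congr' he.symm)
  have han : ∀ z, AnalyticAt ℂ H z := by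
    intro z
    obtain ⟨g, hg, he⟩ := hloc z
    refine hg.congr ?_
    have h1 : ∀ᶠ w in 𝓝 z, AnalyticAt ℂ g w := hg.eventually_analyticAt
    rw [EventuallyEq, eventually_nhdsWithin_iff] at he
    have h2 := he.eventually_nhds
    filter_upwards [h1, h2] with w hw1 hw2
    symm
    by_cases hwz : w = z
    · subst hwz
      exact hlim w g hw1.continuousAt (eventually_nhdsWithin_iff.2 hw2)
    · refine hlim w g hw1.continuousAt ?_
      refine (hw2.and (isOpen_ne.mem_nhds hwz)).filter_mono nhdsWithin_le_nhds |>.mono ?_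
      intro x hx
      exact hx.1 hx.2
  have hHper : ∀ z, ∀ l ∈ Λ.lattice, H (z + l) = H z := by
    intro z l hl
    obtain ⟨g, hg, he⟩ := hloc z
    rw [hlim z g hg.continuousAt he]
    have hc : ContinuousAt (fun w => g (w - l)) (z + l) :=
      ContinuousAt.comp (f := fun w => w - l) (by simpa using hg.continuousAt) (by fun_prop)
    rw [hlim (z + l) (fun w => g (w - l)) hc ?_]
    · simp
    have ht : Tendsto (fun w => w - l) (𝓝[≠] (z + l)) (𝓝[≠] z) := by
      refine tendsto_nhdsWithin_iff.2 ⟨?_, ?_⟩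
      · have : ContinuousAt (fun w : ℂ => w - l) (z + l) := by fun_prop
        simpa using this.tendsto.mono_left nhdsWithin_le_nhds
      · filter_upwards [self_mem_nhdsWithin] with w hw h0
        exact hw (by simpa [sub_eq_iff_eq_add] using h0)
    filter_upwards [ht.eventually he] with w hw
    rw [← hw, ← hper (w - l) l hl, sub_add_cancel]
  have hd : Differentiable ℂ H := fun z => (han z).differentiableAt
  have hconst : ∀ z, H z = H 0 := fun z => hd.apply_eq_apply_of_bounded
    (IsZLattice.isCompact_range_of_periodic Λ.lattice _ hd.continuous hHper).isBounded z 0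
  refine ⟨H 0, fun z hz => ?_, fun z g hg he => ?_⟩
  · rw [← hconst z, hlim z h hz EventuallyEq.rfl]
  · rw [← hconst z, hlim z g hg.continuousAt he]

theorem eventually_notMem_lattice (z : ℂ) : ∀ᶠ w in 𝓝[≠] z, w ∉ Λ.lattice := by
  rw [eventually_nhdsWithin_iff]
  filter_upwards [Λ.compl_lattice_sdiff_singleton_mem_nhds z] with w hw hne hl
  exact hw ⟨hl, hne⟩

theorem eventually_notMem_lattice_of_notMem {z : ℂ} (hz : z ∉ Λ.lattice) :
    ∀ᶠ w in 𝓝 z, w ∉ Λ.lattice :=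
  Λ.isClosed_lattice.isOpen_compl.mem_nhds hz

theorem analyticAt_weierstrassP {z : ℂ} (hz : z ∉ Λ.lattice) : AnalyticAt ℂ Λ.weierstrassP z :=
  Λ.analyticOnNhd_weierstrassP z hz

theorem weierstrassP_add_of_mem {l : ℂ} (hl : l ∈ Λ.lattice) (z : ℂ) :
    Λ.weierstrassP (z + l) = Λ.weierstrassP z :=
  Λ.weierstrassP_add_coe z ⟨l, hl⟩

theorem weierstrassP_eq_except_zero (z : ℂ) :
    Λ.weierstrassP z = Λ.weierstrassPExcept 0 z + 1 / z ^ 2 := by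
  have := Λ.weierstrassPExcept_add 0 z
  simpa using this.symm

/-- The Weierstrass function, with values in the Riemann sphere. -/
def wp (z : ℂ) : RSphere := by
  classical exact if z ∈ Λ.lattice then ∞ else (Λ.weierstrassP z : RSphere)

theorem wp_of_mem {z : ℂ} (hz : z ∈ Λ.lattice) : Λ.wp z = ∞ := by simp [wp, hz]

theorem wp_of_notMem {z : ℂ} (hz : z ∉ Λ.lattice) : Λ.wp z = (Λ.weierstrassP z : RSphere) := by
  simp [wp, hz]

theorem wp_add_of_mem {l : ℂ} (hl : l ∈ Λ.lattice) (z : ℂ) : Λ.wp (z + l) = Λ.wp z := by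
  have : z + l ∈ Λ.lattice ↔ z ∈ Λ.lattice := Λ.lattice.toAddSubgroup.add_mem_cancel_right hl
  by_cases hz : z ∈ Λ.lattice
  · rw [Λ.wp_of_mem hz, Λ.wp_of_mem (this.2 hz)]
  · rw [Λ.wp_of_notMem hz, Λ.wp_of_notMem (mt this.1 hz), Λ.weierstrassP_add_of_mem hl]

open RSphere in
/-- Near any point the Weierstrass function is a quotient of analytic functions. -/
theorem exists_hom_wp (z : ℂ) :
    ∃ U V : ℂ → ℂ, AnalyticAt ℂ U z ∧ AnalyticAt ℂ V z ∧ (U z ≠ 0 ∨ V z ≠ 0) ∧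
      ∀ᶠ w in 𝓝 z, Λ.wp w = ofHom (U w) (V w) := by
  by_cases hz : z ∈ Λ.lattice
  · refine ⟨fun w => (w - z) ^ 2 * Λ.weierstrassPExcept z w + 1 - (w - z) ^ 2 / z ^ 2,
      fun w => (w - z) ^ 2, ?_, by fun_prop, by simp, ?_⟩
    · have := Λ.analyticAt_weierstrassPExcept z
      fun_prop
    · filter_upwards [Λ.compl_lattice_sdiff_singleton_mem_nhds z] with w hw
      rw [← Λ.ite_eq_one_sub_sq_mul_weierstrassP z hz]
      by_cases hwz : w = z
      · simp [hwz, Λ.wp_of_mem hz]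
      · have hwΛ : w ∉ Λ.lattice := fun h => hw ⟨h, hwz⟩
        have h0 : (w - z) ^ 2 ≠ 0 := pow_ne_zero 2 (sub_ne_zero.2 hwz)
        rw [Λ.wp_of_notMem hwΛ, if_neg hwz, ofHom_of_ne h0, mul_div_cancel_left₀ _ h0]
  · refine ⟨Λ.weierstrassP, fun _ => 1, Λ.analyticAt_weierstrassP hz, analyticAt_const, by simp, ?_⟩
    filter_upwards [Λ.eventually_notMem_lattice_of_notMem hz] with w hw
    rw [Λ.wp_of_notMem hw, ofHom_one_right]

theorem isHolomorphic_wp : RSphere.IsHolomorphic Λ.wp :=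
  RSphere.isHolomorphic_of_hom Λ.exists_hom_wp

/-- The Weierstrass function is not locally constant. -/
theorem not_eventually_weierstrassP_eq {z c : ℂ} (hz : z ∉ Λ.lattice) :
    ¬ ∀ᶠ w in 𝓝 z, Λ.weierstrassP w = c := by
  intro h
  have hcount : (Λ.lattice : Set ℂ).Countable :=
    Set.countable_coe_iff.1 (inferInstanceAs (Countable Λ.lattice))
  -- The complement of a countable set is connected, so a locally constant ℘ would be constant near
  -- 0. Then w²℘(w) would tend to 0 there, whereas its limit is 1.
  have hconn : IsPreconnected (Λ.lattice : Set ℂ)ᶜ :=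
    (hcount.isConnected_compl_of_one_lt_rank (by simp)).isPreconnected
  have heq := AnalyticOnNhd.eqOn_of_preconnected_of_eventuallyEq Λ.analyticOnNhd_weierstrassP
    (analyticOnNhd_const (v := c)) hconn hz h
  have h1 : Tendsto Λ.weierstrassP (𝓝[≠] 0) (𝓝 c) := by
    refine tendsto_const_nhds.congr' ?_
    filter_upwards [Λ.eventually_notMem_lattice 0] with w hw
    exact (heq hw).symm
  have h2 : Tendsto (fun w : ℂ => w ^ 2 * Λ.weierstrassP w) (𝓝[≠] 0) (𝓝 (0 ^ 2 * c)) :=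
    (((continuous_pow 2).tendsto 0).mono_left nhdsWithin_le_nhds).mul h1
  have h3 : Tendsto (fun w : ℂ => w ^ 2 * Λ.weierstrassPExcept 0 w + 1) (𝓝[≠] 0)
      (𝓝 (0 ^ 2 * Λ.weierstrassPExcept 0 0 + 1)) := by
    refine Tendsto.mono_left ?_ nhdsWithin_le_nhds
    have := (Λ.analyticAt_weierstrassPExcept 0).continuousAt
    exact ContinuousAt.tendsto (f := fun w : ℂ => w ^ 2 * Λ.weierstrassPExcept 0 w + 1)
      (by fun_prop)
  have h4 := tendsto_nhds_unique h2 (h3.congr' (by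
    filter_upwards [self_mem_nhdsWithin] with w hw
    have hw0 : w ≠ 0 := hw
    rw [Λ.weierstrassP_eq_except_zero]
    field_simp))
  norm_num at h4

theorem wp_ne_const (c : RSphere) : ∃ z, Λ.wp z ≠ c := by
  by_contra! h
  have h1 := h 0
  rw [Λ.wp_of_mem (zero_mem _)] at h1
  have h2 := h (Λ.ω₁ / 2)
  rw [Λ.wp_of_notMem Λ.ω₁_div_two_notMem_lattice, ← h1] at h2
  exact OnePoint.coe_ne_infty _ h2

end PeriodPair

/-- Division of an analytic function by the square of the coordinate at a double zero. -/
theorem AnalyticAt.exists_eq_sq_mul {f : ℂ → ℂ} (hf : AnalyticAt ℂ f 0) (h0 : f 0 = 0)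
    (h1 : deriv f 0 = 0) : ∃ g : ℂ → ℂ, AnalyticAt ℂ g 0 ∧ ∀ z, f z = z ^ 2 * g z := by
  have hd : ∀ {f : ℂ → ℂ}, AnalyticAt ℂ f 0 → AnalyticAt ℂ (dslope f 0) 0 := fun {f} hf => by
    obtain ⟨p, hp⟩ := hf
    exact ⟨_, hp.has_fpower_series_dslope_fslope⟩
  refine ⟨dslope (dslope f 0) 0, hd (hd hf), fun z => ?_⟩
  have e1 := sub_smul_dslope f 0 z
  have e2 := sub_smul_dslope (dslope f 0) 0 z
  rw [dslope_same, h1] at e2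
  simp only [sub_zero, smul_eq_mul, h0] at e1 e2
  rw [pow_two, mul_assoc, e2, e1]

namespace PeriodPair

variable {Λ : PeriodPair}

/-- A point of order two of the torus. -/
structure IsHalfPeriod (Λ : PeriodPair) (t : ℂ) : Prop where
  notMem : t ∉ Λ.lattice
  add_mem : t + t ∈ Λ.lattice

namespace IsHalfPeriod

variable {t : ℂ}

theorem add_add (ht : IsHalfPeriod Λ t) (z : ℂ) :
    Λ.weierstrassP (z + t + t) = Λ.weierstrassP z := by
  rw [add_assoc, Λ.weierstrassP_add_of_mem ht.add_mem]

theorem derivWeierstrassP_eq_zero (ht : IsHalfPeriod Λ t) : Λ.derivWeierstrassP t = 0 := by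
  have h1 : Λ.derivWeierstrassP (-t + (t + t)) = Λ.derivWeierstrassP (-t) :=
    Λ.derivWeierstrassP_add_coe (-t) ⟨_, ht.add_mem⟩
  rw [Λ.derivWeierstrassP_neg, neg_add_cancel_left] at h1
  have h2 : 2 * Λ.derivWeierstrassP t = 0 := by linear_combination h1
  simpa using h2

/-- A function with periods `Λ` and a half period that is regular outside these and at `0`. -/
theorem _root_.PeriodPair.exists_eq_const_of_half (Λ : PeriodPair) {t : ℂ} {h g : ℂ → ℂ}
    (hper : ∀ z, ∀ l ∈ Λ.lattice, h (z + l) = h z) (hper' : ∀ z, h (z + t) = h z)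
    (hreg : ∀ z ∉ Λ.lattice, z + t ∉ Λ.lattice → AnalyticAt ℂ h z)
    (hg : AnalyticAt ℂ g 0) (hhg : h =ᶠ[𝓝[≠] 0] g) :
    ∀ z ∉ Λ.lattice, z + t ∉ Λ.lattice → h z = g 0 := by
  have h0 : ∀ l, (∀ z, h (z - l) = h z) →
      ∃ g : ℂ → ℂ, AnalyticAt ℂ g l ∧ h =ᶠ[𝓝[≠] l] g := by
    intro l hl
    refine ⟨fun z => g (z - l), ?_, ?_⟩
    · exact AnalyticAt.fun_comp (by simpa using hg) (by fun_prop)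
    · have ht : Tendsto (fun w => w - l) (𝓝[≠] l) (𝓝[≠] 0) := by
        refine tendsto_nhdsWithin_iff.2 ⟨?_, ?_⟩
        · have : ContinuousAt (fun w : ℂ => w - l) l := by fun_prop
          simpa using this.tendsto.mono_left nhdsWithin_le_nhds
        · filter_upwards [self_mem_nhdsWithin] with w hw h0
          exact hw (by simpa [sub_eq_zero] using h0)
      filter_upwards [ht.eventually hhg] with w hw
      rw [← hw, hl]
  have hsub : ∀ l ∈ Λ.lattice, ∀ z, h (z - l) = h z := fun l hl z => by
    rw [← hper (z - l) l hl, sub_add_cancel]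
  obtain ⟨c, hc1, hc2⟩ := Λ.exists_eq_const_of_periodic hper (by
    intro z
    by_cases hz : z ∈ Λ.lattice
    · exact h0 z (hsub z hz)
    by_cases hz' : z + t ∈ Λ.lattice
    -- When `z + t` is in the lattice, `z` itself is a period of `h`, and the expansion at 0 can be
    -- transported.
    · refine h0 z fun w => ?_
      rw [← hper' (w - z), ← hsub _ hz' w, ← hper' (w - (z + t)), ← hper' (w - (z + t) + t)]
      congr 1; ring
    · exact ⟨h, hreg z hz hz', EventuallyEq.rfl⟩)
  intro z hz hz'
  rw [hc1 z (hreg z hz hz').continuousAt, hc2 0 g hg hhg]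

theorem analyticAt_add {z : ℂ} (hz : z + t ∉ Λ.lattice) :
    AnalyticAt ℂ (fun w => Λ.weierstrassP (w + t)) z :=
  AnalyticAt.fun_comp (g := Λ.weierstrassP) (f := fun w => w + t)
    (Λ.analyticAt_weierstrassP hz) (by fun_prop)

/-- Translation by a half period acts as an involution of the Riemann sphere. -/
theorem exists_translation (ht : IsHalfPeriod Λ t) : ∃ K : ℂ, K ≠ 0 ∧
    ∀ z ∉ Λ.lattice, z + t ∉ Λ.lattice →
      (Λ.weierstrassP (z + t) - Λ.weierstrassP t) * (Λ.weierstrassP z - Λ.weierstrassP t) = K := by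
  set e := Λ.weierstrassP t with he
  have hP : AnalyticAt ℂ (fun z => Λ.weierstrassP (z + t)) 0 :=
    analyticAt_add (by simpa using ht.notMem)
  -- Since ℘' vanishes at a half period, this factor has at least a double zero at 0, which cancels
  -- the double pole of ℘.
  have hder : deriv (fun z => Λ.weierstrassP (z + t) - e) 0 = 0 := by
    rw [deriv_sub_const, deriv_comp_add_const, Λ.deriv_weierstrassP, zero_add,
      ht.derivWeierstrassP_eq_zero]
  obtain ⟨q, hq, hq'⟩ := AnalyticAt.exists_eq_sq_mul (f := fun z => Λ.weierstrassP (z + t) - e)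
    (by fun_prop) (by simp [he]) hder
  have hE := Λ.analyticAt_weierstrassPExcept 0
  have key := Λ.exists_eq_const_of_half (t := t)
    (h := fun z => (Λ.weierstrassP (z + t) - e) * (Λ.weierstrassP z - e))
    (g := fun z => q z * (1 + z ^ 2 * (Λ.weierstrassPExcept 0 z - e)))
    (fun z l hl => by
      simp only [Λ.weierstrassP_add_of_mem hl, add_right_comm z l t])
    (fun z => by simp only [ht.add_add]; ring)
    (fun z hz hz' => by
      have h1 := Λ.analyticAt_weierstrassP hz
      have h2 := analyticAt_add hz'
      fun_prop)
    (by fun_prop)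
    (by
      filter_upwards [self_mem_nhdsWithin] with z hz
      have hz0 : z ≠ 0 := hz
      rw [hq', Λ.weierstrassP_eq_except_zero z]
      field_simp
      ring)
  refine ⟨_, ?_, key⟩
  -- If the constant were 0, one of the two analytic factors would vanish identically near a generic
  -- point, and ℘ would be locally constant.
  intro h0
  simp only [h0] at key
  have hev : ∀ᶠ z in 𝓝[≠] t, z ∉ Λ.lattice ∧ z + t ∉ Λ.lattice := by
    refine (Λ.eventually_notMem_lattice t).and ?_
    have htd : Tendsto (fun w => w + t) (𝓝[≠] t) (𝓝[≠] (t + t)) := by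
      refine tendsto_nhdsWithin_iff.2 ⟨?_, ?_⟩
      · have : ContinuousAt (fun w : ℂ => w + t) t := by fun_prop
        exact this.tendsto.mono_left nhdsWithin_le_nhds
      · filter_upwards [self_mem_nhdsWithin] with w hw h0
        exact hw (by simpa using h0)
    exact htd.eventually (Λ.eventually_notMem_lattice (t + t))
  obtain ⟨z, hz, hz'⟩ := hev.exists
  have h1 : ∀ᶠ w in 𝓝[≠] z, Λ.weierstrassP w - e ≠ 0 := by
    have := Λ.analyticAt_weierstrassP hz
    rcases AnalyticAt.eventually_eq_zero_or_eventually_ne_zero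
      (f := fun w => Λ.weierstrassP w - e) (z₀ := z) (by fun_prop) with h | h
    · exact absurd (h.mono fun w hw => sub_eq_zero.1 hw) (Λ.not_eventually_weierstrassP_eq hz)
    · exact h
  have h2 : ∀ᶠ w in 𝓝[≠] z, Λ.weierstrassP (w + t) - e ≠ 0 := by
    have := analyticAt_add hz'
    rcases AnalyticAt.eventually_eq_zero_or_eventually_ne_zero
      (f := fun w => Λ.weierstrassP (w + t) - e) (z₀ := z) (by fun_prop) with h | h
    · refine absurd ?_ (Λ.not_eventually_weierstrassP_eq (c := e) hz')
      have hc : Tendsto (fun w => w - t) (𝓝 (z + t)) (𝓝 z) := by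
        have : ContinuousAt (fun w : ℂ => w - t) (z + t) := by fun_prop
        simpa using this.tendsto
      filter_upwards [hc.eventually h] with w hw
      simpa [sub_eq_zero] using hw
    · exact h
  have h3 : ∀ᶠ w in 𝓝[≠] z, w ∉ Λ.lattice ∧ w + t ∉ Λ.lattice := by
    refine Eventually.filter_mono nhdsWithin_le_nhds
      ((Λ.eventually_notMem_lattice_of_notMem hz).and ?_)
    have : ContinuousAt (fun w : ℂ => w + t) z := by fun_prop
    exact this.eventually (Λ.eventually_notMem_lattice_of_notMem hz')
  obtain ⟨w, hw1, hw2, hw3, hw4⟩ := (h1.and (h2.and h3)).exists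
  exact mul_ne_zero hw2 hw1 (key w hw3 hw4)

/-- The Weierstrass function separates the half periods. -/
theorem weierstrassP_ne {s : ℂ} (ht : IsHalfPeriod Λ t) (hs : s ∉ Λ.lattice)
    (hst : s + t ∉ Λ.lattice) : Λ.weierstrassP s ≠ Λ.weierstrassP t := by
  obtain ⟨K, hK, h⟩ := ht.exists_translation
  intro he
  exact hK (by rw [← h s hs hst, he, sub_self, mul_zero])

theorem cubic_eq_zero (ht : IsHalfPeriod Λ t) :
    4 * Λ.weierstrassP t ^ 3 - Λ.g₂ * Λ.weierstrassP t - Λ.g₃ = 0 := by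
  rw [← Λ.derivWeierstrassP_sq t ht.notMem, ht.derivWeierstrassP_eq_zero]
  ring

theorem add {s : ℂ} (ht : IsHalfPeriod Λ t) (hs : IsHalfPeriod Λ s) (hst : s + t ∉ Λ.lattice) :
    IsHalfPeriod Λ (s + t) :=
  ⟨hst, by
    have : s + t + (s + t) = (s + s) + (t + t) := by ring
    rw [this]
    exact Submodule.add_mem _ hs.add_mem ht.add_mem⟩

/-- The values at the three half periods are distinct and their sum is zero. -/
theorem sum_eq_zero {s : ℂ} (ht : IsHalfPeriod Λ t) (hs : IsHalfPeriod Λ s)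
    (hst : s + t ∉ Λ.lattice) :
    Λ.weierstrassP s + Λ.weierstrassP t + Λ.weierstrassP (s + t) = 0 := by
  have h1 : Λ.weierstrassP s ≠ Λ.weierstrassP t := ht.weierstrassP_ne hs.notMem hst
  have e1 : s + t + t ∉ Λ.lattice := by
    rw [add_assoc]
    exact fun h => hs.notMem ((Λ.lattice.toAddSubgroup.add_mem_cancel_right ht.add_mem).1 h)
  have e2 : s + t + s ∉ Λ.lattice := by
    rw [add_right_comm, add_comm]
    exact fun h => ht.notMem ((Λ.lattice.toAddSubgroup.add_mem_cancel_right hs.add_mem).1 h)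
  have h2 : Λ.weierstrassP (s + t) ≠ Λ.weierstrassP t := ht.weierstrassP_ne hst e1
  have h3 : Λ.weierstrassP (s + t) ≠ Λ.weierstrassP s := hs.weierstrassP_ne hst e2
  have c1 := hs.cubic_eq_zero
  have c2 := ht.cubic_eq_zero
  have c3 := (ht.add hs hst).cubic_eq_zero
  -- Three distinct roots of a cubic without quadratic term: multiplication by their Vandermonde
  -- product eliminates `g₂` and `g₃`.
  refine mul_left_cancel₀ (mul_ne_zero (mul_ne_zero (sub_ne_zero.2 h1) (sub_ne_zero.2 h2))
    (sub_ne_zero.2 h3)) ?_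
  linear_combination (-1 / 4) * ((Λ.weierstrassP (s + t) - Λ.weierstrassP t) * c1 +
    (Λ.weierstrassP s - Λ.weierstrassP (s + t)) * c2 +
    (Λ.weierstrassP t - Λ.weierstrassP s) * c3)

end IsHalfPeriod
end PeriodPair

/-! ### Endomorphisms of degree two of a torus, and the maps they induce -/

namespace PeriodPair

variable {Λ : PeriodPair}

/-- Multiplication by `α` is an endomorphism of the torus with kernel `{0, t}`. -/
structure IsIsogeny (Λ : PeriodPair) (α t : ℂ) : Prop where
  map_mem : ∀ l ∈ Λ.lattice, α * l ∈ Λ.lattice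
  half : IsHalfPeriod Λ t
  map_half : α * t ∈ Λ.lattice
  ker : ∀ z, α * z ∈ Λ.lattice → z ∈ Λ.lattice ∨ z + t ∈ Λ.lattice

namespace IsIsogeny

variable {α t : ℂ}

theorem ne_zero (h : IsIsogeny Λ α t) : α ≠ 0 := by
  rintro rfl
  have hev := (Λ.eventually_notMem_lattice 0).and
    ((tendsto_nhdsWithin_iff.2 ⟨(Continuous.tendsto (f := fun w : ℂ => w + t) (by fun_prop) 0).mono_left
      nhdsWithin_le_nhds, by
        filter_upwards [self_mem_nhdsWithin] with w hw h0
        exact hw (by simpa using h0)⟩ : Tendsto (fun w => w + t) (𝓝[≠] 0) (𝓝[≠] (0 + t))).eventually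
        (Λ.eventually_notMem_lattice (0 + t)))
  obtain ⟨z, h1, h2⟩ := hev.exists
  rcases h.ker z (by simp) with h3 | h3
  · exact h1 h3
  · exact h2 h3

/-- Both sides have the same principal parts at the lattice and at its translate by `t`, so their
difference is constant. The constant is read off at 0, where ℘(z) - 1/z² vanishes. -/
theorem sum_formula (h : IsIsogeny Λ α t) {z : ℂ} (hz : z ∉ Λ.lattice) (hzt : z + t ∉ Λ.lattice) :
    α ^ 2 * Λ.weierstrassP (α * z) =
      Λ.weierstrassP z + Λ.weierstrassP (z + t) - Λ.weierstrassP t := by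
  have hα := h.ne_zero
  have hE := Λ.analyticAt_weierstrassPExcept 0
  have hP : AnalyticAt ℂ (fun z => Λ.weierstrassP (z + t)) 0 :=
    IsHalfPeriod.analyticAt_add (by simpa using h.half.notMem)
  have hE' : AnalyticAt ℂ (fun z => Λ.weierstrassPExcept 0 (α * z)) 0 :=
    AnalyticAt.fun_comp (by simpa using hE) (by fun_prop)
  have key := Λ.exists_eq_const_of_half (t := t)
    (h := fun z => α ^ 2 * Λ.weierstrassP (α * z) - Λ.weierstrassP z - Λ.weierstrassP (z + t))
    (g := fun z => α ^ 2 * Λ.weierstrassPExcept 0 (α * z) - Λ.weierstrassPExcept 0 z -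
      Λ.weierstrassP (z + t))
    (fun z l hl => by
      simp only [mul_add, Λ.weierstrassP_add_of_mem hl, Λ.weierstrassP_add_of_mem (h.map_mem l hl),
        add_right_comm z l t])
    (fun z => by
      simp only [mul_add, Λ.weierstrassP_add_of_mem h.map_half, h.half.add_add]; ring)
    (fun z hz hz' => by
      have h1 := Λ.analyticAt_weierstrassP hz
      have h2 := IsHalfPeriod.analyticAt_add hz'
      have h3 : AnalyticAt ℂ (fun z => Λ.weierstrassP (α * z)) z :=
        AnalyticAt.fun_comp (Λ.analyticAt_weierstrassP fun h0 => (h.ker z h0).elim hz hz')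
          (by fun_prop)
      fun_prop)
    (by fun_prop)
    (by
      filter_upwards [self_mem_nhdsWithin] with z hz
      have hz0 : z ≠ 0 := hz
      rw [Λ.weierstrassP_eq_except_zero z, Λ.weierstrassP_eq_except_zero (α * z)]
      field_simp
      ring) z hz hzt
  simp at key
  linear_combination key

/-- The quadratic map `x ↦ α⁻² (x + K / (x - e))`. -/
def _root_.RSphere.QuadMap.isogeny (α e K : ℂ) : RSphere.QuadMap :=
  ⟨1, -e, K, 0, α ^ 2, -(α ^ 2 * e)⟩

open RSphere RSphere.QuadMap

theorem _root_.RSphere.QuadMap.nondeg_isogeny {α e K : ℂ} (hα : α ≠ 0) (hK : K ≠ 0) :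
    (isogeny α e K).Nondeg := by
  intro u v h1 h2
  simp only [num, den, isogeny] at h1 h2
  have h3 : α ^ 2 * (v * (u - e * v)) = 0 := by linear_combination h2
  rcases mul_eq_zero.1 ((mul_eq_zero.1 h3).resolve_left (pow_ne_zero 2 hα)) with h4 | h4
  · subst h4
    simpa using h1
  · have h5 : K * v ^ 2 = 0 := by linear_combination h1 - u * h4
    have h6 : v = 0 := by simpa [hK] using h5
    subst h6
    simpa using h4

/-- Outside the kernel, `hK` expresses ℘(z + t) as `e + K / (℘ z - e)` in `sum_formula`. The two
classes of the kernel go to ∞ and are treated separately. -/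
theorem toMap_isogeny (h : IsIsogeny Λ α t) {K : ℂ} (hK0 : K ≠ 0)
    (hK : ∀ z ∉ Λ.lattice, z + t ∉ Λ.lattice →
      (Λ.weierstrassP (z + t) - Λ.weierstrassP t) * (Λ.weierstrassP z - Λ.weierstrassP t) = K)
    (z : ℂ) : (isogeny α (Λ.weierstrassP t) K).toMap (Λ.wp z) = Λ.wp (α * z) := by
  set e := Λ.weierstrassP t with he
  by_cases hz : z ∈ Λ.lattice
  · rw [Λ.wp_of_mem hz, Λ.wp_of_mem (h.map_mem z hz), ← ofHom_zero_right 1,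
      toMap_ofHom _ (by simp)]
    simp [num, den, isogeny]
  by_cases hzt : z + t ∈ Λ.lattice
  · have hPz : Λ.weierstrassP z = e := by
      have := Λ.weierstrassP_add_of_mem hzt (-t)
      rw [Λ.weierstrassP_neg] at this
      rw [he, ← this]
      congr 1; ring
    have hαz : α * z ∈ Λ.lattice := by
      have : α * z = α * (z + t) - α * t := by ring
      rw [this]
      exact sub_mem (h.map_mem _ hzt) h.map_half
    rw [Λ.wp_of_notMem hz, Λ.wp_of_mem hαz, hPz, ← ofHom_one_right, toMap_ofHom _ (by simp)]
    have : (isogeny α e K).den e 1 = 0 := by simp [den, isogeny]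
    rw [this, ofHom_zero_right]
  · have hαz : α * z ∉ Λ.lattice := fun h0 => (h.ker z h0).elim hz hzt
    have hK' := hK z hz hzt
    have hne : Λ.weierstrassP z - e ≠ 0 := by
      intro h0
      rw [h0, mul_zero] at hK'
      exact hK0 hK'.symm
    have hden : (isogeny α e K).den (Λ.weierstrassP z) 1 ≠ 0 := by
      have : (isogeny α e K).den (Λ.weierstrassP z) 1 = α ^ 2 * (Λ.weierstrassP z - e) := by
        simp [den, isogeny]; ring
      rw [this]
      exact mul_ne_zero (pow_ne_zero 2 h.ne_zero) hne
    rw [Λ.wp_of_notMem hz, Λ.wp_of_notMem hαz, ← ofHom_one_right, toMap_ofHom _ (by simp),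
      ofHom_of_ne hden, OnePoint.coe_eq_coe, div_eq_iff hden]
    have hs := h.sum_formula hz hzt
    simp only [num, den, isogeny]
    linear_combination -(Λ.weierstrassP z - e) * hs - hK'

end IsIsogeny
end PeriodPair

theorem CTorus.proj_eq_proj_iff {Λ : PeriodPair} {z w : ℂ} :
    CTorus.proj Λ z = CTorus.proj Λ w ↔ z - w ∈ Λ.lattice :=
  Submodule.Quotient.eq _

namespace RSphere

/-- A quadratic map that is semiconjugate to an affine map of a torus is a Lattès map. -/
theorem QuadMap.Nondeg.isLattesMap {F : QuadMap} (hF : F.Nondeg) {Λ : PeriodPair} {α β : ℂ}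
    (hα : ∀ l ∈ Λ.lattice, α * l ∈ Λ.lattice) {P : ℂ → RSphere} (hP : IsHolomorphic P)
    (hper : ∀ z, ∀ l ∈ Λ.lattice, P (z + l) = P z) (hne : ∀ c, ∃ z, P z ≠ c)
    (hFP : ∀ z, F.toMap (P z) = P (α * z + β)) : IsLattesMap F.toMap := by
  have hout : ∀ z, (CTorus.proj Λ z).out - z ∈ Λ.lattice := fun z => by
    rw [← CTorus.proj_eq_proj_iff]
    exact Quotient.out_eq (CTorus.proj Λ z)
  have hp : ∀ z, P (CTorus.proj Λ z).out = P z := fun z => by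
    rw [← hper z _ (hout z), add_sub_cancel]
  have hL : ∀ z, CTorus.proj Λ (α * (CTorus.proj Λ z).out + β) = CTorus.proj Λ (α * z + β) := by
    intro z
    rw [CTorus.proj_eq_proj_iff]
    have : α * (CTorus.proj Λ z).out + β - (α * z + β) = α * ((CTorus.proj Λ z).out - z) := by ring
    rw [this]
    exact hα _ (hout z)
  refine ⟨2, le_rfl, hF.isRationalMap, Λ, fun q => CTorus.proj Λ (α * q.out + β),
    fun q => P q.out, ?_, ?_, ?_, ?_⟩
  · intro z
    exact ⟨fun w => α * w + β, by fun_prop, Eventually.of_forall hL⟩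
  · rw [CTorus.IsHolomorphicToSphere]
    simpa only [hp] using hP
  · rintro ⟨c, hc⟩
    obtain ⟨z, hz⟩ := hne c
    exact hz ((hp z).symm.trans (hc _))
  · funext q
    simp only [Function.comp_apply, hp, hFP]

end RSphere

/-! ### Lattices with an endomorphism of norm 2 -/

namespace PeriodPair

/-- The lattice spanned by `1` and `θ`. -/
def ofIm (θ : ℂ) (hθ : θ.im ≠ 0) : PeriodPair where
  ω₁ := 1
  ω₂ := θ
  indep := by
    rw [LinearIndependent.pair_iff]
    intro s t h
    have h1 := congrArg Complex.im h
    have h2 := congrArg Complex.re h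
    simp at h1 h2
    have ht : t = 0 := h1.resolve_right hθ
    subst ht
    exact ⟨by simpa using h2, rfl⟩

variable {θ : ℂ} {hθ : θ.im ≠ 0}

theorem mem_ofIm {x : ℂ} : x ∈ (ofIm θ hθ).lattice ↔ ∃ m n : ℤ, x = m + n * θ := by
  rw [mem_lattice]
  simp [ofIm, eq_comm]

theorem ofIm_half_notMem {m n : ℤ} (h : m % 2 = 1 ∨ n % 2 = 1) :
    (m + n * θ) / 2 ∉ (ofIm θ hθ).lattice := by
  rw [mem_ofIm]
  rintro ⟨m', n', h'⟩
  have h1 : (m + n * θ : ℂ) = 2 * (m' + n' * θ) := by linear_combination 2 * h'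
  have h2 := congrArg Complex.im h1
  have h3 := congrArg Complex.re h1
  simp at h2 h3
  have hn : n = 2 * n' := by
    have : (n : ℝ) = 2 * n' := mul_right_cancel₀ hθ (by linarith)
    exact_mod_cast this
  have hm : m = 2 * m' := by
    have : (m : ℝ) = 2 * m' := by rw [hn] at h3; push_cast at h3; linarith
    exact_mod_cast this
  omega

theorem isHalfPeriod_ofIm (m n : ℤ) (h : m % 2 = 1 ∨ n % 2 = 1) :
    IsHalfPeriod (ofIm θ hθ) ((m + n * θ) / 2) :=
  ⟨ofIm_half_notMem h, mem_ofIm.2 ⟨m, n, by ring⟩⟩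

/-- Values at half periods and an endomorphism with kernel of order two. -/
theorem IsIsogeny.apply_half {Λ : PeriodPair} {α t s : ℂ} (h : IsIsogeny Λ α t)
    (hs : IsHalfPeriod Λ s) (hst : s + t ∉ Λ.lattice) :
    α ^ 2 * Λ.weierstrassP (α * s) = -2 * Λ.weierstrassP t := by
  rw [h.sum_formula hs.notMem hst]
  linear_combination h.half.sum_eq_zero hs hst

theorem im_ne_zero_of_sq {D : ℕ} (hD : 0 < D) {r : ℂ} (hr : r ^ 2 = -D) : r.im ≠ 0 := by
  intro h0
  have h2 := (ZRoot.re_root hr hD).2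
  rw [h0] at h2
  have : (0 : ℝ) < D := by exact_mod_cast hD
  simp at h2
  exact this.ne h2

/-- Division by `1 + r` is multiplication by `(1 - r) / 2`, and the parity of `m + n` tells the two
classes of the kernel apart. -/
theorem isIsogeny_one_add {r : ℂ} (hr : r ^ 2 = -1) (h : r.im ≠ 0) :
    IsIsogeny (ofIm r h) (1 + r) ((1 + r) / 2) where
  map_mem := by
    intro l hl
    obtain ⟨m, n, rfl⟩ := mem_ofIm.1 hl
    exact mem_ofIm.2 ⟨m - n, m + n, by push_cast; linear_combination (n : ℂ) * hr⟩
  half := by simpa using isHalfPeriod_ofIm (θ := r) (hθ := h) 1 1 (by norm_num)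
  map_half := mem_ofIm.2 ⟨0, 1, by push_cast; linear_combination hr / 2⟩
  ker := by
    intro z hz
    obtain ⟨m, n, hmn⟩ := mem_ofIm.1 hz
    have hz' : z = ((m + n : ℤ) + (n - m : ℤ) * r) / 2 := by
      push_cast
      linear_combination (1 - r) / 2 * hmn + (z / 2 - n / 2) * hr
    rcases Int.even_or_odd' (m + n) with ⟨k, hk | hk⟩
    · left
      refine mem_ofIm.2 ⟨k, k - m, ?_⟩
      rw [hz', hk, show n - m = 2 * (k - m) by omega]; push_cast; ring
    · right
      refine mem_ofIm.2 ⟨k + 1, k + 1 - m, ?_⟩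
      rw [hz', hk, show n - m = 2 * (k - m) + 1 by omega]; push_cast; ring

/-- Division by `r` is multiplication by `-r / 2`; the parity of `m` decides the class. -/
theorem isIsogeny_sqrt_two {r : ℂ} (hr : r ^ 2 = -2) (h : r.im ≠ 0) :
    IsIsogeny (ofIm r h) r (r / 2) where
  map_mem := by
    intro l hl
    obtain ⟨m, n, rfl⟩ := mem_ofIm.1 hl
    exact mem_ofIm.2 ⟨-2 * n, m, by push_cast; linear_combination (n : ℂ) * hr⟩
  half := by simpa using isHalfPeriod_ofIm (θ := r) (hθ := h) 0 1 (by norm_num)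
  map_half := mem_ofIm.2 ⟨-1, 0, by push_cast; linear_combination hr / 2⟩
  ker := by
    intro z hz
    obtain ⟨m, n, hmn⟩ := mem_ofIm.1 hz
    have hz' : z = n + (-m : ℤ) * r / 2 := by
      push_cast
      linear_combination -r / 2 * hmn + (z / 2 - n / 2) * hr
    rcases Int.even_or_odd' (-m) with ⟨k, hk | hk⟩
    · left
      refine mem_ofIm.2 ⟨n, k, ?_⟩
      rw [hz', hk]; push_cast; ring
    · right
      refine mem_ofIm.2 ⟨n, k + 1, ?_⟩
      rw [hz', hk]; push_cast; ring

/-- Division by `α` is multiplication by `(1 - α) / 2`; the parity of `m` decides the class. -/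
theorem isIsogeny_sqrt_seven {α : ℂ} (hα : α ^ 2 = α - 2) (h : α.im ≠ 0) :
    IsIsogeny (ofIm α h) α ((1 - α) / 2) where
  map_mem := by
    intro l hl
    obtain ⟨m, n, rfl⟩ := mem_ofIm.1 hl
    exact mem_ofIm.2 ⟨-2 * n, m + n, by push_cast; linear_combination (n : ℂ) * hα⟩
  half := by
    simpa [sub_eq_add_neg] using isHalfPeriod_ofIm (θ := α) (hθ := h) 1 (-1) (by norm_num)
  map_half := mem_ofIm.2 ⟨1, 0, by push_cast; linear_combination -hα / 2⟩
  ker := by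
    intro z hz
    obtain ⟨m, n, hmn⟩ := mem_ofIm.1 hz
    have hz' : z = n + (m : ℤ) * (1 - α) / 2 := by
      linear_combination (1 - α) / 2 * hmn + (z / 2 - n / 2) * hα
    rcases Int.even_or_odd' m with ⟨k, hk | hk⟩
    · left
      refine mem_ofIm.2 ⟨n + k, -k, ?_⟩
      rw [hz', hk]; push_cast; ring
    · right
      refine mem_ofIm.2 ⟨n + k + 1, -k - 1, ?_⟩
      rw [hz', hk]; push_cast; ring

end PeriodPair

/-! ### The quadratic Lattès maps and their fixed point multipliers -/

namespace RSphere
namespace QuadMap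

open PeriodPair

theorem isLattesMap_isogeny {Λ : PeriodPair} {α t K : ℂ} (h : IsIsogeny Λ α t) (hK0 : K ≠ 0)
    (hK : ∀ z ∉ Λ.lattice, z + t ∉ Λ.lattice →
      (Λ.weierstrassP (z + t) - Λ.weierstrassP t) * (Λ.weierstrassP z - Λ.weierstrassP t) = K) :
    IsLattesMap (isogeny α (Λ.weierstrassP t) K).toMap :=
  (nondeg_isogeny h.ne_zero hK0).isLattesMap (β := 0) h.map_mem Λ.isHolomorphic_wp
    (fun z _ hl => Λ.wp_add_of_mem hl z) Λ.wp_ne_const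
    fun z => by rw [h.toMap_isogeny hK0 hK, add_zero]

theorem nondeg_squareLattes {K : ℂ} (hK0 : K ≠ 0) :
    (⟨1, 2 * K, K ^ 2, 0, -4, 0⟩ : QuadMap).Nondeg := by
  intro u v h1 h2
  simp only [num, den] at h1 h2
  have h3 : u * v = 0 := by linear_combination -h2 / 4
  rcases mul_eq_zero.1 h3 with rfl | rfl
  · simpa [hK0] using h1
  · simpa using h1

/-- The Lattès maps of the square lattice. -/
theorem exists_isLattesMap_isogeny_one_add {r : ℂ} (hr : r ^ 2 = -1) :
    ∃ K : ℂ, K ≠ 0 ∧ IsLattesMap (isogeny (1 + r) 0 K).toMap ∧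
      IsLattesMap (⟨1, 2 * K, K ^ 2, 0, -4, 0⟩ : QuadMap).toMap := by
  have him : r.im ≠ 0 := im_ne_zero_of_sq (D := 1) one_pos (by simpa using hr)
  have h := isIsogeny_one_add hr him
  set Λ := ofIm r him
  obtain ⟨K, hK0, hK⟩ := h.half.exists_translation
  have hs : IsHalfPeriod Λ (1 / 2) := by
    simpa using isHalfPeriod_ofIm (θ := r) (hθ := him) 1 0 (by norm_num)
  -- Multiplication by `1 + r` sends the half period 1/2 to `(1 + r) / 2`, so the value there is
  -- multiplied by `-2` and by `(1 + r) ^ 2` with the same result.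
  have he : Λ.weierstrassP ((1 + r) / 2) = 0 := by
    have h1 := h.apply_half hs (by
      rw [show (1 : ℂ) / 2 + (1 + r) / 2 = ((2 : ℤ) + (1 : ℤ) * r) / 2 by push_cast; ring]
      exact ofIm_half_notMem (by norm_num))
    rw [mul_one_div] at h1
    have h2 : (2 + 2 * r) * Λ.weierstrassP ((1 + r) / 2) = 0 := by
      linear_combination h1 - Λ.weierstrassP ((1 + r) / 2) * hr
    refine (mul_eq_zero.1 h2).resolve_left fun h3 => ?_
    have := congrArg Complex.im h3
    simp at this
    exact him this
  have hL := isLattesMap_isogeny h hK0 hK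
  have hFP := h.toMap_isogeny hK0 hK
  rw [he] at hL hFP
  refine ⟨K, hK0, hL, ?_⟩
  -- As the value `e` is 0, the induced map is odd and descends through squaring: ℘² is again a
  -- semiconjugacy, with `(1 + r) ^ 4 = -4` as coefficient.
  set S : QuadMap := ⟨1, 0, 0, 0, 0, 1⟩ with hS
  refine (nondeg_squareLattes hK0).isLattesMap (P := fun z => S.toMap (Λ.wp z)) (α := 1 + r) (β := 0) h.map_mem
    (isHolomorphic_of_hom fun z => ?_) (fun z l hl => ?_) (fun c => ?_) (fun z => ?_)
  · obtain ⟨U, V, hU, hV, h0, he⟩ := Λ.exists_hom_wp z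
    refine ⟨fun w => U w ^ 2, fun w => V w ^ 2, by fun_prop, by fun_prop, by simpa using h0, ?_⟩
    have hne : ∀ᶠ w in 𝓝 z, U w ≠ 0 ∨ V w ≠ 0 := by
      rcases h0 with h | h
      · exact (hU.continuousAt.eventually_ne h).mono fun _ => Or.inl
      · exact (hV.continuousAt.eventually_ne h).mono fun _ => Or.inr
    filter_upwards [he, hne] with w hw hw'
    rw [hw, toMap_ofHom _ hw']
    simp [num, den, hS]
  · simp only [Λ.wp_add_of_mem hl]
  · by_contra! hc
    have h1 := hc 0
    have h2 := hc (Λ.ω₁ / 2)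
    rw [← h1, Λ.wp_of_mem (zero_mem _), Λ.wp_of_notMem Λ.ω₁_div_two_notMem_lattice] at h2
    simp [toMap, hS, num, den] at h2
  · simp only [add_zero]
    rw [← hFP z]
    obtain ⟨u, v, huv, hw⟩ := exists_eq_ofHom (Λ.wp z)
    rw [hw, toMap_ofHom _ huv, toMap_ofHom _ huv,
      toMap_ofHom _ ((nondeg_isogeny h.ne_zero hK0).ne_zero huv), toMap_ofHom]
    · have hα : (1 + r) ^ 4 = -4 := by linear_combination (r ^ 2 + 4 * r + 5) * hr
      congr 1
      · simp only [num, den, hS, isogeny]; ring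
      · simp only [num, den, hS, isogeny]
        linear_combination -(u ^ 2 * v ^ 2) * hα
    · simpa [num, den, hS] using huv

theorem isLattesMap_normalForm {F : QuadMap} {a b : ℂ} (hab : a * b ≠ 1) (hF : IsLattesMap F.toMap)
    (h : IsConj F.toMap (normalForm a b).toMap) : IsLattesMap (normalForm a b).toMap :=
  IsLattesMap.of_isConj (nondeg_normalForm hab).isRationalMap h.symm hF

/-- For the map induced by ℘, the multiplier at ∞ is `(1 + r) ^ 2 = 2 * r` and the two opposite
finite fixed points both have `-1 - r`. For the map induced by ℘², the finite fixed points have `-1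
- r` and `-1 + r`. -/
theorem isLattesMap_sqrt_one {r : ℂ} (hr : r ^ 2 = -1) :
    IsLattesMap (normalForm (2 * r) (-1 - r)).toMap ∧
      IsLattesMap (normalForm (-1 - r) (-1 - r)).toMap ∧
      IsLattesMap (normalForm (-1 - r) (-1 + r)).toMap := by
  obtain ⟨K, hK0, hL, hL'⟩ := exists_isLattesMap_isogeny_one_add hr
  have hr0 : r ≠ 0 := by rintro rfl; norm_num at hr
  have h2r : 2 * r - 1 ≠ 0 := by
    intro h0
    have : (5 : ℂ) = 0 := by linear_combination (2 * r + 1) * (-h0) + 4 * hr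
    norm_num at this
  have hα : (1 + r) ^ 2 = 2 * r := by linear_combination hr
  have hα0 : (1 + r) ≠ 0 := by
    intro h0
    rw [h0] at hα
    simp at hα
    exact hr0 hα
  obtain ⟨x, hx⟩ := IsAlgClosed.exists_pow_nat_eq (K / (2 * r - 1)) (n := 2) (by norm_num)
  have hKx : K = (2 * r - 1) * x ^ 2 := by rw [hx, mul_div_cancel₀ _ h2r]
  have hx0 : x ≠ 0 := by rintro rfl; simp at hKx; exact hK0 hKx
  obtain ⟨hab, hconj⟩ := isConj_normalForm (F := isogeny (1 + r) 0 K) (u₁ := 1) (v₁ := 0)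
    (u₂ := 1 / (2 * r)) (v₂ := 1 / (2 * r * x)) (a := 2 * r) (b := -1 - r)
    (nondeg_isogeny hα0 hK0) (by simp [hr0, hx0]) (by simp [num, isogeny]) (by simp [den, isogeny])
    (by simp only [num, isogeny, hKx]; field_simp; ring)
    (by simp only [den, isogeny, hα]; field_simp; ring)
    (by simp only [isogeny]; field_simp; linear_combination 2 * x * hr)
    (by simp only [isogeny, hα]; field_simp; ring)
  have hs1 := isLattesMap_normalForm hab hL hconj
  refine ⟨hs1, ?_, ?_⟩
  · have hne : -1 - r ≠ 1 := by
      intro h0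
      have : (5 : ℂ) = 0 := by linear_combination hr - (r - 2) * (-h0)
      norm_num at this
    obtain ⟨hab', hconj'⟩ := isConj_normalForm_third (a := -1 - r) (b := 2 * r) (c := -1 - r)
      (by rwa [mul_comm]) hne (by linear_combination (-2 * r - 4) * hr)
    exact isLattesMap_normalForm hab' hL (hconj.trans ((isConj_normalForm_swap hab).trans hconj'))
  · have hnd : (⟨1, 2 * K, K ^ 2, 0, -4, 0⟩ : QuadMap).Nondeg := nondeg_squareLattes hK0
    obtain ⟨hab', hconj'⟩ : (-1 - r) * (-1 + r) ≠ 1 ∧ IsConj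
        (⟨1, 2 * K, K ^ 2, 0, -4, 0⟩ : QuadMap).toMap (normalForm (-1 - r) (-1 + r)).toMap := by
      refine isConj_normalForm (u₁ := -1 / 4) (v₁ := -(-1 + 2 * r) / (4 * K))
        (u₂ := -1 / 4) (v₂ := -(-1 - 2 * r) / (4 * K)) hnd ?_ ?_ ?_ ?_ ?_ ?_ ?_
      · field_simp; ring_nf; simpa using ⟨hr0, hK0⟩
      · simp only [num]; field_simp; linear_combination 4 * hr
      · simp only [den]; field_simp; ring
      · simp only [num]; field_simp; linear_combination 4 * hr
      · simp only [den]; field_simp; ring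
      · simp only []; field_simp; linear_combination (-8) * hr
      · simp only []; field_simp; linear_combination 16 * K * hr
    exact isLattesMap_normalForm hab' hL' hconj'

end QuadMap
end RSphere

namespace RSphere
namespace QuadMap

open PeriodPair

/-- The Lattès map of the lattice `ℤ[√-2]`. -/
theorem isLattesMap_sqrt_two {r : ℂ} (hr : r ^ 2 = -2) : IsLattesMap (normalForm r (-r)).toMap := by
  have him : r.im ≠ 0 := im_ne_zero_of_sq (D := 2) two_pos (by simpa using hr)
  have h := isIsogeny_sqrt_two hr him
  set Λ := ofIm r him
  obtain ⟨K, hK0, hK⟩ := h.half.exists_translation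
  have hL := isLattesMap_isogeny h hK0 hK
  set e := Λ.weierstrassP (r / 2) with he
  have hs : IsHalfPeriod Λ (1 / 2) := by
    simpa using isHalfPeriod_ofIm (θ := r) (hθ := him) 1 0 (by norm_num)
  have hst : 1 / 2 + r / 2 ∉ Λ.lattice := by
    rw [show (1 : ℂ) / 2 + r / 2 = ((1 : ℤ) + (1 : ℤ) * r) / 2 by push_cast; ring]
    exact ofIm_half_notMem (by norm_num)
  have hsum := h.half.sum_eq_zero hs hst
  have h1 := hK _ hs.notMem hst
  -- A quarter period determines `K`: `-(r / 4)` and its translate by `r / 2` are opposite, so ℘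
  -- agrees there, and multiplication by `r` leads to the half period 1/2.
  have hquarter : ∀ n : ℤ, n % 2 = 1 → (n : ℂ) * r / 4 ∉ Λ.lattice := by
    intro n hn hmem
    have h2 := Λ.lattice.add_mem hmem hmem
    rw [show (n : ℂ) * r / 4 + n * r / 4 = ((0 : ℤ) + n * r) / 2 by push_cast; ring] at h2
    exact ofIm_half_notMem (Or.inr hn) h2
  have hz : -(r / 4) ∉ Λ.lattice := by
    simpa [neg_div] using hquarter (-1) (by norm_num)
  have hzt : -(r / 4) + r / 2 ∉ Λ.lattice := by
    rw [show -(r / 4) + r / 2 = ((1 : ℤ) : ℂ) * r / 4 by push_cast; ring]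
    exact hquarter 1 (by norm_num)
  have heq : Λ.weierstrassP (-(r / 4) + r / 2) = Λ.weierstrassP (-(r / 4)) := by
    rw [Λ.weierstrassP_neg]
    congr 1; ring
  have h2 := h.sum_formula hz hzt
  have h3 := hK _ hz hzt
  rw [heq] at h2 h3
  rw [show r * -(r / 4) = 1 / 2 by linear_combination -hr / 4, hr] at h2
  rw [← he] at h2
  set y := Λ.weierstrassP (-(r / 4))
  set x := Λ.weierstrassP (1 / 2)
  set x' := Λ.weierstrassP (1 / 2 + r / 2)
  -- Eliminating the quarter period and the other half periods leaves only the scale `e`.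
  have hKe : 8 * K = 9 * e ^ 2 := by
    have hy : y = (e - 2 * x) / 2 := by linear_combination -h2 / 2
    have hx' : x' = -x - e := by linear_combination hsum
    rw [hy] at h3
    rw [hx'] at h1
    linear_combination -4 * h3 - 4 * h1
  have he0 : e ≠ 0 := by
    intro h0
    rw [h0] at hKe
    simp at hKe
    exact hK0 hKe
  have hKe' : K = 9 / 8 * e ^ 2 := by linear_combination hKe / 8
  have hr0 : r ≠ 0 := by rintro rfl; norm_num at hr
  have h3r : r ^ 3 = -2 * r := by linear_combination r * hr
  have h4r : r ^ 4 = 4 := by linear_combination (r ^ 2 - 2) * hr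
  have h5r : r ^ 5 = 4 * r := by linear_combination r * (r ^ 2 - 2) * hr
  obtain ⟨hab, hconj⟩ : r * -r ≠ 1 ∧ IsConj (isogeny r e K).toMap (normalForm r (-r)).toMap := by
    refine isConj_normalForm (u₁ := (r + 2) ^ 2 / 12) (v₁ := (r + 2) / (3 * e))
      (u₂ := (-r + 2) ^ 2 / 12) (v₂ := (-r + 2) / (3 * e)) (nondeg_isogeny hr0 hK0)
      ?_ ?_ ?_ ?_ ?_ ?_ ?_
    · field_simp
      ring_nf
      simp only [h3r]
      ring_nf
      simpa using ⟨hr0, he0⟩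
    · simp only [num, isogeny, hKe']; field_simp; ring_nf; simp only [hr, h3r, h4r]; ring
    · simp only [den, isogeny]; field_simp; ring_nf; simp only [hr, h3r, h4r, h5r]; ring
    · simp only [num, isogeny, hKe']; field_simp; ring_nf; simp only [hr, h3r, h4r]; ring
    · simp only [den, isogeny]; field_simp; ring_nf; simp only [hr, h3r, h4r, h5r]; ring
    · simp only [isogeny, hKe']; field_simp; ring_nf; simp only [hr, h4r]; ring
    · simp only [isogeny]; field_simp; ring_nf; simp only [hr, h4r]; ring
  exact isLattesMap_normalForm hab hL hconj

end QuadMap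
end RSphere

namespace PeriodPair

open RSphere

/-- Translation by a half period, on the Riemann sphere. -/
theorem IsHalfPeriod.wp_add {Λ : PeriodPair} {t K : ℂ} (ht : IsHalfPeriod Λ t) (hK0 : K ≠ 0)
    (hK : ∀ z ∉ Λ.lattice, z + t ∉ Λ.lattice →
      (Λ.weierstrassP (z + t) - Λ.weierstrassP t) * (Λ.weierstrassP z - Λ.weierstrassP t) = K)
    {z u v : ℂ} (huv : u ≠ 0 ∨ v ≠ 0) (h : Λ.wp z = ofHom u v) :
    Λ.wp (z + t) = ofHom (Λ.weierstrassP t * u + (K - Λ.weierstrassP t ^ 2) * v)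
      (u - Λ.weierstrassP t * v) := by
  set e := Λ.weierstrassP t with he
  have hdet : e * -e - (K - e ^ 2) * 1 ≠ 0 := by
    intro h0
    exact hK0 (by linear_combination -h0)
  have hm : ∀ {u v : ℂ}, (u ≠ 0 ∨ v ≠ 0) → mob e (K - e ^ 2) 1 (-e) hdet • ofHom u v =
      ofHom (e * u + (K - e ^ 2) * v) (1 * u + -e * v) :=
    fun huv => mob_smul_ofHom _ _ _ _ hdet huv
  suffices hs : Λ.wp (z + t) = mob e (K - e ^ 2) 1 (-e) hdet • Λ.wp z by
    rw [hs, h, hm huv]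
    congr 1; ring
  by_cases hz : z ∈ Λ.lattice
  · have hzt : Λ.wp (z + t) = Λ.wp t := by rw [add_comm, Λ.wp_add_of_mem hz]
    rw [hzt, Λ.wp_of_notMem ht.notMem, Λ.wp_of_mem hz, ← ofHom_zero_right 1, hm (by simp)]
    simp [he]
  by_cases hzt : z + t ∈ Λ.lattice
  · have hPz : Λ.weierstrassP z = e := by
      have := Λ.weierstrassP_add_of_mem hzt (-t)
      rw [Λ.weierstrassP_neg] at this
      rw [he, ← this]
      congr 1; ring
    rw [Λ.wp_of_notMem hz, Λ.wp_of_mem hzt, hPz, ← ofHom_one_right, hm (by simp)]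
    have : 1 * e + -e * 1 = 0 := by ring
    rw [this, ofHom_zero_right]
  · have hK' := hK z hz hzt
    have hne : Λ.weierstrassP z - e ≠ 0 := by
      intro h0
      rw [h0, mul_zero] at hK'
      exact hK0 hK'.symm
    have hne' : 1 * Λ.weierstrassP z + -e * 1 ≠ 0 := fun h => hne (by linear_combination h)
    rw [Λ.wp_of_notMem hz, Λ.wp_of_notMem hzt, ← ofHom_one_right (Λ.weierstrassP z), hm (by simp),
      ofHom_of_ne hne', OnePoint.coe_eq_coe, eq_div_iff hne']
    linear_combination hK'

end PeriodPair

namespace RSphere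
namespace QuadMap

open PeriodPair

/-- The quadratic map followed by `x ↦ e + K / (x - e)`. -/
def involute (F : QuadMap) (e K : ℂ) : QuadMap :=
  ⟨e * F.p₂ + (K - e ^ 2) * F.q₂, e * F.p₁ + (K - e ^ 2) * F.q₁, e * F.p₀ + (K - e ^ 2) * F.q₀,
    F.p₂ - e * F.q₂, F.p₁ - e * F.q₁, F.p₀ - e * F.q₀⟩

theorem num_involute (F : QuadMap) (e K u v : ℂ) :
    (F.involute e K).num u v = e * F.num u v + (K - e ^ 2) * F.den u v := by
  simp only [num, den, involute]; ring

theorem den_involute (F : QuadMap) (e K u v : ℂ) :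
    (F.involute e K).den u v = F.num u v - e * F.den u v := by
  simp only [num, den, involute]; ring

theorem Nondeg.involute {F : QuadMap} (hF : F.Nondeg) (e : ℂ) {K : ℂ} (hK : K ≠ 0) :
    (F.involute e K).Nondeg := by
  intro u v h1 h2
  rw [num_involute] at h1
  rw [den_involute] at h2
  have h3 : K * F.den u v = 0 := by linear_combination h1 - e * h2
  have h4 : F.den u v = 0 := (mul_eq_zero.1 h3).resolve_left hK
  exact hF u v (by rw [h4] at h2; simpa using h2) h4

/-- The Lattès maps of the lattice `ℤ[(1 + √-7) / 2]`. -/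
theorem exists_isLattesMap_sqrt_seven {α : ℂ} (hα : α ^ 2 = α - 2) :
    ∃ c : ℂ, c ≠ 0 ∧ IsLattesMap (isogeny α ((2 - α) * c / 2) (-(1 + α) * c ^ 2)).toMap ∧
      IsLattesMap ((isogeny α ((2 - α) * c / 2) (-(1 + α) * c ^ 2)).involute c
        ((5 * α + 2) * c ^ 2 / 4)).toMap := by
  have him : α.im ≠ 0 := by
    have := im_ne_zero_of_sq (D := 7) (r := 2 * α - 1) (by norm_num)
      (by push_cast; linear_combination 4 * hα)
    simpa using this
  have h := isIsogeny_sqrt_seven hα him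
  set Λ := ofIm α him
  have hs : IsHalfPeriod Λ (α / 2) := by
    simpa using isHalfPeriod_ofIm (θ := α) (hθ := him) 0 1 (by norm_num)
  have hst : α / 2 + (1 - α) / 2 ∉ Λ.lattice := by
    rw [show α / 2 + (1 - α) / 2 = ((1 : ℤ) + (0 : ℤ) * α) / 2 by push_cast; ring]
    exact ofIm_half_notMem (by norm_num)
  have hts : (1 - α) / 2 + α / 2 ∉ Λ.lattice := by rwa [add_comm]
  obtain ⟨K, hK0, hK⟩ := h.half.exists_translation
  obtain ⟨K₀, hK₀0, hK₀⟩ := hs.exists_translation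
  have hL := isLattesMap_isogeny h hK0 hK
  -- The half period `α / 2` is fixed by `α` modulo the lattice, because `α ^ 2 / 2 = α / 2 - 1`.
  -- Hence all constants are expressed through the value of ℘ there.
  have hfix : Λ.weierstrassP (α * (α / 2)) = Λ.weierstrassP (α / 2) := by
    have h1 : (-1 : ℂ) ∈ Λ.lattice := mem_ofIm.2 ⟨-1, 0, by simp⟩
    rw [← Λ.weierstrassP_add_of_mem h1 (α / 2)]
    congr 1
    linear_combination hα / 2
  have h1 := h.apply_half hs hst
  have h2 := hK _ hs.notMem hst
  have h3 := hK₀ _ h.half.notMem hts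
  have hsum := h.half.sum_eq_zero hs hst
  rw [hfix] at h1
  rw [add_comm ((1 - α) / 2)] at h3
  have hF := fun z => h.toMap_isogeny hK0 hK z
  have hnd := nondeg_isogeny (e := Λ.weierstrassP ((1 - α) / 2)) h.ne_zero hK0
  -- The affine map `α * z + α / 2` descends as well, since translation by a half period acts on the
  -- sphere as an involution.
  have hL₂ : IsLattesMap ((isogeny α (Λ.weierstrassP ((1 - α) / 2)) K).involute
      (Λ.weierstrassP (α / 2)) K₀).toMap := by
    refine (hnd.involute _ hK₀0).isLattesMap (P := Λ.wp) (α := α) (β := α / 2) h.map_mem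
      Λ.isHolomorphic_wp (fun z _ hl => Λ.wp_add_of_mem hl z) Λ.wp_ne_const fun z => ?_
    obtain ⟨u, v, huv, hw⟩ := exists_eq_ofHom (Λ.wp z)
    have hFz := hF z
    rw [hw, toMap_ofHom _ huv] at hFz
    rw [hs.wp_add hK₀0 hK₀ (hnd.ne_zero huv) hFz.symm, hw, toMap_ofHom _ huv, num_involute,
      den_involute]
  set e := Λ.weierstrassP ((1 - α) / 2)
  set c := Λ.weierstrassP (α / 2)
  set x := Λ.weierstrassP (α / 2 + (1 - α) / 2)
  have hx : x = -c - e := by linear_combination hsum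
  have he : e = (2 - α) * c / 2 := by linear_combination h1 / 2 - c / 2 * hα
  have hKe : K = -(1 + α) * c ^ 2 := by
    rw [← h2, hx, he]; linear_combination c ^ 2 / 2 * hα
  have hKe₀ : K₀ = (5 * α + 2) * c ^ 2 / 4 := by
    rw [← h3, hx, he]; linear_combination (-c ^ 2 / 4) * hα
  refine ⟨c, ?_, ?_, ?_⟩
  · intro h0
    rw [h0] at hKe
    exact hK0 (by simpa using hKe)
  · rwa [← he, ← hKe]
  · rwa [← he, ← hKe, ← hKe₀]

/-- When the fixed points ∞ and `c` are placed at ∞ and 0, the map without translation becomes the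
normal form with both multipliers `α ^ 2 = α - 2`. The translation exchanges these points and
becomes z ↦ 1/z, so the second map is the inverse `G` of that normal form as a function. -/
theorem isLattesMap_sqrt_seven {α : ℂ} (hα : α ^ 2 = α - 2) :
    IsLattesMap (normalForm (-α) (α - 2)).toMap ∧ IsLattesMap (normalForm α (-α)).toMap := by
  obtain ⟨c, hc, hL, hL'⟩ := exists_isLattesMap_sqrt_seven hα
  have h3 : α ^ 3 = -α - 2 := by linear_combination (α + 1) * hα
  have h4 : α ^ 4 = -3 * α + 2 := by linear_combination (α ^ 2 + α - 1) * hα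
  have h5' : α ^ 5 = -α + 6 := by linear_combination (α ^ 3 + α ^ 2 - α - 3) * hα
  have ne_zero_of_mul : ∀ {x y : ℂ} {n : ℕ}, n ≠ 0 → x * y = n → x ≠ 0 := by
    rintro x y n hn h rfl
    rw [zero_mul] at h
    exact hn (by exact_mod_cast h.symm)
  have hα0 : α ≠ 0 := ne_zero_of_mul (y := 1 - α) (n := 2) (by norm_num)
    (by push_cast; linear_combination -hα)
  have hα1 : 1 + α ≠ 0 := ne_zero_of_mul (y := 2 - α) (n := 4) (by norm_num)
    (by push_cast; linear_combination -hα)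
  have hα2 : α + 2 ≠ 0 := ne_zero_of_mul (y := 3 - α) (n := 8) (by norm_num)
    (by push_cast; linear_combination -hα)
  have hα3 : α - 3 ≠ 0 := ne_zero_of_mul (y := -2 - α) (n := 8) (by norm_num)
    (by push_cast; linear_combination -hα)
  have hα4 : α - 1 ≠ 0 := ne_zero_of_mul (y := -α) (n := 2) (by norm_num)
    (by push_cast; linear_combination -hα)
  have hnd := nondeg_isogeny (e := (2 - α) * c / 2) (K := -(1 + α) * c ^ 2) hα0
    (mul_ne_zero (neg_ne_zero.2 hα1) (pow_ne_zero 2 hc))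
  have h5 : 5 * α + 2 ≠ 0 := ne_zero_of_mul (y := 7 - 5 * α) (n := 64) (by norm_num)
    (by push_cast; linear_combination -25 * hα)
  have hnd' := hnd.involute c (K := (5 * α + 2) * c ^ 2 / 4)
    (div_ne_zero (mul_ne_zero h5 (pow_ne_zero 2 hc)) (by norm_num))
  constructor
  · have hconj : IsConj (isogeny α ((2 - α) * c / 2) (-(1 + α) * c ^ 2)).toMap
        (normalForm (α - 2) (α - 2)).toMap := by
      refine isConj_of_hom (a := 1) (b := -c) (c := 0) (d := -(α + 2) * c / 2) hnd ?_ ?_ ?_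
      · simpa using ⟨fun h => hα2 (by linear_combination -h), hc⟩
      · intro u v
        simp only [num, den, normalForm, isogeny]
        ring_nf
        simp only [hα, h3]
        ring
      · intro u v
        simp only [num, den, normalForm, isogeny]
        ring_nf
        simp only [hα, h3, h4]
        ring
    have hne : (α - 2) * (α - 2) ≠ 1 := by
      intro h0
      have : (α - 1) * (α - 3) = 0 := by linear_combination h0
      exact mul_ne_zero hα4 hα3 this
    obtain ⟨hab, hc'⟩ := isConj_normalForm_third (a := α - 2) (b := α - 2) (c := -α) hne
      (fun h => hα3 (by linear_combination h))
      (by linear_combination (α - 3) * hα)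
    exact isLattesMap_normalForm (by rwa [mul_comm]) hL
      ((hconj.trans hc').trans (isConj_normalForm_swap hab))
  · set G : QuadMap := ⟨0, α - 2, 1, 1, α - 2, 0⟩ with hG
    have hconj : IsConj ((isogeny α ((2 - α) * c / 2) (-(1 + α) * c ^ 2)).involute c
        ((5 * α + 2) * c ^ 2 / 4)).toMap G.toMap := by
      refine isConj_of_hom (a := -(α + 2) * c / 2) (b := (α + 2) * c ^ 2 / 2) (c := 0)
        (d := (5 * α + 2) * c ^ 2 / 4) hnd' ?_ ?_ ?_
      · have : -(α + 2) * c / 2 * ((5 * α + 2) * c ^ 2 / 4) ≠ 0 :=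
          mul_ne_zero (div_ne_zero (mul_ne_zero (neg_ne_zero.2 hα2) hc) two_ne_zero)
            (div_ne_zero (mul_ne_zero h5 (pow_ne_zero 2 hc)) (by norm_num))
        simpa using this
      · intro u v
        rw [num_involute, den_involute]
        simp only [num, den, isogeny, hG]
        ring_nf
        simp only [hα, h3, h4, h5']
        ring
      · intro u v
        rw [num_involute, den_involute]
        simp only [num, den, isogeny, hG]
        ring_nf
        simp only [hα, h3, h4]
        ring
    have hGnd : G.Nondeg := by
      intro u v h1 h2
      simp only [num, den, hG] at h1 h2
      have := nondeg_normalForm (a := α - 2) (b := α - 2) ?_ u v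
        (by simp only [num, normalForm]; linear_combination h2)
        (by simp only [den, normalForm]; linear_combination h1)
      · exact this
      · intro h0
        have : (α - 1) * (α - 3) = 0 := by linear_combination h0
        exact mul_ne_zero hα4 hα3 this
    -- The fixed points of `G` are 1 and the roots of this polynomial.
    obtain ⟨w, hw⟩ : ∃ w : ℂ, w ^ 2 + (α - 1) * w + 1 = 0 := by
      obtain ⟨w, hw⟩ := exists_quadratic_root (a := 1) (b := α - 1) (c := 1) (by simp)
      exact ⟨w, by linear_combination hw⟩
    have hw1 : w + 1 ≠ 0 := by
      intro h0
      exact hα3 (by linear_combination (w + α - 2) * h0 - hw)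
    have hw2 : w - 1 ≠ 0 := by
      intro h0
      exact hα1 (by linear_combination (-w - α) * h0 + hw)
    obtain ⟨hab, hc'⟩ : α * -α ≠ 1 ∧ IsConj G.toMap (normalForm α (-α)).toMap := by
      refine isConj_normalForm (u₁ := 1 / (α - 1)) (v₁ := 1 / (α - 1))
        (u₂ := -w / (w + 1)) (v₂ := -1 / (w + 1)) hGnd ?_ ?_ ?_ ?_ ?_ ?_ ?_
      · have : -w / (w + 1) * (1 / (α - 1)) - 1 / (α - 1) * (-1 / (w + 1)) =
            -(w - 1) / ((w + 1) * (α - 1)) := by field_simp; ring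
        rw [this]
        exact div_ne_zero (neg_ne_zero.2 hw2) (mul_ne_zero hw1 hα4)
      · simp only [num, hG]; field_simp; ring
      · simp only [den, hG]; field_simp; ring
      · simp only [num, hG]; field_simp; linear_combination hw
      · simp only [den, hG]; field_simp; linear_combination hw
      · simp only [hG]; field_simp; linear_combination w * hα
      · simp only [hG]; field_simp; linear_combination hα
    exact isLattesMap_normalForm hab hL' (hconj.trans hc')

end QuadMap
end RSphere

/-! ### Identification of the models -/

namespace RSphere
namespace QuadMap

theorem toMap_eq_ratMap {F : QuadMap} {P Q : ℂ[X]} (hdeg : max P.natDegree Q.natDegree = 2)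
    (hp : P.coeff 2 = F.p₂) (hq : Q.coeff 2 = F.q₂) (hP : ∀ z, P.eval z = F.num z 1)
    (hQ : ∀ z, Q.eval z = F.den z 1) : F.toMap = ratMap P Q := by
  funext z
  induction z using OnePoint.rec with
  | infty => simp [ratMap, toMap, ofHom, hdeg, hp, hq]
  | coe z => simp [ratMap, toMap, ofHom, hP, hQ]

theorem toMap_sq : (⟨1, 0, 0, 0, 0, 1⟩ : QuadMap).toMap = ratMap (X ^ 2) 1 :=
  toMap_eq_ratMap (by simp) (by simp) (by simp [coeff_one]) (by simp [num]) (by simp [den])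

theorem toMap_inv_sq : (⟨0, 0, 1, 1, 0, 0⟩ : QuadMap).toMap = ratMap 1 (X ^ 2) :=
  toMap_eq_ratMap (by simp) (by simp [coeff_one]) (by simp) (by simp [num]) (by simp [den])

theorem toMap_chebyshev :
    (⟨1, 0, -2, 0, 0, 1⟩ : QuadMap).toMap = ratMap (Chebyshev.C ℂ (2 : ℕ)) 1 := by
  have h : Chebyshev.C ℂ (2 : ℕ) = X ^ 2 - C 2 := by
    rw [Nat.cast_ofNat, Chebyshev.C_two, map_ofNat C 2]
  rw [h]
  exact toMap_eq_ratMap (by simp) (by simp) (by simp [coeff_one])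
    (by simp [num, sub_eq_add_neg]) (by simp [den])

theorem isConj_normalForm_poly {a k : ℂ} (hk : k = a / 2 - a ^ 2 / 4) :
    IsConj (normalForm a 0).toMap (⟨1, 0, k, 0, 0, 1⟩ : QuadMap).toMap := by
  refine isConj_of_hom (a := 1) (b := a / 2) (c := 0) (d := 1) (nondeg_normalForm (by simp))
    (by simp) (fun u v => ?_) (fun u v => ?_)
  · simp only [num, den, normalForm, hk]; ring
  · simp only [num, den, normalForm]; ring

theorem isConj_normalForm_inv_sq :
    IsConj (normalForm (-2) (-2)).toMap (⟨0, 0, 1, 1, 0, 0⟩ : QuadMap).toMap := by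
  -- The fixed points of 1/z² are the cube roots of unity, and the vectors `(1, 1)` and `(w, w ^ 2)`
  -- are themselves fixed.
  obtain ⟨w, hw⟩ := exists_quadratic_root (a := 1) (b := 1) (c := 1) (by simp)
  refine (isConj_normalForm (u₁ := 1) (v₁ := 1) (u₂ := w) (v₂ := w ^ 2) ?_ ?_ ?_ ?_ ?_ ?_ ?_
    ?_).2.symm
  · intro u v h1 h2
    simp only [num, den] at h1 h2
    exact ⟨by simpa using h2, by simpa using h1⟩
  · intro h0
    have : (3 : ℂ) = 0 := by linear_combination 4 * hw - (2 * w + 1) * h0 - (2 * w + 1) * hw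
    norm_num at this
  all_goals simp only [num, den]
  · ring
  · ring
  · linear_combination (w ^ 2 - w) * hw
  · ring
  · linear_combination 2 * hw
  · linear_combination 2 * hw

end QuadMap

open QuadMap

/-- For polynomials, `a / 2 - a ^ 2 / 4` is 0 when `a` is 0 or 2, and -2 when `a` is 4 or -2: these
are the multipliers at the finite fixed points of z² and of z² - 2. The pair (-2, -2) is 1/z², and
the other entries come from the three lattices. -/
theorem IsModelPair.isSpecial {f : RSphere → RSphere} {a b : ℂ} (h : IsModelPair a b)
    (hf : IsRationalMap 2 f) (hc : IsConj f (normalForm a b).toMap) :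
    IsPowerMap f ∨ IsChebyshevMap f ∨ IsLattesMap f := by
  obtain ⟨e, he, r, hr, ha, hb⟩ := h
  have sq : ∀ {a : ℂ}, 0 = a / 2 - a ^ 2 / 4 → IsConj f (normalForm a 0).toMap → IsPowerMap f :=
    fun h hc => ⟨2, le_rfl, hf, Or.inl (toMap_sq ▸ hc.trans (isConj_normalForm_poly h))⟩
  have cheb : ∀ {a : ℂ}, -2 = a / 2 - a ^ 2 / 4 → IsConj f (normalForm a 0).toMap →
      IsChebyshevMap f :=
    fun h hc => ⟨2, le_rfl, hf, Or.inl (toMap_chebyshev ▸ hc.trans (isConj_normalForm_poly h))⟩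
  have lattes : ∀ {a' b' : ℂ}, IsLattesMap (normalForm a' b').toMap → a = a' → b = b' →
      IsPowerMap f ∨ IsChebyshevMap f ∨ IsLattesMap f := by
    rintro _ _ h rfl rfl
    exact Or.inr (Or.inr (h.of_isConj hf hc))
  simp only [NormalFormCert.special, List.mem_cons, List.not_mem_nil, or_false] at he
  rcases he with rfl | rfl | rfl | rfl | rfl | rfl | rfl | rfl | rfl | rfl | rfl <;>
    simp only [ZRoot.toC] at ha hb <;> push_cast at ha hb hr
  · obtain rfl : a = 0 := by linear_combination ha / 2
    obtain rfl : b = 0 := by linear_combination hb / 2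
    exact Or.inl (sq (by norm_num) hc)
  · obtain rfl : a = 2 := by linear_combination ha / 2
    obtain rfl : b = 0 := by linear_combination hb / 2
    exact Or.inl (sq (by norm_num) hc)
  · obtain rfl : a = -2 := by linear_combination ha / 2
    obtain rfl : b = -2 := by linear_combination hb / 2
    exact Or.inl ⟨2, le_rfl, hf, Or.inr (toMap_inv_sq ▸ hc.trans isConj_normalForm_inv_sq)⟩
  · obtain rfl : a = 4 := by linear_combination ha / 2
    obtain rfl : b = 0 := by linear_combination hb / 2
    exact Or.inr (Or.inl (cheb (by norm_num) hc))
  · obtain rfl : a = -2 := by linear_combination ha / 2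
    obtain rfl : b = 0 := by linear_combination hb / 2
    exact Or.inr (Or.inl (cheb (by norm_num) hc))
  · exact lattes (isLattesMap_sqrt_one hr).2.2 (by linear_combination ha / 2)
      (by linear_combination hb / 2)
  · exact lattes (isLattesMap_sqrt_one hr).1 (by linear_combination ha / 2)
      (by linear_combination hb / 2)
  · exact lattes (isLattesMap_sqrt_one hr).2.1 (by linear_combination ha / 2)
      (by linear_combination hb / 2)
  · exact lattes (isLattesMap_sqrt_two hr) (by linear_combination ha / 2)
      (by linear_combination hb / 2)
  · have hα : ((1 + r) / 2) ^ 2 = (1 + r) / 2 - 2 := by linear_combination hr / 4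
    exact lattes (isLattesMap_sqrt_seven hα).1 (by linear_combination ha / 2)
      (by linear_combination hb / 2)
  · have hα : ((1 + r) / 2) ^ 2 = (1 + r) / 2 - 2 := by linear_combination hr / 4
    exact lattes (isLattesMap_sqrt_seven hα).2 (by linear_combination ha / 2)
      (by linear_combination hb / 2)

end RSphere

end

theorem theorem1 (D : ℕ) (hD : 0 < D) (hsq : Squarefree D) (f : RSphere → RSphere)
    (hf : RSphere.IsRationalMap 2 f)
    (hmult : ∀ a ∈ Function.periodicPts f, Function.minimalPeriod f a ≤ 5 →
      RSphere.multiplier f a ∈ imQuadInt D) :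
    RSphere.IsPowerMap f ∨ RSphere.IsChebyshevMap f ∨ RSphere.IsLattesMap f := by
  obtain ⟨F, hF, rfl⟩ := hf.exists_quadMap
  obtain ⟨a, b, -, hab, hc⟩ := hF.hasModel hD hsq hmult
  exact hab.isSpecial hf hc
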